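/- Let $\nu\in\{1,-1\}$, $\gamma>0$, and let $\mathcal L=\nu I+\gamma\mathcal B$ on $L^2(\mathbb R^2)$, where $\widehat{\mathcal B f}(\xi)=\frac{\xi_1^2}{\xi_1^2+\xi_2^2}\hat f(\xi)$. Let $C_{opt}$ denote the optimal (smallest) constant $C$ such that $$\int_{\mathbb R^2}\mathcal L(|v|^2)\,|v|^2\,dx\le C\,\|\nabla v\|_2^2\,\|v\|_2^2\qquad\text{for all }v\in H^1(\mathbb R^2).$$ Let $u\in C([0,T^*);H^1(\mathbb R^2))\cap C^1([0,T^*);H^{-1}(\mathbb R^2))$ be a solution of the elliptic-elliptic Davey–Stewartson system $$iu_t+\Delta u+\mathcal L(|u|^2)u=0\quad\text{on }[0,T^*)\times\mathbb R^2$$ which blows up at the finite time $T^*>0$, i.e. $\|u(t)\|_{H^1}\to\infty$ as $t\uparrow T^*$. Then $C_{opt}>0$, and: (a) If $\lambda:[0,T^*)\to(0,\infty)$ is any function with $\lambda(t)\|\nabla u(t)\|_2\to+\infty$ as $t\uparrow T^*$, then there are points $y(t)\in\mathbb R^2$ such that $$\liminf_{t\uparrow T^*}\int_{|x-y(t)|\le\lambda(t)}|u(t,x)|^2\,dx\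 \ge\ \frac{2}{C_{opt}}.$$ (b) (Nearly parabolic concentration.) The conclusion of (a) holds in particular for every function $\lambda:[0,T^*)\to(0,\infty)$ such that, for some $\varepsilon>0$ and $c>0$, $\lambda(t)\ge c\,(T^*-t)^{1/2-\varepsilon}$ for all $t<T^*$ close to $T^*$. -/

import Mathlib

open MeasureTheory Filter Topology
open scoped FourierTransform SchwartzMap LineDeriv ComplexConjugate ENNReal

noncomputable section

namespace DaveyStewartson

/-- The Euclidean plane. -/
abbrev Plane : Type := EuclideanSpace ℝ (Fin 2)

/-- The Hilbert space of complex square integrable functions on the plane. -/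
abbrev L2 : Type := Lp ℂ 2 (volume : Measure Plane)

/-- The Sobolev space `H^1` of the plane, realised as the set of all pairs `(v, g)`, where `v` and
the two components of `g` are square integrable and `g j` is the `j`-th partial derivative of `v`
in the sense of (tempered) distributions. As a subspace of a Hilbert sum it carries the norm
`(‖v‖₂ ^ 2 + ‖∂₁ v‖₂ ^ 2 + ‖∂₂ v‖₂ ^ 2) ^ (1/2)`. -/
def sobolevOne : Submodule ℂ (WithLp 2 (L2 × PiLp 2 (fun _ : Fin 2 => L2))) where
  carrier := {w | ∀ j : Fin 2,
    ∂_{EuclideanSpace.single j (1 : ℝ)} (w.fst : 𝓢'(Plane, ℂ)) = (w.snd j : 𝓢'(Plane, ℂ))}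
  add_mem' := by
    intro a b ha hb j
    have ha' := ha j
    have hb' := hb j
    simp only [← Lp.toTemperedDistributionCLM_apply] at ha' hb' ⊢
    simp only [WithLp.add_fst, WithLp.add_snd, PiLp.add_apply, map_add,
      LineDeriv.lineDerivOp_add, ha', hb']
  zero_mem' := by
    intro j
    simp only [← Lp.toTemperedDistributionCLM_apply, WithLp.zero_fst, WithLp.zero_snd,
      PiLp.zero_apply, map_zero, LineDeriv.lineDerivOp_zero]
  smul_mem' := by
    intro c a ha j
    have ha' := ha j
    simp only [← Lp.toTemperedDistributionCLM_apply] at ha' ⊢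
    simp only [WithLp.smul_fst, WithLp.smul_snd, PiLp.smul_apply, map_smul,
      LineDeriv.lineDerivOp_smul, ha']

/-- The Sobolev space `H^1` as a (normed) space. -/
def H1 : Type := sobolevOne

instance : NormedAddCommGroup H1 := inferInstanceAs (NormedAddCommGroup sobolevOne)

instance : InnerProductSpace ℂ H1 := inferInstanceAs (InnerProductSpace ℂ sobolevOne)

/-- The pair `(v, ∇ v)` of an element `v` of `H^1`. -/
def H1.pairL : H1 →ₗᵢ[ℂ] WithLp 2 (L2 × PiLp 2 (fun _ : Fin 2 => L2)) :=
  sobolevOne.subtypeₗᵢ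

/-- The function underlying an element of `H^1`. -/
def H1.fn (v : H1) : L2 := v.pairL.fst

/-- The gradient of an element of `H^1`; its norm is the `L^2` norm `‖∇ v‖₂`. -/
def H1.grad (v : H1) : PiLp 2 (fun _ : Fin 2 => L2) := v.pairL.snd

/-- The inclusion of `H^1` into `L^2`. -/
def H1.fnL : H1 →L[ℂ] L2 :=
  (WithLp.fstL 2 ℂ L2 (PiLp 2 (fun _ : Fin 2 => L2))).comp H1.pairL.toContinuousLinearMap

/-- The dual space `H^{-1}` of `H^1`: an element `F` acts on `φ` as `∫ F (conj φ)`. -/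
abbrev Hneg1 : Type := H1 →L⋆[ℂ] ℂ

/-- The inclusion of `L^2` into `H^{-1}`, sending `f` to the functional `φ ↦ ∫ f (conj φ)`. -/
def toHneg1 (f : L2) : Hneg1 := (innerSLFlip ℂ f).comp H1.fnL

/-- The symbol `ξ₁² / (ξ₁² + ξ₂²)` of the operator `B`. -/
def symbolB (ξ : Plane) : ℝ := ξ 0 ^ 2 / (ξ 0 ^ 2 + ξ 1 ^ 2)

theorem memLp_symbolB_mul (f : L2) :
    MemLp (fun ξ => (symbolB ξ : ℂ) * f ξ) 2 (volume : Measure Plane) := by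
  refine (Lp.memLp f).of_le ?_ (Eventually.of_forall fun ξ => ?_)
  · refine AEStronglyMeasurable.mul ?_ (Lp.aestronglyMeasurable f)
    have h : Measurable symbolB := by
      unfold symbolB
      fun_prop
    exact (Complex.measurable_ofReal.comp h).aestronglyMeasurable
  · rw [norm_mul]
    refine mul_le_of_le_one_left (norm_nonneg _) ?_
    have h0 : 0 ≤ symbolB ξ := by
      unfold symbolB
      positivity
    rw [Complex.norm_real, Real.norm_of_nonneg h0]
    unfold symbolB
    exact div_le_one_of_le₀ (by nlinarith [sq_nonneg (ξ 1)]) (by positivity)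

/-- The Fourier multiplier `B` on `L^2` with symbol `ξ₁² / (ξ₁² + ξ₂²)`. (The symbol is homogeneous
of degree zero, so the normalisation of the Fourier transform is immaterial.) -/
def opB (f : L2) : L2 := 𝓕⁻ ((memLp_symbolB_mul (𝓕 f)).toLp _)

/-- The operator `ν I + γ B` on `L^2`. -/
def opL (ν γ : ℝ) (f : L2) : L2 := (ν : ℂ) • f + (γ : ℂ) • opB f

open Classical in
/-- The function `|f|²` as an element of `L^2`. It belongs to `L^2` exactly when `f` is in `L^4`, in
particular for every `f` in `H^1`; the value zero for all other `f` plays no role. -/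
def absSq (f : L2) : L2 :=
  if h : MemLp (fun x => ((‖f x‖ ^ 2 : ℝ) : ℂ)) 2 (volume : Measure Plane) then h.toLp _ else 0

/-- The quartic functional `∫ L(|v|²) |v|² dx`, where `L = ν I + γ B`. (`L(|v|²)` is real.) -/
def quartic (ν γ : ℝ) (v : H1) : ℝ :=
  ∫ x, (opL ν γ (absSq v.fn) x).re * ‖v.fn x‖ ^ 2

/-- The optimal constant `C` in `∫ L(|v|²) |v|² dx ≤ C ‖∇ v‖₂² ‖v‖₂²` over all `v` in `H^1`. -/
def Copt (ν γ : ℝ) : ℝ :=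
  sInf {C : ℝ | ∀ v : H1, quartic ν γ v ≤ C * ‖v.grad‖ ^ 2 * ‖v.fn‖ ^ 2}

/-- `u` is a solution of `i u_t + Δ u + L(|u|²) u = 0` on `[0, T)`, of class
`C([0,T); H^1) ∩ C^1([0,T); H^{-1})`, the equation being satisfied in `H^{-1}`, that is, after
pairing with every `φ` in `H^1`. The values of `u` outside `[0, T)` play no role. -/
def IsSolution (ν γ T : ℝ) (u : ℝ → H1) : Prop :=
  ContinuousOn u (Set.Ico 0 T) ∧
  ∃ du : ℝ → Hneg1, ContinuousOn du (Set.Ico 0 T) ∧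
    ∀ t ∈ Set.Ico 0 T,
      HasDerivWithinAt (fun s => toHneg1 (u s).fn) (du t) (Set.Ico 0 T) t ∧
      ∀ φ : H1,
        Complex.I * du t φ - ∑ j, inner ℂ (φ.grad j) ((u t).grad j)
          + ∫ x, opL ν γ (absSq (u t).fn) x * (u t).fn x * conj (φ.fn x) = 0

/-- `u` is a solution in `H^1` which blows up at the finite time `T`: it is a solution on `[0, T)`,
and its `H^1` norm tends to infinity as `t ↑ T`. -/
def IsBlowUpSolution (ν γ T : ℝ) (u : ℝ → H1) : Prop :=
  0 < T ∧ IsSolution ν γ T u ∧ Tendsto (fun t => ‖u t‖) (𝓝[<] T) atTop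

/-- The mass `∫_{|x - y| ≤ r} |f(x)|² dx`, as an extended nonnegative number. -/
def massIn (f : L2) (y : Plane) (r : ℝ) : ℝ≥0∞ :=
  ∫⁻ x in Metric.closedBall y r, ‖f x‖ₑ ^ 2

end DaveyStewartson

end

noncomputable section

namespace DaveyStewartson

/-! ### The Fourier transform on `L²` -/

/-! Write Q(v) = ∫ L(|v|²)|v|² and E(v) = ‖∇v‖²/2 − Q(v)/4. Conservation of mass turns blow-up in H¹
into ‖∇u‖ → ∞, and conservation of energy then gives Q(u(t))/‖∇u(t)‖² → 2. So Q is eventually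
positive, which forces C_opt > 0, and it remains to see that Q cannot be that large unless some disc
carries mass close to 2/C_opt.

Concentration. Suppose every disc of radius R has mass at most μ. The optimal inequality is applied
to v times a cutoff χ of radius R centred at y, and integrated over all y. The local terms average
exactly, and differentiating the cutoff costs a factor R⁻². The operator B is nonlocal, but
Plancherel in y shows that the averaged term is the original one with the symbol σ(ξ) replaced by an
average of σ(ξ+ζ) with weight |η̂(ζ)|², where η = |χ|² and the first moment of the weight is of
relative size 1/R. As σ is homogeneous of degree zero, it varies by at most |ζ|/δ off the disc |ξ| ≤
δ, while that disc contributes at most a multiple of δ²‖v‖₂⁴. With X = R‖∇v‖ and δ = ‖∇v‖/√X all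
errors are o(‖∇v‖²) as X → ∞. Up to a factor near one from the shape of the cutoff, Q(v) ≤ (C_opt μ
+ o(1))‖∇v‖², so μ cannot stay below 2/C_opt (`averaged_inequality`, `exists_concentration_bound`,
`concentration`). No compactness argument is needed.

Energy. The solution is too rough for the equation to be tested with u_t. The sharp frequency
truncation a = P_k u at 2^k is differentiable in H¹, and the derivative of its energy is only the
mismatch between the nonlinearities of u and of a. This is at most k times `dyadicSize`, plus a term
O(k²2⁻ᵏ); the factor k is the logarithmic failure of H¹ ⊂ L^∞. The time integrals b_k of
`dyadicSize` are summable because the dyadic pieces add up to at most a multiple of ‖∇u‖², and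
divergence of the harmonic series makes k b_k small for infinitely many k. Along these k the energy
of the truncations becomes constant (`exists_truncation_bound`, `exists_energy_deriv_bound`,
`IsWeakDerivative.energy_eq`).

Rate. While ‖∇u‖ grows from g to 2g, energy conservation changes Q by exactly 6g². Since Q is Hölder
continuous of order 1/2 for the L² norm on bounded sets of H¹, u must move by a fixed amount in L²,
and the equation, read in H⁻¹, needs a time at least c/g² for that (`IsWeakDerivative.exists_rate`).
Hence ‖∇u‖ ≥ c(T−t)^(−1/2), and part (b) is a case of part (a). -/

theorem ae_eq_of_integral_schwartz {f g : Plane → ℂ} (hf : LocallyIntegrable f)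
    (hg : LocallyIntegrable g)
    (h : ∀ φ : 𝓢(Plane, ℂ), ∫ x, φ x * f x = ∫ x, φ x * g x) : f =ᵐ[volume] g := by
  refine ae_eq_of_integral_contDiff_smul_eq hf hg fun φ hφ hc => ?_
  have hg₁ : HasCompactSupport (Complex.ofRealCLM ∘ φ) := hc.comp_left rfl
  have hg₂ : ContDiff ℝ ((⊤ : ℕ∞) : WithTop ℕ∞) (Complex.ofRealCLM ∘ φ) := by fun_prop
  simpa using h (hg₁.toSchwartzMap hg₂)

theorem locallyIntegrable_L2 (f : L2) : LocallyIntegrable f :=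
  (Lp.memLp f).locallyIntegrable (by norm_num)

theorem integral_fourier_mul_schwartz (φ : 𝓢(Plane, ℂ)) {f : Plane → ℂ} (hf : Integrable f) :
    ∫ x, 𝓕 φ x * f x = ∫ x, φ x * 𝓕 f x := by
  simpa using! VectorFourier.integral_bilin_fourierIntegral_eq_flip (ContinuousLinearMap.mul ℂ ℂ)
    (L := innerₗ Plane) Real.continuous_fourierChar continuous_inner φ.integrable hf

theorem integral_fourierInv_mul_schwartz (φ : 𝓢(Plane, ℂ)) {f : Plane → ℂ} (hf : Integrable f) :
    ∫ x, 𝓕⁻ φ x * f x = ∫ x, φ x * 𝓕⁻ f x := by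
  have h := integral_fourier_mul_schwartz φ hf.comp_neg
  rw [← integral_neg_eq_self] at h
  simp only [neg_neg] at h
  convert h using 3 with x x
  · rw [SchwartzMap.fourierInv_coe, SchwartzMap.fourier_coe, Real.fourierInv_eq_fourier_neg]
  · rw [Real.fourierInv_eq_fourier_comp_neg]

theorem integral_schwartz_mul_fourier (φ : 𝓢(Plane, ℂ)) (f : L2) :
    ∫ x, φ x * (𝓕 f : L2) x = ∫ x, 𝓕 φ x * f x := by
  have h := congrArg (fun T : 𝓢'(Plane, ℂ) => T φ) (Lp.fourier_toTemperedDistribution_eq f)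
  simpa [TemperedDistribution.fourier_apply] using h.symm

theorem integral_schwartz_mul_fourierInv (φ : 𝓢(Plane, ℂ)) (f : L2) :
    ∫ x, φ x * (𝓕⁻ f : L2) x = ∫ x, 𝓕⁻ φ x * f x := by
  have h := congrArg (fun T : 𝓢'(Plane, ℂ) => T φ) (Lp.fourierInv_toTemperedDistribution_eq f)
  simpa [TemperedDistribution.fourierInv_apply] using h.symm

theorem continuous_fourier {f : Plane → ℂ} (hf : Integrable f) : Continuous (𝓕 f) :=
  VectorFourier.fourierIntegral_continuous Real.continuous_fourierChar
    (by exact continuous_inner) hf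

theorem continuous_fourierInv {f : Plane → ℂ} (hf : Integrable f) : Continuous (𝓕⁻ f) := by
  rw [Real.fourierInv_eq_fourier_comp_neg]
  exact continuous_fourier hf.comp_neg

theorem norm_fourier_le {f : Plane → ℂ} (ξ : Plane) : ‖𝓕 f ξ‖ ≤ ∫ x, ‖f x‖ :=
  VectorFourier.norm_fourierIntegral_le_integral_norm _ _ _ _ _

theorem norm_fourierInv_le {f : Plane → ℂ} (ξ : Plane) : ‖𝓕⁻ f ξ‖ ≤ ∫ x, ‖f x‖ := by
  rw [Real.fourierInv_eq_fourier_neg]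
  exact norm_fourier_le _

/-- The `L²` Fourier transform is given by the integral on `L¹ ∩ L²`. -/
theorem fourier_ae_eq (f : L2) (hf : Integrable f) : (𝓕 f : L2) =ᵐ[volume] 𝓕 (f : Plane → ℂ) :=
  ae_eq_of_integral_schwartz (locallyIntegrable_L2 _) (continuous_fourier hf).locallyIntegrable
    fun φ => by rw [integral_schwartz_mul_fourier, integral_fourier_mul_schwartz φ hf]

theorem fourierInv_ae_eq (f : L2) (hf : Integrable f) :
    (𝓕⁻ f : L2) =ᵐ[volume] 𝓕⁻ (f : Plane → ℂ) :=
  ae_eq_of_integral_schwartz (locallyIntegrable_L2 _) (continuous_fourierInv hf).locallyIntegrable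
    fun φ => by rw [integral_schwartz_mul_fourierInv, integral_fourierInv_mul_schwartz φ hf]

/-- Only integrability of `h` is asked, which is what a convolution of two integrable transforms
provides; this is used for the transform of |a|². -/
theorem fourier_ae_eq_of_fourierInv (f : L2) {h : Plane → ℂ} (hh : Integrable h)
    (hf : 𝓕⁻ h =ᵐ[volume] f) : (𝓕 f : L2) =ᵐ[volume] h := by
  refine ae_eq_of_integral_schwartz (locallyIntegrable_L2 _) hh.locallyIntegrable fun φ => ?_
  rw [integral_schwartz_mul_fourier]
  have h1 := integral_fourierInv_mul_schwartz (𝓕 φ) hh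
  rw [FourierTransform.fourierInv_fourier_eq] at h1
  rw [h1]
  refine integral_congr_ae ?_
  filter_upwards [hf] with x hx
  rw [hx]

/-- The source of every pointwise bound below: H¹ of the plane does not embed in L^∞, so sup norms
are controlled through the L¹ norm of the transform. -/
theorem norm_le_of_integrable_fourier (f : L2) (hf : Integrable (𝓕 f : L2)) :
    ∀ᵐ x, ‖f x‖ ≤ ∫ ξ, ‖(𝓕 f : L2) ξ‖ := by
  have h := fourierInv_ae_eq (𝓕 f) hf
  rw [FourierTransform.fourierInv_fourier_eq] at h
  filter_upwards [h] with x hx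
  rw [hx]
  exact norm_fourierInv_le x

/-- `g` is the `j`-th weak derivative of `f` iff `ĝ = 2πi ξ_j f̂`. -/
theorem lineDeriv_eq_iff_fourier (f g : L2) (j : Fin 2) :
    ∂_{EuclideanSpace.single j (1 : ℝ)} (f : 𝓢'(Plane, ℂ)) = (g : 𝓢'(Plane, ℂ)) ↔
      (𝓕 g : L2) =ᵐ[volume] fun ξ => 2 * Real.pi * Complex.I * (ξ j : ℂ) * (𝓕 f : L2) ξ := by
  have htg : (fun ξ : Plane => inner ℝ ξ (EuclideanSpace.single j (1 : ℝ))).HasTemperateGrowth := by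
    fun_prop
  have htg' : (fun ξ : Plane =>
      ((inner ℝ ξ (EuclideanSpace.single j (1 : ℝ)) : ℝ) : ℂ)).HasTemperateGrowth := by
    fun_prop
  have key : ∀ φ : 𝓢(Plane, ℂ),
      𝓕 (∂_{EuclideanSpace.single j (1 : ℝ)} (f : 𝓢'(Plane, ℂ))) φ
        = ∫ ξ, φ ξ * (2 * Real.pi * Complex.I * (ξ j : ℂ) * (𝓕 f : L2) ξ) := by
    intro φ
    rw [TemperedDistribution.fourier_lineDerivOp_eq, Lp.fourier_toTemperedDistribution_eq]
    simp only [smul_apply, TemperedDistribution.smulLeftCLM_apply_apply,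
      Lp.toTemperedDistribution_apply]
    rw [smul_eq_mul, ← integral_const_mul]
    congr 1
    ext ξ
    rw [SchwartzMap.smulLeftCLM_apply_apply htg']
    simp only [smul_eq_mul, EuclideanSpace.inner_single_right]
    simp
    ring
  have hli : LocallyIntegrable
      fun ξ : Plane => 2 * Real.pi * Complex.I * (ξ j : ℂ) * (𝓕 f : L2) ξ := by
    refine (locallyIntegrable_L2 (𝓕 f)).continuous_smul
      (g := fun ξ : Plane => 2 * Real.pi * Complex.I * (ξ j : ℂ)) ?_
    fun_prop
  constructor
  · intro h
    refine ae_eq_of_integral_schwartz (locallyIntegrable_L2 _) hli fun φ => ?_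
    rw [← key φ, h, Lp.fourier_toTemperedDistribution_eq]
    simp
  · intro h
    have : 𝓕 (∂_{EuclideanSpace.single j (1 : ℝ)} (f : 𝓢'(Plane, ℂ))) = 𝓕 (g : 𝓢'(Plane, ℂ)) := by
      ext φ
      rw [key φ, Lp.fourier_toTemperedDistribution_eq, Lp.toTemperedDistribution_apply]
      refine integral_congr_ae ?_
      filter_upwards [h] with ξ hξ
      rw [hξ, smul_eq_mul]
    have h2 := congrArg (fun T => 𝓕⁻ T) this
    simpa using h2

/-! ### The space `H¹` on the Fourier side -/

theorem norm_L2_sq (f : L2) : ‖f‖ ^ 2 = ∫ x, ‖f x‖ ^ 2 := by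
  have h := L2.inner_def (𝕜 := ℂ) f f
  rw [inner_self_eq_norm_sq_to_K] at h
  have h2 : (∫ x, inner ℂ (f x) (f x) : ℂ) = ((∫ x, ‖f x‖ ^ 2 : ℝ) : ℂ) := by
    rw [← integral_complex_ofReal]
    congr 1
    ext x
    rw [inner_self_eq_norm_sq_to_K]
    simp
  rw [h2] at h
  refine Complex.ofReal_injective ?_
  simpa using h

theorem integrable_norm_sq (f : L2) : Integrable fun x => ‖f x‖ ^ 2 :=
  (Lp.memLp f).integrable_norm_pow (by norm_num)

theorem norm_L2_le_of_ae {f g : L2} {C : ℝ} (h : ∀ᵐ x, ‖f x‖ ≤ C * ‖g x‖) : ‖f‖ ≤ C * ‖g‖ :=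
  Lp.norm_le_mul_norm_of_ae_le_mul h

theorem inner_L2_def (f g : L2) : inner ℂ f g = ∫ x, conj (f x) * g x := by
  rw [L2.inner_def]
  congr 1
  ext x
  rw [RCLike.inner_apply, mul_comm]

theorem integrable_conj_mul (f g : L2) : Integrable fun x => conj (f x) * g x := by
  have h := L2.integrable_inner (𝕜 := ℂ) f g
  refine h.congr (Eventually.of_forall fun x => ?_)
  simp only [RCLike.inner_apply, mul_comm]

/-! ### Bounded Fourier multipliers on L². -/

theorem memLp_bounded_mul {σ : Plane → ℂ} {C : ℝ} (hσ : Measurable σ) (hC : ∀ ξ, ‖σ ξ‖ ≤ C)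
    (f : L2) : MemLp (fun ξ => σ ξ * f ξ) 2 (volume : Measure Plane) :=
  (Lp.memLp f).of_le_mul (c := C) (hσ.aestronglyMeasurable.mul (Lp.aestronglyMeasurable f))
    (Eventually.of_forall fun ξ => by
      rw [norm_mul]
      exact mul_le_mul_of_nonneg_right (hC ξ) (norm_nonneg _))

/-- Multiplication by a bounded measurable function on `L²`. -/
def mulL (σ : Plane → ℂ) {C : ℝ} (hσ : Measurable σ) (hC : ∀ ξ, ‖σ ξ‖ ≤ C) : L2 →L[ℂ] L2 :=
  have hm := fun f : L2 => memLp_bounded_mul hσ hC f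
  LinearMap.mkContinuous
    { toFun := fun f => (hm f).toLp _
      map_add' := fun f g => by
        rw [← MemLp.toLp_add]
        refine MemLp.toLp_congr _ _ ?_
        filter_upwards [Lp.coeFn_add f g] with x hx
        simp only [hx, Pi.add_apply]
        ring
      map_smul' := fun c f => by
        rw [RingHom.id_apply, ← MemLp.toLp_const_smul]
        refine MemLp.toLp_congr _ _ ?_
        filter_upwards [Lp.coeFn_smul c f] with x hx
        simp only [hx, Pi.smul_apply, smul_eq_mul]
        ring } C fun f => norm_L2_le_of_ae (by
          filter_upwards [(hm f).coeFn_toLp] with x hx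
          rw [LinearMap.coe_mk, AddHom.coe_mk, hx, norm_mul]
          exact mul_le_mul_of_nonneg_right (hC x) (norm_nonneg _))

theorem mulL_ae (σ : Plane → ℂ) {C : ℝ} (hσ : Measurable σ) (hC : ∀ ξ, ‖σ ξ‖ ≤ C) (f : L2) :
    mulL σ hσ hC f =ᵐ[volume] fun ξ => σ ξ * f ξ :=
  (memLp_bounded_mul hσ hC f).coeFn_toLp

/-- The Fourier multiplier with a bounded measurable symbol. -/
def multL (σ : Plane → ℂ) {C : ℝ} (hσ : Measurable σ) (hC : ∀ ξ, ‖σ ξ‖ ≤ C) : L2 →L[ℂ] L2 :=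
  ((Lp.fourierTransformₗᵢ Plane ℂ).symm.toContinuousLinearEquiv : L2 →L[ℂ] L2) ∘L mulL σ hσ hC ∘L
    ((Lp.fourierTransformₗᵢ Plane ℂ).toContinuousLinearEquiv : L2 →L[ℂ] L2)

theorem multL_apply (σ : Plane → ℂ) {C : ℝ} (hσ : Measurable σ) (hC : ∀ ξ, ‖σ ξ‖ ≤ C) (f : L2) :
    multL σ hσ hC f = 𝓕⁻ (mulL σ hσ hC (𝓕 f)) := rfl

theorem fourier_multL_ae (σ : Plane → ℂ) {C : ℝ} (hσ : Measurable σ) (hC : ∀ ξ, ‖σ ξ‖ ≤ C)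
    (f : L2) : (𝓕 (multL σ hσ hC f) : L2) =ᵐ[volume] fun ξ => σ ξ * (𝓕 f : L2) ξ := by
  rw [multL_apply, FourierTransform.fourier_fourierInv_eq]
  exact mulL_ae σ hσ hC _

theorem fourier_injective {f g : L2} (h : (𝓕 f : L2) =ᵐ[volume] (𝓕 g : L2)) : f = g := by
  have := congrArg (fun T : L2 => (𝓕⁻ T : L2)) (Lp.ext h)
  simpa using this

theorem fourier_add_ae (f g : L2) :
    (𝓕 (f + g) : L2) =ᵐ[volume] fun ξ => (𝓕 f : L2) ξ + (𝓕 g : L2) ξ := by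
  rw [FourierTransform.fourier_add]
  exact Lp.coeFn_add _ _

theorem fourier_sub_ae (f g : L2) :
    (𝓕 (f - g) : L2) =ᵐ[volume] fun ξ => (𝓕 f : L2) ξ - (𝓕 g : L2) ξ := by
  have : (𝓕 (f - g) : L2) = 𝓕 f - 𝓕 g := (Lp.fourierTransformₗᵢ Plane ℂ).map_sub f g
  rw [this]
  exact Lp.coeFn_sub _ _

theorem fourier_smul_ae (c : ℂ) (f : L2) :
    (𝓕 (c • f) : L2) =ᵐ[volume] fun ξ => c * (𝓕 f : L2) ξ := by
  rw [FourierTransform.fourier_smul]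
  exact Lp.coeFn_smul _ _

namespace H1

/-- The element of `H¹` with given function and gradient. -/
def ofFourier (f : L2) (g : Fin 2 → L2) (h : ∀ j, (𝓕 (g j) : L2) =ᵐ[volume]
    fun ξ => 2 * Real.pi * Complex.I * (ξ j : ℂ) * (𝓕 f : L2) ξ) : H1 :=
  ⟨WithLp.toLp 2 (f, WithLp.toLp 2 g), fun j => (lineDeriv_eq_iff_fourier f (g j) j).2 (h j)⟩

@[simp] theorem fn_ofFourier (f : L2) (g : Fin 2 → L2) (h) : (ofFourier f g h).fn = f := rfl

@[simp] theorem grad_ofFourier (f : L2) (g : Fin 2 → L2) (h) (j : Fin 2) :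
    (ofFourier f g h).grad j = g j := rfl

theorem fourier_grad (v : H1) (j : Fin 2) : (𝓕 (v.grad j) : L2) =ᵐ[volume]
    fun ξ => 2 * Real.pi * Complex.I * (ξ j : ℂ) * (𝓕 v.fn : L2) ξ :=
  (lineDeriv_eq_iff_fourier v.fn (v.grad j) j).1 (v.2 j)

@[simp] theorem fn_add (v w : H1) : (v + w).fn = v.fn + w.fn := rfl
@[simp] theorem fn_sub (v w : H1) : (v - w).fn = v.fn - w.fn := rfl
@[simp] theorem fn_smul (c : ℂ) (v : H1) : (c • v).fn = c • v.fn := rfl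
@[simp] theorem grad_add (v w : H1) : (v + w).grad = v.grad + w.grad := rfl
@[simp] theorem grad_sub (v w : H1) : (v - w).grad = v.grad - w.grad := rfl
@[simp] theorem grad_smul (c : ℂ) (v : H1) : (c • v).grad = c • v.grad := rfl

theorem norm_sq (v : H1) : ‖v‖ ^ 2 = ‖v.fn‖ ^ 2 + ‖v.grad‖ ^ 2 := by
  rw [← pairL.norm_map v]
  exact WithLp.prod_norm_sq_eq_of_L2 _

theorem norm_fn_le (v : H1) : ‖v.fn‖ ≤ ‖v‖ :=
  abs_le_of_sq_le_sq' (by rw [norm_sq]; nlinarith [sq_nonneg ‖v.grad‖]) (norm_nonneg _) |>.2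

theorem norm_grad_le (v : H1) : ‖v.grad‖ ≤ ‖v‖ :=
  abs_le_of_sq_le_sq' (by rw [norm_sq]; nlinarith [sq_nonneg ‖v.fn‖]) (norm_nonneg _) |>.2

theorem norm_le_add (v : H1) : ‖v‖ ≤ ‖v.fn‖ + ‖v.grad‖ :=
  abs_le_of_sq_le_sq' (by
    rw [norm_sq]; nlinarith [mul_nonneg (norm_nonneg v.fn) (norm_nonneg v.grad)])
    (by positivity) |>.2

/-- The gradient as a bounded operator. -/
def gradL : H1 →L[ℂ] PiLp 2 (fun _ : Fin 2 => L2) :=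
  LinearMap.mkContinuous
    { toFun := grad, map_add' := grad_add, map_smul' := grad_smul } 1
    fun v => by rw [one_mul]; exact norm_grad_le v

theorem norm_grad_sq (v : H1) : ‖v.grad‖ ^ 2 = ∑ j, ‖v.grad j‖ ^ 2 :=
  PiLp.norm_sq_eq_of_L2 _ _

/-- The transform of the gradient is a multiple of that of the function. Linearity of operators into
H¹ can thus be checked on the function component alone. -/
theorem ext_fn {v w : H1} (h : v.fn = w.fn) : v = w := by
  have hg : v.grad = w.grad := by
    ext1 j
    refine fourier_injective ?_
    filter_upwards [fourier_grad v j, fourier_grad w j] with ξ h1 h2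
    rw [h1, h2, h]
  exact Subtype.ext (WithLp.ofLp_injective 2 (Prod.ext h hg))

theorem fourier_norm_grad_sq (v : H1) :
    (Integrable fun ξ : Plane => (4 * Real.pi ^ 2 * ‖ξ‖ ^ 2) * ‖(𝓕 v.fn : L2) ξ‖ ^ 2) ∧
    ‖v.grad‖ ^ 2 = ∫ ξ, (4 * Real.pi ^ 2 * ‖ξ‖ ^ 2) * ‖(𝓕 v.fn : L2) ξ‖ ^ 2 := by
  have hae : (fun ξ : Plane => ∑ j, ‖(𝓕 (v.grad j) : L2) ξ‖ ^ 2) =ᵐ[volume]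
      fun ξ : Plane => (4 * Real.pi ^ 2 * ‖ξ‖ ^ 2) * ‖(𝓕 v.fn : L2) ξ‖ ^ 2 := by
    filter_upwards [fourier_grad v 0, fourier_grad v 1] with ξ h0 h1
    rw [Fin.sum_univ_two, h0, h1, EuclideanSpace.norm_sq_eq, Fin.sum_univ_two]
    simp only [norm_mul, Complex.norm_real, Complex.norm_I, Complex.norm_ofNat, mul_pow]
    simp only [Real.norm_eq_abs, sq_abs]
    ring
  have hint : Integrable fun ξ : Plane => ∑ j, ‖(𝓕 (v.grad j) : L2) ξ‖ ^ 2 :=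
    integrable_finsetSum _ fun j _ => integrable_norm_sq _
  refine ⟨hint.congr hae, ?_⟩
  rw [← integral_congr_ae hae, integral_finsetSum _ fun j _ => integrable_norm_sq _, norm_grad_sq]
  refine Finset.sum_congr rfl fun j _ => ?_
  rw [← norm_L2_sq, Lp.norm_fourier_eq]

theorem norm_fn_sq_fourier (f : L2) : ‖f‖ ^ 2 = ∫ ξ, ‖(𝓕 f : L2) ξ‖ ^ 2 := by
  rw [← norm_L2_sq, Lp.norm_fourier_eq]

theorem norm_fn_le_of_fourier {v w : H1}
    (h : ∀ᵐ ξ, ‖(𝓕 v.fn : L2) ξ‖ ≤ ‖(𝓕 w.fn : L2) ξ‖) : ‖v.fn‖ ≤ ‖w.fn‖ := by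
  rw [← Lp.norm_fourier_eq v.fn, ← Lp.norm_fourier_eq w.fn]
  exact Lp.norm_le_norm_of_ae_le h

theorem norm_grad_le_of_fourier {v w : H1}
    (h : ∀ᵐ ξ, ‖(𝓕 v.fn : L2) ξ‖ ≤ ‖(𝓕 w.fn : L2) ξ‖) : ‖v.grad‖ ≤ ‖w.grad‖ := by
  refine abs_le_of_sq_le_sq' ?_ (norm_nonneg _) |>.2
  rw [(fourier_norm_grad_sq v).2, (fourier_norm_grad_sq w).2]
  refine integral_mono_ae (fourier_norm_grad_sq v).1 (fourier_norm_grad_sq w).1 ?_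
  filter_upwards [h] with ξ hξ
  gcongr

theorem norm_le_of_fourier {v w : H1}
    (h : ∀ᵐ ξ, ‖(𝓕 v.fn : L2) ξ‖ ≤ ‖(𝓕 w.fn : L2) ξ‖) : ‖v‖ ≤ ‖w‖ := by
  refine abs_le_of_sq_le_sq' ?_ (norm_nonneg _) |>.2
  rw [norm_sq, norm_sq]
  gcongr
  · exact norm_fn_le_of_fourier h
  · exact norm_grad_le_of_fourier h

theorem norm_ofFourier_le (f : L2) (g : Fin 2 → L2) (h) :
    ‖ofFourier f g h‖ ≤ ‖f‖ + ∑ j, ‖g j‖ := by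
  refine (norm_le_add _).trans ?_
  gcongr
  · exact le_rfl
  · refine abs_le_of_sq_le_sq' ?_ (by positivity) |>.2
    rw [norm_grad_sq]
    simp only [grad_ofFourier, Fin.sum_univ_two]
    nlinarith [mul_nonneg (norm_nonneg (g 0)) (norm_nonneg (g 1))]

end H1

/-! ### Frequency cutoffs -/

/-- The characteristic function of the ball of radius `n`. -/
def cutSymbol (n : ℝ) (ξ : Plane) : ℂ := (Metric.closedBall (0 : Plane) n).indicator 1 ξ

theorem measurable_cutSymbol (n : ℝ) : Measurable (cutSymbol n) :=
  measurable_one.indicator Metric.isClosed_closedBall.measurableSet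

theorem cutSymbol_of_le {n : ℝ} {ξ : Plane} (h : ‖ξ‖ ≤ n) : cutSymbol n ξ = 1 := by
  simp [cutSymbol, h]

theorem cutSymbol_of_lt {n : ℝ} {ξ : Plane} (h : n < ‖ξ‖) : cutSymbol n ξ = 0 := by
  simp [cutSymbol, h]

theorem norm_cutSymbol_le (n : ℝ) (ξ : Plane) : ‖cutSymbol n ξ‖ ≤ 1 := by
  rcases le_or_gt ‖ξ‖ n with h | h
  · simp [cutSymbol_of_le h]
  · simp [cutSymbol_of_lt h]

theorem norm_coord_cutSymbol_le {n : ℝ} (hn : 0 ≤ n) (j : Fin 2) (ξ : Plane) :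
    ‖2 * Real.pi * Complex.I * (ξ j : ℂ) * cutSymbol n ξ‖ ≤ 2 * Real.pi * n := by
  have h0 : ‖ξ j‖ ≤ ‖ξ‖ := PiLp.norm_apply_le ξ j
  have hpi := Real.pi_pos
  rcases le_or_gt ‖ξ‖ n with h | h
  · rw [cutSymbol_of_le h]
    simp only [norm_mul, Complex.norm_real, Complex.norm_I, Complex.norm_ofNat, mul_one]
    rw [Real.norm_of_nonneg hpi.le]
    gcongr
    exact h0.trans h
  · rw [cutSymbol_of_lt h, mul_zero, norm_zero]
    positivity

theorem measurable_coord_cutSymbol (n : ℝ) (j : Fin 2) :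
    Measurable fun ξ : Plane => 2 * Real.pi * Complex.I * (ξ j : ℂ) * cutSymbol n ξ := by
  refine Measurable.mul ?_ (measurable_cutSymbol n)
  fun_prop

/-- The sharp frequency cutoff to the ball of radius `n`, as an operator from `L²` to `H¹`. -/
def cutL {n : ℝ} (hn : 0 ≤ n) : L2 →L[ℂ] H1 :=
  have h : ∀ (f : L2) (j : Fin 2),
      (𝓕 (multL _ (measurable_coord_cutSymbol n j) (norm_coord_cutSymbol_le hn j) f) : L2)
      =ᵐ[volume] fun ξ => 2 * Real.pi * Complex.I * (ξ j : ℂ) *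
        (𝓕 (multL _ (measurable_cutSymbol n) (norm_cutSymbol_le n) f) : L2) ξ := fun f j => by
    filter_upwards [fourier_multL_ae _ (measurable_coord_cutSymbol n j)
      (norm_coord_cutSymbol_le hn j) f, fourier_multL_ae _ (measurable_cutSymbol n)
      (norm_cutSymbol_le n) f] with ξ h1 h2
    rw [h1, h2]
    ring
  LinearMap.mkContinuous
    { toFun := fun f => H1.ofFourier _ _ (h f)
      map_add' := fun f g => H1.ext_fn (by
        simp only [H1.fn_ofFourier, H1.fn_add, map_add])
      map_smul' := fun c f => H1.ext_fn (by
        simp only [H1.fn_ofFourier, H1.fn_smul, map_smul, RingHom.id_apply]) }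
    (‖multL _ (measurable_cutSymbol n) (norm_cutSymbol_le n)‖ +
      ∑ j, ‖multL _ (measurable_coord_cutSymbol n j) (norm_coord_cutSymbol_le hn j)‖)
    fun f => by
      refine (H1.norm_ofFourier_le _ _ (h f)).trans ?_
      rw [add_mul, Finset.sum_mul]
      gcongr
      · exact ContinuousLinearMap.le_opNorm _ _
      · exact ContinuousLinearMap.le_opNorm _ _

theorem fourier_cutL {n : ℝ} (hn : 0 ≤ n) (f : L2) :
    (𝓕 (cutL hn f).fn : L2) =ᵐ[volume] fun ξ => cutSymbol n ξ * (𝓕 f : L2) ξ :=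
  fourier_multL_ae _ (measurable_cutSymbol n) (norm_cutSymbol_le n) f

/-! ### Density of Schwartz functions and the Ladyzhenskaya inequality -/

namespace H1

/-- A Schwartz function as an element of `H¹`. -/
def ofSchwartz (φ : 𝓢(Plane, ℂ)) : H1 :=
  ⟨WithLp.toLp 2 (φ.toLp 2, WithLp.toLp 2 fun j =>
    (∂_{EuclideanSpace.single j (1 : ℝ)} φ : 𝓢(Plane, ℂ)).toLp 2), fun j => by
      simp [TemperedDistribution.lineDerivOp_toTemperedDistributionCLM_eq]⟩

@[simp] theorem fn_ofSchwartz (φ : 𝓢(Plane, ℂ)) : (ofSchwartz φ).fn = φ.toLp 2 := rfl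

@[simp] theorem grad_ofSchwartz (φ : 𝓢(Plane, ℂ)) (j : Fin 2) :
    (ofSchwartz φ).grad j = (∂_{EuclideanSpace.single j (1 : ℝ)} φ : 𝓢(Plane, ℂ)).toLp 2 := rfl

/-- Multiplying the transform by (1+|ξ|²)^(1/2) carries H¹ into L², where Schwartz functions are
dense. An approximant there is multiplied by the inverse weight, which has temperate growth and so
keeps it Schwartz. -/
theorem exists_schwartz_near (v : H1) {ε : ℝ} (hε : 0 < ε) :
    ∃ φ : 𝓢(Plane, ℂ), ‖ofSchwartz φ - v‖ < ε := by
  have hpi := Real.pi_pos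
  have hpi3 := Real.pi_gt_three
  set w : Plane → ℂ := fun ξ => (((1 + ‖ξ‖ ^ 2) ^ (1 / 2 : ℝ) : ℝ) : ℂ) with hw
  set w' : Plane → ℂ := fun ξ => (((1 + ‖ξ‖ ^ 2) ^ (-1 / 2 : ℝ) : ℝ) : ℂ) with hw'
  have hww : ∀ ξ, w' ξ * w ξ = 1 := fun ξ => by
    rw [hw, hw', ← Complex.ofReal_mul, ← Real.rpow_add (by positivity)]
    norm_num
  have hwn : ∀ ξ, ‖w' ξ‖ ^ 2 * (1 + ‖ξ‖ ^ 2) = 1 := fun ξ => by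
    rw [hw', Complex.norm_real, Real.norm_of_nonneg (by positivity), ← Real.rpow_mul_natCast
      (by positivity)]
    norm_num
    rw [Real.rpow_neg_one, inv_mul_cancel₀ (by positivity)]
  have hwn2 : ∀ ξ, ‖w ξ‖ ^ 2 = 1 + ‖ξ‖ ^ 2 := fun ξ => by
    rw [hw, Complex.norm_real, Real.norm_of_nonneg (by positivity), ← Real.rpow_mul_natCast
      (by positivity)]
    norm_num
  have hwtg : w'.HasTemperateGrowth := by fun_prop
  have hwc : Continuous w := by
    have : w.HasTemperateGrowth := by fun_prop
    exact this.1.continuous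
  have hG : MemLp (fun ξ => w ξ * (𝓕 v.fn : L2) ξ) 2 (volume : Measure Plane) := by
    refine (memLp_two_iff_integrable_sq_norm
      (hwc.aestronglyMeasurable.mul (Lp.aestronglyMeasurable _))).2 ?_
    have h1 := (integrable_norm_sq (𝓕 v.fn : L2)).add
      ((fourier_norm_grad_sq v).1.const_mul (1 / (4 * Real.pi ^ 2)))
    refine h1.congr (Eventually.of_forall fun ξ => ?_)
    simp only [Pi.add_apply, Pi.mul_apply]
    rw [norm_mul, mul_pow, hwn2]
    field_simp
  have hd := SchwartzMap.denseRange_toLpCLM (E := Plane) (F := ℂ) (p := 2)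
    (μ := volume) ENNReal.ofNat_ne_top
  obtain ⟨h, hh⟩ := hd.exists_dist_lt (hG.toLp _) (show 0 < ε / (2 * Real.pi) by positivity)
  rw [dist_eq_norm, norm_sub_rev] at hh
  set ψ : 𝓢(Plane, ℂ) := SchwartzMap.smulLeftCLM ℂ w' h
  refine ⟨𝓕⁻ ψ, ?_⟩
  set d := ofSchwartz (𝓕⁻ ψ) - v with hdd
  set e : L2 := SchwartzMap.toLpCLM ℝ ℂ 2 volume h - hG.toLp _ with he
  have hF : ∀ᵐ ξ, ‖(𝓕 d.fn : L2) ξ‖ = ‖w' ξ‖ * ‖e ξ‖ := by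
    have h1 := fourier_sub_ae (ofSchwartz (𝓕⁻ ψ)).fn v.fn
    rw [fn_ofSchwartz, SchwartzMap.toLp_fourier_eq, FourierTransform.fourier_fourierInv_eq] at h1
    filter_upwards [h1, ψ.coeFn_toLp 2 volume, Lp.coeFn_sub (SchwartzMap.toLpCLM ℝ ℂ 2 volume h)
      (hG.toLp _), hG.coeFn_toLp, h.coeFn_toLp 2 volume] with ξ a1 a2 a3 a4 a5
    rw [hdd, fn_sub, fn_ofSchwartz, a1, a2, he, a3, Pi.sub_apply, a4, SchwartzMap.toLpCLM_apply, a5,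
      ← norm_mul]
    congr 1
    rw [SchwartzMap.smulLeftCLM_apply_apply hwtg, mul_sub, ← mul_assoc, hww, one_mul, smul_eq_mul]
  -- The H¹ weight is 1 + 4π²|ξ|² ≤ 4π²(1+|ξ|²), whence the factor 2π and the tolerance ε/(2π)
  -- above.
  have hle : ‖d‖ ^ 2 ≤ (2 * Real.pi * ‖e‖) ^ 2 := by
    rw [norm_sq, norm_fn_sq_fourier, (fourier_norm_grad_sq d).2,
      ← integral_add (integrable_norm_sq _) (fourier_norm_grad_sq d).1, mul_pow, norm_L2_sq e,
      ← integral_const_mul]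
    refine integral_mono_ae ((integrable_norm_sq _).add (fourier_norm_grad_sq d).1)
      ((integrable_norm_sq e).const_mul _) ?_
    filter_upwards [hF] with ξ hξ
    simp only [hξ, mul_pow]
    have h1 := hwn ξ
    have h2 : 0 ≤ ‖w' ξ‖ ^ 2 := by positivity
    calc ‖w' ξ‖ ^ 2 * ‖e ξ‖ ^ 2 + 4 * Real.pi ^ 2 * ‖ξ‖ ^ 2 * (‖w' ξ‖ ^ 2 * ‖e ξ‖ ^ 2)
        = (‖w' ξ‖ ^ 2 * (1 + 4 * Real.pi ^ 2 * ‖ξ‖ ^ 2)) * ‖e ξ‖ ^ 2 := by ring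
      _ ≤ (2 ^ 2 * Real.pi ^ 2) * ‖e ξ‖ ^ 2 := by
        refine mul_le_mul_of_nonneg_right ?_ (by positivity)
        have h3 : 0 ≤ ‖w' ξ‖ ^ 2 * (4 * Real.pi ^ 2 - 1) := mul_nonneg h2 (by nlinarith)
        have h4 : 4 * Real.pi ^ 2 * (‖w' ξ‖ ^ 2 * (1 + ‖ξ‖ ^ 2)) = 4 * Real.pi ^ 2 := by
          rw [h1, mul_one]
        nlinarith
  have := abs_le_of_sq_le_sq' hle (by positivity) |>.2
  calc ‖d‖ ≤ 2 * Real.pi * ‖e‖ := this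
    _ < 2 * Real.pi * (ε / (2 * Real.pi)) := by gcongr
    _ = ε := by field_simp

end H1

/-! ### The endpoint Sobolev inequality of the plane, applied to squares. -/

theorem holderConjugate_finrank_plane :
    ((Module.finrank ℝ Plane : ℕ) : NNReal).HolderConjugate 2 := by
  rw [finrank_euclideanSpace_fin]
  exact NNReal.holderConjugate_iff.2 ⟨by norm_num, by
    push_cast; rw [← NNReal.coe_inj]; push_cast; norm_num⟩

theorem exists_eLpNorm_le_fderiv : ∃ K : NNReal, ∀ u : Plane → ℂ, ContDiff ℝ 1 u →
    HasCompactSupport u → eLpNorm u 2 volume ≤ K * eLpNorm (fderiv ℝ u) 1 volume := by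
  refine ⟨eLpNormLESNormFDerivOneConst (volume : Measure Plane) (2 : NNReal), fun u hu hc => ?_⟩
  have h := eLpNorm_le_eLpNorm_fderiv_one (volume : Measure Plane) hu hc
    holderConjugate_finrank_plane
  rw [ENNReal.coe_ofNat] at h
  exact h

theorem eLpNorm_fderiv_sq_le {w : Plane → ℂ} (hw : ContDiff ℝ 1 w) :
    eLpNorm (fderiv ℝ fun x => w x ^ 2) 1 volume ≤
      2 * (eLpNorm w 2 volume * eLpNorm (fderiv ℝ w) 2 volume) := by
  have hholder : eLpNorm (fun x => ‖w x‖ * ‖fderiv ℝ w x‖) 1 volume ≤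
      eLpNorm w 2 volume * eLpNorm (fderiv ℝ w) 2 volume := by
    rw [← eLpNorm_norm w, ← eLpNorm_norm (fderiv ℝ w)]
    exact eLpNorm_smul_le_mul_eLpNorm (𝕜 := ℝ) (E := ℝ)
      (hw.continuous_fderiv one_ne_zero).norm.aestronglyMeasurable
      hw.continuous.norm.aestronglyMeasurable
  have h0 : ∀ x, ‖fderiv ℝ (fun x => w x ^ 2) x‖ ≤ 2 * ‖‖w x‖ * ‖fderiv ℝ w x‖‖ := fun x => by
    have hd : HasFDerivAt w (fderiv ℝ w x) x := (hw.differentiable one_ne_zero x).hasFDerivAt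
    rw [(hd.pow 2).fderiv]
    rw [norm_smul, Real.norm_of_nonneg (by positivity)]
    norm_num
    rw [mul_assoc]
  have h2 := eLpNorm_le_mul_eLpNorm_of_ae_le_mul (μ := volume) (Eventually.of_forall h0) 1
  rw [ENNReal.ofReal_ofNat] at h2
  exact h2.trans (mul_le_mul_right hholder 2)

/-- The embedding of W^{1,1} into L² is applied to w²: since ∇(w²) = 2w∇w, Cauchy–Schwarz produces
the product of the two L² norms. -/
theorem exists_eLpNorm_sq_le_of_hasCompactSupport : ∃ K : NNReal, ∀ w : Plane → ℂ,
    ContDiff ℝ 1 w → HasCompactSupport w →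
    eLpNorm (fun x => w x ^ 2) 2 volume ≤
      K * (eLpNorm w 2 volume * eLpNorm (fderiv ℝ w) 2 volume) := by
  obtain ⟨K, hK⟩ := exists_eLpNorm_le_fderiv
  refine ⟨K * 2, fun w hw hc => ?_⟩
  have h1 := hK _ (hw.pow 2) (hc.comp_left (g := fun z : ℂ => z ^ 2) (by simp))
  rw [ENNReal.coe_mul, mul_assoc]
  exact h1.trans (mul_le_mul_right (eLpNorm_fderiv_sq_le hw) _)

theorem norm_clm_plane_le (A : Plane →L[ℝ] ℂ) :
    ‖A‖ ≤ ∑ j, ‖A (EuclideanSpace.single j (1 : ℝ))‖ := by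
  refine A.opNorm_le_bound (by positivity) fun x => ?_
  have hx : x = ∑ j, x j • EuclideanSpace.single j (1 : ℝ) := by
    ext i
    fin_cases i <;> simp [Fin.sum_univ_two]
  conv_lhs => rw [hx]
  rw [map_sum, Finset.sum_mul]
  refine (norm_sum_le _ _).trans (Finset.sum_le_sum fun j _ => ?_)
  rw [map_smul, norm_smul, mul_comm]
  gcongr
  exact PiLp.norm_apply_le x j

/-- A smooth cutoff to the ball of radius `R + 1`. -/
theorem exists_cutoff_sequence : ∃ (χ : ℕ → Plane → ℂ) (K : ℝ), 0 ≤ K ∧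
    (∀ n, ContDiff ℝ 1 (χ n)) ∧ (∀ n, HasCompactSupport (χ n)) ∧ (∀ n x, ‖χ n x‖ ≤ 1) ∧
    (∀ n x, ‖fderiv ℝ (χ n) x‖ ≤ K * (1 / ((n : ℝ) + 1))) ∧
    ∀ x, ∀ᶠ n in atTop, χ n x = 1 := by
  let b : ContDiffBump (0 : Plane) := ⟨1, 2, by norm_num, by norm_num⟩
  let f : Plane → ℂ := fun x => (b x : ℂ)
  have hf : ContDiff ℝ 1 f := Complex.ofRealCLM.contDiff.comp b.contDiff
  have hfc : HasCompactSupport f :=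
    b.hasCompactSupport.comp_left (g := fun t : ℝ => (t : ℂ)) (by simp)
  obtain ⟨K, hK⟩ := (hf.continuous_fderiv one_ne_zero).bounded_above_of_compact_support
    (hfc.fderiv (𝕜 := ℝ))
  have hK0 : 0 ≤ K := (norm_nonneg _).trans (hK 0)
  refine ⟨fun n x => f ((1 / ((n : ℝ) + 1)) • x), K, hK0, fun n => ?_, fun n => ?_, fun n x => ?_,
    fun n x => ?_, fun x => ?_⟩
  · exact hf.comp (contDiff_const_smul _)
  · exact hfc.comp_smul (by positivity)
  · simp only [f, Complex.norm_real, Real.norm_of_nonneg b.nonneg]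
    exact b.le_one
  · have h1 : HasFDerivAt f (fderiv ℝ f ((1 / ((n : ℝ) + 1)) • x)) ((1 / ((n : ℝ) + 1)) • x) :=
      (hf.differentiable one_ne_zero _).hasFDerivAt
    have h2 : HasFDerivAt (fun y : Plane => (1 / ((n : ℝ) + 1)) • y)
      ((1 / ((n : ℝ) + 1)) • ContinuousLinearMap.id ℝ Plane) x :=
      ((1 / ((n : ℝ) + 1)) • ContinuousLinearMap.id ℝ Plane).hasFDerivAt
    have h3 : fderiv ℝ (fun y : Plane => f ((1 / ((n : ℝ) + 1)) • y)) x = _ := (h1.comp x h2).fderiv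
    rw [h3]
    simp only [ContinuousLinearMap.comp_smul, ContinuousLinearMap.comp_id, norm_smul]
    rw [mul_comm, Real.norm_of_nonneg (by positivity)]
    gcongr
    exact hK _
  · have ht : Tendsto (fun n : ℕ => (1 / ((n : ℝ) + 1)) • x) atTop (𝓝 0) := by
      simpa using (tendsto_one_div_add_atTop_nhds_zero_nat (𝕜 := ℝ)).smul_const x
    filter_upwards [ht.eventually (Metric.closedBall_mem_nhds 0 one_pos)] with n hn
    simp only [f]
    rw [b.one_of_mem_closedBall hn, Complex.ofReal_one]

theorem eLpNorm_L2_eq (f : L2) : eLpNorm f 2 volume = ENNReal.ofReal ‖f‖ := by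
  rw [Lp.norm_def, ENNReal.ofReal_toReal (Lp.eLpNorm_ne_top f)]

/-- The factor 2 is crude: the operator norm is bounded by the sum of the two partial derivatives,
each at most the full gradient in L². -/
theorem eLpNorm_fderiv_schwartz_le (φ : 𝓢(Plane, ℂ)) :
    eLpNorm (fderiv ℝ φ) 2 volume ≤ ENNReal.ofReal (2 * ‖(H1.ofSchwartz φ).grad‖) := by
  set D : Fin 2 → 𝓢(Plane, ℂ) := fun j => ∂_{EuclideanSpace.single j (1 : ℝ)} φ
  have hD : ∀ j, eLpNorm (fun x => ‖D j x‖) 2 volume ≤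
      ENNReal.ofReal ‖(H1.ofSchwartz φ).grad‖ := fun j => by
    rw [eLpNorm_norm, ← eLpNorm_congr_ae ((D j).coeFn_toLp 2 volume), eLpNorm_L2_eq]
    exact ENNReal.ofReal_le_ofReal (PiLp.norm_apply_le (H1.ofSchwartz φ).grad j)
  have h1 : eLpNorm (fderiv ℝ φ) 2 volume ≤
      eLpNorm ((fun x => ‖D 0 x‖) + fun x => ‖D 1 x‖) 2 volume := by
    refine eLpNorm_mono_real fun x => ?_
    refine (norm_clm_plane_le _).trans_eq ?_
    rw [Fin.sum_univ_two, Pi.add_apply]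
    simp only [D, SchwartzMap.lineDerivOp_apply_eq_fderiv]
  refine h1.trans ((eLpNorm_add_le (D 0).continuous.norm.aestronglyMeasurable
    (D 1).continuous.norm.aestronglyMeasurable (by norm_num)).trans ?_)
  rw [two_mul, ENNReal.ofReal_add (norm_nonneg _) (norm_nonneg _)]
  exact add_le_add (hD 0) (hD 1)

theorem norm_fderiv_mul_le {χ f : Plane → ℂ} (hχ : ContDiff ℝ 1 χ) (hf : ContDiff ℝ 1 f)
    (x : Plane) : ‖fderiv ℝ (fun x => χ x * f x) x‖ ≤
      ‖χ x‖ * ‖fderiv ℝ f x‖ + ‖fderiv ℝ χ x‖ * ‖f x‖ := by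
  have hd := (hχ.differentiable one_ne_zero x).hasFDerivAt.mul
    (hf.differentiable one_ne_zero x).hasFDerivAt
  have hd' : fderiv ℝ (fun x => χ x * f x) x = _ := hd.fderiv
  rw [hd']
  refine (norm_add_le _ _).trans ?_
  rw [norm_smul, norm_smul, mul_comm ‖f x‖]

theorem eLpNorm_fderiv_mul_le {χ f : Plane → ℂ} (hχ : ContDiff ℝ 1 χ) (hf : ContDiff ℝ 1 f)
    (h1 : ∀ x, ‖χ x‖ ≤ 1) {c : ℝ} (hc : ∀ x, ‖fderiv ℝ χ x‖ ≤ c) :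
    eLpNorm (fderiv ℝ fun x => χ x * f x) 2 volume ≤
      eLpNorm (fderiv ℝ f) 2 volume + ENNReal.ofReal c * eLpNorm f 2 volume := by
  have h4 : eLpNorm (fderiv ℝ fun x => χ x * f x) 2 volume ≤
      eLpNorm ((fun x => ‖fderiv ℝ f x‖) + fun x => c * ‖f x‖) 2 volume := by
    refine eLpNorm_mono_real fun x => ?_
    refine (norm_fderiv_mul_le hχ hf x).trans ?_
    rw [Pi.add_apply]
    gcongr
    · exact mul_le_of_le_one_left (norm_nonneg _) (h1 x)
    · exact hc x
  have h5 : AEStronglyMeasurable (fun x => c * ‖f x‖) volume :=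
    (continuous_const.mul hf.continuous.norm).aestronglyMeasurable
  refine h4.trans ((eLpNorm_add_le (hf.continuous_fderiv one_ne_zero).norm.aestronglyMeasurable
    h5 (by norm_num)).trans ?_)
  rw [eLpNorm_norm]
  refine add_le_add le_rfl ?_
  refine eLpNorm_le_mul_eLpNorm_of_ae_le_mul (Eventually.of_forall fun x => ?_) 2
  rw [norm_mul, norm_norm, Real.norm_of_nonneg ((norm_nonneg _).trans (hc 0))]

/-- Compact support is removed by dilated cutoffs: the derivative falling on the cutoff costs
K/(n+1) times the L² norm, which vanishes in the limit, and Fatou's lemma passes the bound to φ. -/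
theorem exists_ladyzhenskaya_schwartz : ∃ K : ℝ, 0 ≤ K ∧ ∀ φ : 𝓢(Plane, ℂ),
    eLpNorm (fun x => φ x ^ 2) 2 volume ≤
      ENNReal.ofReal (K * (‖(H1.ofSchwartz φ).fn‖ * ‖(H1.ofSchwartz φ).grad‖)) := by
  obtain ⟨K₁, hK₁⟩ := exists_eLpNorm_sq_le_of_hasCompactSupport
  obtain ⟨χ, K, hK, hχd, hχc, hχ1, hχK, hχl⟩ := exists_cutoff_sequence
  refine ⟨2 * K₁, by positivity, fun φ => ?_⟩
  set A := ‖(H1.ofSchwartz φ).fn‖ with hA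
  set G := ‖(H1.ofSchwartz φ).grad‖ with hG
  have hφA : eLpNorm φ 2 volume = ENNReal.ofReal A := by
    rw [hA, H1.fn_ofSchwartz, ← eLpNorm_L2_eq, eLpNorm_congr_ae (φ.coeFn_toLp 2 volume)]
  have hφ1 : ContDiff ℝ 1 φ := φ.smooth 1
  have hb : ∀ n : ℕ, eLpNorm (fun x => (χ n x * φ x) ^ 2) 2 volume ≤
      ENNReal.ofReal (K₁ * (A * (2 * G + K * (1 / ((n : ℝ) + 1)) * A))) := fun n => by
    have h1 := hK₁ (fun x => χ n x * φ x) ((hχd n).mul hφ1) (hχc n).mul_right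
    have h2 : eLpNorm (fun x => χ n x * φ x) 2 volume ≤ ENNReal.ofReal A := by
      rw [← hφA]
      refine eLpNorm_mono fun x => ?_
      rw [norm_mul]
      exact mul_le_of_le_one_left (norm_nonneg _) (hχ1 n x)
    have h3 : eLpNorm (fderiv ℝ fun x => χ n x * φ x) 2 volume ≤
        ENNReal.ofReal (2 * G + K * (1 / ((n : ℝ) + 1)) * A) := by
      refine (eLpNorm_fderiv_mul_le (hχd n) hφ1 (hχ1 n) (hχK n)).trans ?_
      rw [ENNReal.ofReal_add (by positivity) (by positivity),
        ENNReal.ofReal_mul (p := K * (1 / ((n : ℝ) + 1))) (by positivity), hφA]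
      exact add_le_add (eLpNorm_fderiv_schwartz_le φ) le_rfl
    refine h1.trans ?_
    rw [ENNReal.ofReal_mul (by positivity), ENNReal.ofReal_mul (by positivity),
      ENNReal.ofReal_coe_nnreal]
    exact mul_le_mul_right (mul_le_mul' h2 h3) _
  have hlim : Tendsto (fun n : ℕ => ENNReal.ofReal
      (K₁ * (A * (2 * G + K * (1 / ((n : ℝ) + 1)) * A)))) atTop
      (𝓝 (ENNReal.ofReal (2 * K₁ * (A * G)))) := by
    refine ENNReal.tendsto_ofReal ?_
    have h := ((((tendsto_one_div_add_atTop_nhds_zero_nat (𝕜 := ℝ)).const_mul K).mul_const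
      A).const_add (2 * G)).const_mul A |>.const_mul (K₁ : ℝ)
    convert h using 2
    ring
  refine (Lp.eLpNorm_lim_le_liminf_eLpNorm (f := fun n x => (χ n x * φ x) ^ 2)
    (fun n => (((hχd n).continuous.mul φ.continuous).pow 2).aestronglyMeasurable) _
    (Eventually.of_forall fun x => ?_)).trans ?_
  · refine tendsto_const_nhds.congr' ?_
    filter_upwards [hχl x] with n hn
    rw [hn, one_mul]
  · rw [← hlim.liminf_eq]
    exact liminf_le_liminf (Eventually.of_forall hb)

/-- The Ladyzhenskaya inequality `‖v²‖₂ ≤ K ‖v‖₂ ‖∇v‖₂` in the plane. -/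
theorem exists_ladyzhenskaya : ∃ K : ℝ, 0 ≤ K ∧ ∀ v : H1,
    eLpNorm (fun x => v.fn x ^ 2) 2 volume ≤ ENNReal.ofReal (K * (‖v.fn‖ * ‖v.grad‖)) := by
  obtain ⟨K, hK, hφ⟩ := exists_ladyzhenskaya_schwartz
  refine ⟨K, hK, fun v => ?_⟩
  choose φ hφv using fun n : ℕ => H1.exists_schwartz_near v (ε := 1 / ((n : ℝ) + 1)) (by positivity)
  have ht : Tendsto (fun n => H1.ofSchwartz (φ n)) atTop (𝓝 v) := by
    rw [tendsto_iff_norm_sub_tendsto_zero]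
    exact squeeze_zero (fun _ => norm_nonneg _) (fun n => (hφv n).le)
      tendsto_one_div_add_atTop_nhds_zero_nat
  have htf : Tendsto (fun n => (H1.ofSchwartz (φ n)).fn) atTop (𝓝 v.fn) :=
    (H1.fnL.continuous.tendsto v).comp ht
  have htg : Tendsto (fun n => (H1.ofSchwartz (φ n)).grad) atTop (𝓝 v.grad) :=
    (H1.gradL.continuous.tendsto v).comp ht
  -- Fatou's lemma needs pointwise convergence, which L² convergence gives along a subsequence.
  obtain ⟨ns, hns, hae⟩ := (tendstoInMeasure_of_tendsto_Lp htf).exists_seq_tendsto_ae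
  have hlim : Tendsto (fun n => ENNReal.ofReal (K * (‖(H1.ofSchwartz (φ (ns n))).fn‖ *
      ‖(H1.ofSchwartz (φ (ns n))).grad‖))) atTop (𝓝 (ENNReal.ofReal (K * (‖v.fn‖ * ‖v.grad‖)))) :=
    ENNReal.tendsto_ofReal
      (((htf.norm.mul htg.norm).const_mul K).comp hns.tendsto_atTop)
  refine (Lp.eLpNorm_lim_le_liminf_eLpNorm
    (f := fun n x => (H1.ofSchwartz (φ (ns n))).fn x ^ 2)
    (fun n => (Lp.aestronglyMeasurable _).pow 2) _ ?_).trans ?_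
  · filter_upwards [hae] with x hx
    exact hx.pow 2
  · rw [← hlim.liminf_eq]
    refine liminf_le_liminf (Eventually.of_forall fun n => ?_)
    refine (eLpNorm_congr_ae ?_).trans_le (hφ (φ (ns n)))
    filter_upwards [(φ (ns n)).coeFn_toLp 2 volume] with x hx
    rw [H1.fn_ofSchwartz, hx]

/-! ### Products of elements of `H¹` -/

/-- A constant in the Ladyzhenskaya inequality. -/
def ladyK : ℝ := exists_ladyzhenskaya.choose

theorem ladyK_nonneg : 0 ≤ ladyK := exists_ladyzhenskaya.choose_spec.1

theorem eLpNorm_fn_sq_le (v : H1) :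
    eLpNorm (fun x => v.fn x ^ 2) 2 volume ≤ ENNReal.ofReal (ladyK * (‖v.fn‖ * ‖v.grad‖)) :=
  exists_ladyzhenskaya.choose_spec.2 v

namespace H1

theorem memLp_fn_sq (v : H1) : MemLp (fun x => v.fn x ^ 2) 2 volume :=
  ⟨(Lp.aestronglyMeasurable _).pow 2, (eLpNorm_fn_sq_le v).trans_lt ENNReal.ofReal_lt_top⟩

theorem memLp_mul_conj (v w : H1) : MemLp (fun x => v.fn x * conj (w.fn x)) 2 volume := by
  refine ((memLp_fn_sq v).norm.add (memLp_fn_sq w).norm).mono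
    ((Lp.aestronglyMeasurable _).mul (Complex.continuous_conj.comp_aestronglyMeasurable
      (Lp.aestronglyMeasurable _))) (Eventually.of_forall fun x => ?_)
  simp only [Pi.add_apply, norm_mul, RCLike.norm_conj, norm_pow]
  rw [Real.norm_of_nonneg (by positivity)]
  nlinarith [sq_nonneg (‖v.fn x‖ - ‖w.fn x‖), sq_nonneg ‖v.fn x‖, sq_nonneg ‖w.fn x‖]

/-- The product `v · conj w` of two elements of `H¹`. -/
def mulConj (v w : H1) : L2 := (memLp_mul_conj v w).toLp _

theorem mulConj_ae (v w : H1) :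
    mulConj v w =ᵐ[volume] fun x => v.fn x * conj (w.fn x) :=
  (memLp_mul_conj v w).coeFn_toLp

theorem norm_mulConj_self_le (v : H1) : ‖mulConj v v‖ ≤ ladyK * (‖v.fn‖ * ‖v.grad‖) := by
  have h : eLpNorm (mulConj v v) 2 volume = eLpNorm (fun x => v.fn x ^ 2) 2 volume := by
    refine eLpNorm_congr_norm_ae ?_
    filter_upwards [mulConj_ae v v] with x hx
    rw [hx, norm_mul, RCLike.norm_conj, norm_pow, sq]
  rw [Lp.norm_def, h]
  exact ENNReal.toReal_le_of_le_ofReal (by have := ladyK_nonneg; positivity) (eLpNorm_fn_sq_le v)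

/-- ∫|v w̄|² is the inner product of |v|² and |w|², so this is Cauchy–Schwarz. It reduces all
product estimates to the diagonal case. -/
theorem norm_mulConj_sq_le (v w : H1) :
    ‖mulConj v w‖ ^ 2 ≤ ‖mulConj v v‖ * ‖mulConj w w‖ := by
  have h : ((‖mulConj v w‖ ^ 2 : ℝ) : ℂ) = inner ℂ (mulConj v v) (mulConj w w) := by
    rw [norm_L2_sq, inner_L2_def, ← integral_complex_ofReal]
    refine integral_congr_ae ?_
    filter_upwards [mulConj_ae v w, mulConj_ae v v, mulConj_ae w w] with x h1 h2 h3
    rw [h1, h2, h3, norm_mul, RCLike.norm_conj, mul_pow, Complex.ofReal_mul, Complex.ofReal_pow,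
      Complex.ofReal_pow, ← Complex.mul_conj', ← Complex.mul_conj']
    simp only [map_mul, Complex.conj_conj]
    ring
  calc ‖mulConj v w‖ ^ 2 = ‖((‖mulConj v w‖ ^ 2 : ℝ) : ℂ)‖ := by
        rw [Complex.norm_real, Real.norm_of_nonneg (by positivity)]
    _ ≤ _ := by rw [h]; exact norm_inner_le_norm _ _

theorem norm_mulConj_sq_le' (v w : H1) :
    ‖mulConj v w‖ ^ 2 ≤ ladyK ^ 2 * (‖v.fn‖ * ‖v.grad‖) * (‖w.fn‖ * ‖w.grad‖) := by
  refine (norm_mulConj_sq_le v w).trans ?_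
  calc ‖mulConj v v‖ * ‖mulConj w w‖
      ≤ (ladyK * (‖v.fn‖ * ‖v.grad‖)) * (ladyK * (‖w.fn‖ * ‖w.grad‖)) :=
        mul_le_mul (norm_mulConj_self_le v) (norm_mulConj_self_le w) (norm_nonneg _)
          (by have := ladyK_nonneg; positivity)
    _ = _ := by ring

theorem norm_mulConj_le (v w : H1) : ‖mulConj v w‖ ≤ ladyK * ‖v‖ * ‖w‖ := by
  have hK := ladyK_nonneg
  refine abs_le_of_sq_le_sq' ((norm_mulConj_sq_le' v w).trans ?_) (by positivity) |>.2
  calc ladyK ^ 2 * (‖v.fn‖ * ‖v.grad‖) * (‖w.fn‖ * ‖w.grad‖)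
      ≤ ladyK ^ 2 * (‖v‖ * ‖v‖) * (‖w‖ * ‖w‖) := by
        gcongr
        · exact norm_fn_le v
        · exact norm_grad_le v
        · exact norm_fn_le w
        · exact norm_grad_le w
    _ = (ladyK * ‖v‖ * ‖w‖) ^ 2 := by ring

/-- The norm bound for a product with one essentially bounded factor. -/
theorem norm_mulConj_le_of_bound_left {v : H1} {K : ℝ} (hv : ∀ᵐ x, ‖v.fn x‖ ≤ K) (w : H1) :
    ‖mulConj v w‖ ≤ K * ‖w.fn‖ := by
  refine norm_L2_le_of_ae ?_
  filter_upwards [hv, mulConj_ae v w] with x h1 h2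
  rw [h2, norm_mul, RCLike.norm_conj]
  gcongr

theorem norm_mulConj_le_of_bound_right (v : H1) {w : H1} {K : ℝ} (hw : ∀ᵐ x, ‖w.fn x‖ ≤ K) :
    ‖mulConj v w‖ ≤ K * ‖v.fn‖ := by
  refine norm_L2_le_of_ae ?_
  filter_upwards [hw, mulConj_ae v w] with x h1 h2
  rw [h2, norm_mul, RCLike.norm_conj, mul_comm]
  gcongr

theorem mulConj_add_left (v v' w : H1) : mulConj (v + v') w = mulConj v w + mulConj v' w := by
  refine Lp.ext ?_
  filter_upwards [mulConj_ae (v + v') w, mulConj_ae v w, mulConj_ae v' w,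
    Lp.coeFn_add (mulConj v w) (mulConj v' w), Lp.coeFn_add v.fn v'.fn] with x h1 h2 h3 h4 h5
  rw [h1, h4, Pi.add_apply, h2, h3, fn_add, h5, Pi.add_apply, add_mul]

theorem mulConj_add_right (v w w' : H1) : mulConj v (w + w') = mulConj v w + mulConj v w' := by
  refine Lp.ext ?_
  filter_upwards [mulConj_ae v (w + w'), mulConj_ae v w, mulConj_ae v w',
    Lp.coeFn_add (mulConj v w) (mulConj v w'), Lp.coeFn_add w.fn w'.fn] with x h1 h2 h3 h4 h5
  rw [h1, h4, Pi.add_apply, h2, h3, fn_add, h5, Pi.add_apply, map_add, mul_add]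

theorem mulConj_smul_left (c : ℂ) (v w : H1) : mulConj (c • v) w = c • mulConj v w := by
  refine Lp.ext ?_
  filter_upwards [mulConj_ae (c • v) w, mulConj_ae v w,
    Lp.coeFn_smul c (mulConj v w), Lp.coeFn_smul c v.fn] with x h1 h2 h3 h4
  rw [h1, h3, Pi.smul_apply, h2, fn_smul, h4, Pi.smul_apply, smul_eq_mul, smul_eq_mul, mul_assoc]

theorem mulConj_smul_right (c : ℂ) (v w : H1) : mulConj v (c • w) = conj c • mulConj v w := by
  refine Lp.ext ?_
  filter_upwards [mulConj_ae v (c • w), mulConj_ae v w,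
    Lp.coeFn_smul (conj c) (mulConj v w), Lp.coeFn_smul c w.fn] with x h1 h2 h3 h4
  rw [h1, h3, Pi.smul_apply, h2, fn_smul, h4, Pi.smul_apply, smul_eq_mul, smul_eq_mul, map_mul]
  ring

theorem mulConj_sub_left (v v' w : H1) : mulConj (v - v') w = mulConj v w - mulConj v' w := by
  rw [eq_sub_iff_add_eq, ← mulConj_add_left, sub_add_cancel]

theorem mulConj_sub_right (v w w' : H1) : mulConj v (w - w') = mulConj v w - mulConj v w' := by
  rw [eq_sub_iff_add_eq, ← mulConj_add_right, sub_add_cancel]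

theorem isBoundedBilinearMap_mulConj :
    IsBoundedBilinearMap ℝ fun p : H1 × H1 => mulConj p.1 p.2 where
  add_left := mulConj_add_left
  add_right := mulConj_add_right
  smul_left c v w := by
    rw [← Complex.coe_smul c v]
    exact mulConj_smul_left _ v w
  smul_right c v w := by
    rw [← Complex.coe_smul c w]
    refine (mulConj_smul_right _ v w).trans ?_
    rw [Complex.conj_ofReal, Complex.coe_smul]
    rfl
  bound := ⟨ladyK + 1, by have := ladyK_nonneg; linarith, fun v w => by
    refine (norm_mulConj_le v w).trans ?_
    gcongr
    linarith⟩

theorem star_mulConj (v w : H1) : star (mulConj v w) = mulConj w v := by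
  refine Lp.ext ?_
  filter_upwards [mulConj_ae v w, mulConj_ae w v, Lp.coeFn_star (mulConj v w)] with x h1 h2 h3
  rw [h3, Pi.star_apply, h1, h2, Complex.star_def, map_mul, Complex.conj_conj, mul_comm]

theorem absSq_fn (v : H1) : absSq v.fn = mulConj v v := by
  have he : (fun x => ((‖v.fn x‖ ^ 2 : ℝ) : ℂ)) = fun x => v.fn x * conj (v.fn x) := by
    ext x
    rw [Complex.mul_conj', Complex.ofReal_pow]
  have h : MemLp (fun x => ((‖v.fn x‖ ^ 2 : ℝ) : ℂ)) 2 (volume : Measure Plane) := by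
    rw [he]; exact memLp_mul_conj v v
  rw [absSq, dif_pos h, mulConj]
  exact MemLp.toLp_congr _ _ (Eventually.of_forall fun x => congrFun he x)

theorem absSq_fn_ae (v : H1) : mulConj v v =ᵐ[volume] fun x => ((‖v.fn x‖ ^ 2 : ℝ) : ℂ) := by
  filter_upwards [mulConj_ae v v] with x hx
  rw [hx, Complex.mul_conj', Complex.ofReal_pow]

end H1

/-! ### The operator `L` -/

theorem measurable_symbolB : Measurable symbolB := by
  unfold symbolB
  fun_prop

theorem symbolB_nonneg (ξ : Plane) : 0 ≤ symbolB ξ := by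
  unfold symbolB
  positivity

theorem symbolB_le_one (ξ : Plane) : symbolB ξ ≤ 1 :=
  div_le_one_of_le₀ (by nlinarith [sq_nonneg (ξ 1)]) (by positivity)

theorem symbolB_neg (ξ : Plane) : symbolB (-ξ) = symbolB ξ := by
  simp [symbolB]

theorem norm_symbolB_le (ξ : Plane) : ‖(symbolB ξ : ℂ)‖ ≤ 1 := by
  rw [Complex.norm_real, Real.norm_of_nonneg (symbolB_nonneg ξ)]
  exact symbolB_le_one ξ

/-- The operator `B` as a bounded operator. -/
def opBL : L2 →L[ℂ] L2 :=
  multL (fun ξ => (symbolB ξ : ℂ)) (Complex.measurable_ofReal.comp measurable_symbolB)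
    norm_symbolB_le

theorem fourier_opB_ae (f : L2) :
    (𝓕 (opB f) : L2) =ᵐ[volume] fun ξ => (symbolB ξ : ℂ) * (𝓕 f : L2) ξ :=
  fourier_multL_ae _ (Complex.measurable_ofReal.comp measurable_symbolB) norm_symbolB_le f

theorem norm_opB_le (f : L2) : ‖opB f‖ ≤ ‖f‖ := by
  rw [← Lp.norm_fourier_eq (opB f), ← Lp.norm_fourier_eq f]
  refine Lp.norm_le_norm_of_ae_le ?_
  filter_upwards [fourier_opB_ae f] with ξ hξ
  rw [hξ, norm_mul]
  exact mul_le_of_le_one_left (norm_nonneg _) (norm_symbolB_le ξ)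

theorem inner_opB (f g : L2) :
    inner ℂ f (opB g) = ∫ ξ, (symbolB ξ : ℂ) * (conj ((𝓕 f : L2) ξ) * (𝓕 g : L2) ξ) := by
  rw [← Lp.inner_fourier_eq, inner_L2_def]
  refine integral_congr_ae ?_
  filter_upwards [fourier_opB_ae g] with ξ hξ
  rw [hξ]
  ring

theorem inner_opB_left (f g : L2) : inner ℂ (opB f) g = inner ℂ f (opB g) := by
  rw [← inner_conj_symm, inner_opB, inner_opB, ← integral_conj]
  congr 1
  ext ξ
  simp only [map_mul, Complex.conj_conj, Complex.conj_ofReal]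
  ring

/-- The operator `L = ν I + γ B` as a bounded operator. -/
def opLL (ν γ : ℝ) : L2 →L[ℂ] L2 := (ν : ℂ) • ContinuousLinearMap.id ℂ L2 + (γ : ℂ) • opBL

theorem opLL_apply (ν γ : ℝ) (f : L2) : opLL ν γ f = opL ν γ f := rfl

theorem norm_opLL_le (ν γ : ℝ) (f : L2) : ‖opLL ν γ f‖ ≤ (|ν| + |γ|) * ‖f‖ := by
  rw [opLL_apply, opL, add_mul]
  refine (norm_add_le _ _).trans ?_
  rw [norm_smul, norm_smul, Complex.norm_real, Complex.norm_real, Real.norm_eq_abs,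
    Real.norm_eq_abs]
  gcongr
  exact norm_opB_le f

theorem inner_opLL_left (ν γ : ℝ) (f g : L2) :
    inner ℂ (opLL ν γ f) g = inner ℂ f (opLL ν γ g) := by
  simp only [opLL_apply, opL, inner_add_left, inner_add_right, inner_smul_left, inner_smul_right,
    inner_opB_left, Complex.conj_ofReal]

/-- Complex conjugation of a Schwartz function composed with the reflection. -/
def schwartzConjNeg (φ : 𝓢(Plane, ℂ)) : 𝓢(Plane, ℂ) :=
  SchwartzMap.postcompCLM (𝕜 := ℝ) (Complex.conjCLE : ℂ →L[ℝ] ℂ)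
    (SchwartzMap.compCLMOfContinuousLinearEquiv ℝ (ContinuousLinearEquiv.neg ℝ) φ)

theorem schwartzConjNeg_apply (φ : 𝓢(Plane, ℂ)) (x : Plane) :
    schwartzConjNeg φ x = conj (φ (-x)) := by
  simp [schwartzConjNeg]

theorem fourier_schwartzConjNeg (φ : 𝓢(Plane, ℂ)) (ξ : Plane) :
    𝓕 (schwartzConjNeg φ) ξ = conj (𝓕 φ ξ) := by
  rw [SchwartzMap.fourier_coe, SchwartzMap.fourier_coe, Real.fourier_eq', Real.fourier_eq',
    ← integral_conj, ← integral_neg_eq_self]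
  congr 1
  ext x
  rw [schwartzConjNeg_apply, neg_neg, smul_eq_mul, smul_eq_mul, map_mul, ← Complex.exp_conj]
  congr 2
  simp [Complex.conj_ofNat]

theorem fourier_star_ae (f : L2) :
    (𝓕 (star f) : L2) =ᵐ[volume] fun ξ => conj ((𝓕 f : L2) (-ξ)) := by
  have hmp := Measure.measurePreserving_neg (volume : Measure Plane)
  have hm : MemLp (fun ξ => conj ((𝓕 f : L2) (-ξ))) 2 (volume : Measure Plane) :=
    ((Lp.memLp (𝓕 f : L2)).comp_measurePreserving hmp).star
  refine ae_eq_of_integral_schwartz (locallyIntegrable_L2 _)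
    (hm.locallyIntegrable (by norm_num)) fun φ => ?_
  rw [integral_schwartz_mul_fourier]
  have h1 : ∫ x, 𝓕 φ x * (star f : L2) x = conj (∫ x, 𝓕 (schwartzConjNeg φ) x * f x) := by
    rw [← integral_conj]
    refine integral_congr_ae ?_
    filter_upwards [Lp.coeFn_star f] with x hx
    rw [hx, fourier_schwartzConjNeg, Pi.star_apply, Complex.star_def, map_mul, Complex.conj_conj]
  rw [h1, ← integral_schwartz_mul_fourier, ← integral_conj, ← integral_neg_eq_self]
  congr 1
  ext x
  rw [schwartzConjNeg_apply, neg_neg, map_mul, Complex.conj_conj]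

/-- The symbol is real and even, so B commutes with complex conjugation and L(|v|²) is real. -/
theorem opB_star (f : L2) : opB (star f) = star (opB f) := by
  refine fourier_injective ?_
  have hmp := (Measure.measurePreserving_neg (volume : Measure Plane)).quasiMeasurePreserving
  filter_upwards [fourier_opB_ae (star f), fourier_star_ae (opB f), fourier_star_ae f,
    hmp.ae (fourier_opB_ae f)] with ξ h1 h2 h3 h4
  rw [h1, h2, h3, h4, map_mul, Complex.conj_ofReal, symbolB_neg]

theorem opLL_star (ν γ : ℝ) (f : L2) : opLL ν γ (star f) = star (opLL ν γ f) := by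
  rw [opLL_apply, opLL_apply, opL, opL, opB_star]
  refine Lp.ext ?_
  filter_upwards [Lp.coeFn_star ((ν : ℂ) • f + (γ : ℂ) • opB f),
    Lp.coeFn_add ((ν : ℂ) • f) ((γ : ℂ) • opB f),
    Lp.coeFn_add ((ν : ℂ) • star f) ((γ : ℂ) • star (opB f)), Lp.coeFn_smul (ν : ℂ) f,
    Lp.coeFn_smul (ν : ℂ) (star f), Lp.coeFn_smul (γ : ℂ) (opB f),
    Lp.coeFn_smul (γ : ℂ) (star (opB f)), Lp.coeFn_star f, Lp.coeFn_star (opB f)]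
    with x h1 h2 h3 h4 h5 h6 h7 h8 h9
  rw [h1, h3]
  simp only [Pi.star_apply, Pi.add_apply, Pi.smul_apply, h2, h4, h5, h6, h7, h8, h9, star_add,
    smul_eq_mul, Complex.star_def, map_mul, Complex.conj_ofReal]

theorem inner_star (f g : L2) : inner ℂ (star f) (star g) = conj (inner ℂ f g) := by
  rw [inner_L2_def, inner_L2_def, ← integral_conj]
  refine integral_congr_ae ?_
  filter_upwards [Lp.coeFn_star f, Lp.coeFn_star g] with x h1 h2
  rw [h1, h2, Pi.star_apply, Pi.star_apply, Complex.star_def, map_mul]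

/-- Holds because L(|u|²) is real. It gives conservation of mass (the case v = w = u), and it
identifies the two halves of the derivative of the quartic functional. -/
theorem inner_mulConj_swap (ν γ : ℝ) (u v w : H1) :
    inner ℂ (H1.mulConj v w) (opLL ν γ (H1.mulConj u u)) =
      conj (inner ℂ (H1.mulConj w v) (opLL ν γ (H1.mulConj u u))) := by
  rw [← inner_star, ← opLL_star, H1.star_mulConj, H1.star_mulConj]

theorem quartic_eq (ν γ : ℝ) (v : H1) :
    quartic ν γ v = (inner ℂ (H1.mulConj v v) (opLL ν γ (H1.mulConj v v))).re := by
  rw [quartic, H1.absSq_fn, inner_L2_def, opLL_apply]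
  rw [← RCLike.re_eq_complex_re, ← integral_re (integrable_conj_mul _ _)]
  refine integral_congr_ae ?_
  filter_upwards [H1.absSq_fn_ae v] with x hx
  rw [hx, Complex.conj_ofReal, RCLike.re_eq_complex_re, Complex.re_ofReal_mul, mul_comm]

theorem integral_nonlinearity_eq (ν γ : ℝ) (u φ : H1) :
    ∫ x, opL ν γ (absSq u.fn) x * u.fn x * conj (φ.fn x) =
      inner ℂ (H1.mulConj φ u) (opLL ν γ (H1.mulConj u u)) := by
  rw [H1.absSq_fn, inner_L2_def, opLL_apply]
  refine integral_congr_ae ?_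
  filter_upwards [H1.mulConj_ae φ u] with x hx
  rw [hx, map_mul, Complex.conj_conj]
  ring

theorem abs_quartic_le (ν γ : ℝ) (v : H1) :
    |quartic ν γ v| ≤ (|ν| + |γ|) * ladyK ^ 2 * ‖v.grad‖ ^ 2 * ‖v.fn‖ ^ 2 := by
  rw [quartic_eq]
  refine (Complex.abs_re_le_norm _).trans ((norm_inner_le_norm _ _).trans ?_)
  have h := norm_opLL_le ν γ (H1.mulConj v v)
  have h2 := H1.norm_mulConj_self_le v
  calc ‖H1.mulConj v v‖ * ‖opLL ν γ (H1.mulConj v v)‖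
      ≤ (ladyK * (‖v.fn‖ * ‖v.grad‖)) * ((|ν| + |γ|) * (ladyK * (‖v.fn‖ * ‖v.grad‖))) := by
        have := ladyK_nonneg
        gcongr
        exact h.trans (by gcongr)
    _ = _ := by ring

/-! ### Bounds for frequency localised functions -/

/-- The area of the unit disc. -/
def discArea : ℝ := volume.real (Metric.ball (0 : Plane) 1)

theorem discArea_pos : 0 < discArea :=
  ENNReal.toReal_pos (Metric.measure_ball_pos _ _ one_pos).ne' measure_ball_lt_top.ne

theorem volume_real_closedBall {r : ℝ} (hr : 0 ≤ r) :
    volume.real (Metric.closedBall (0 : Plane) r) = r ^ 2 * discArea := by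
  rw [Measure.real, Measure.addHaar_closedBall _ _ hr, finrank_euclideanSpace_fin,
    ENNReal.toReal_mul, ENNReal.toReal_ofReal (by positivity), discArea, Measure.real]

/-- Cauchy–Schwarz for F = (W^{1/2}F)·W^{−1/2} on S. It is carried out through the pointwise
inequality of arithmetic and geometric means, weighted so that the two halves each integrate to at
most MY/2; the same majorant gives integrability of F. -/
theorem integral_norm_le_of_weight {F : Plane → ℂ} (hF : AEStronglyMeasurable F volume)
    {S : Set Plane} (hS : MeasurableSet S) (hFS : ∀ᵐ ξ, ξ ∉ S → F ξ = 0) {W : Plane → ℝ}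
    (hW : ∀ ξ, 0 < W ξ) {M Y : ℝ} (hM : 0 < M) (hY : 0 < Y)
    (h1 : Integrable fun ξ => W ξ * ‖F ξ‖ ^ 2) (h1' : ∫ ξ, W ξ * ‖F ξ‖ ^ 2 ≤ M ^ 2)
    (h2 : IntegrableOn (fun ξ => (W ξ)⁻¹) S) (h2' : ∫ ξ in S, (W ξ)⁻¹ ≤ Y ^ 2) :
    Integrable F ∧ ∫ ξ, ‖F ξ‖ ≤ M * Y := by
  have h2i : Integrable (S.indicator fun ξ => (W ξ)⁻¹) := (integrable_indicator_iff hS).2 h2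
  set G : Plane → ℝ := fun ξ =>
    Y / (2 * M) * (W ξ * ‖F ξ‖ ^ 2) + M / (2 * Y) * S.indicator (fun ξ => (W ξ)⁻¹) ξ
  have hG : Integrable G := (h1.const_mul _).add (h2i.const_mul _)
  have hle : ∀ᵐ ξ, ‖F ξ‖ ≤ G ξ := by
    filter_upwards [hFS] with ξ hξ
    have hw := hW ξ
    by_cases hs : ξ ∈ S
    · simp only [G, Set.indicator_of_mem hs]
      have key : Y / (2 * M) * (W ξ * ‖F ξ‖ ^ 2) + M / (2 * Y) * (W ξ)⁻¹ - ‖F ξ‖ =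
          (Y * W ξ * ‖F ξ‖ - M) ^ 2 / (2 * M * Y * W ξ) := by
        field_simp
        ring
      have : 0 ≤ (Y * W ξ * ‖F ξ‖ - M) ^ 2 / (2 * M * Y * W ξ) := by positivity
      linarith
    · simp only [G, Set.indicator_of_notMem hs, hξ hs]
      simp
  have hFi : Integrable F := hG.mono' hF hle
  refine ⟨hFi, (integral_mono_ae hFi.norm hG hle).trans ?_⟩
  simp only [G]
  rw [integral_add (h1.const_mul _) (h2i.const_mul _), integral_const_mul, integral_const_mul,
    integral_indicator hS]
  calc Y / (2 * M) * (∫ ξ, W ξ * ‖F ξ‖ ^ 2) + M / (2 * Y) * ∫ ξ in S, (W ξ)⁻¹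
      ≤ Y / (2 * M) * M ^ 2 + M / (2 * Y) * Y ^ 2 := by gcongr
    _ = M * Y := by field_simp; norm_num

theorem integrableOn_inv_one_add_sq (S : Set Plane) (hS : volume S ≠ ⊤) :
    IntegrableOn (fun ξ : Plane => (1 + ‖ξ‖ ^ 2)⁻¹) S := by
  have : IsFiniteMeasure (volume.restrict S) := ⟨by simpa using hS.lt_top⟩
  refine Integrable.of_bound (C := 1) ?_ (Eventually.of_forall fun ξ => ?_)
  · exact (Continuous.inv₀ (by fun_prop) fun ξ => by positivity).aestronglyMeasurable
  · rw [Real.norm_of_nonneg (by positivity)]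
    exact inv_le_one_of_one_le₀ (by nlinarith [sq_nonneg ‖ξ‖])

/-- Each dyadic annulus contributes at most its area, 4·4^k `discArea`, times 4^(−k). The resulting
linear growth in k is the logarithmic divergence that keeps H¹ out of L^∞. -/
theorem integral_inv_one_add_sq_le (k : ℕ) :
    ∫ ξ in Metric.closedBall (0 : Plane) (2 ^ k), (1 + ‖ξ‖ ^ 2)⁻¹ ≤ discArea * (1 + 4 * k) := by
  induction k with
  | zero =>
    have h : ∫ ξ in Metric.closedBall (0 : Plane) (2 ^ 0), (1 + ‖ξ‖ ^ 2)⁻¹ ≤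
        ∫ ξ in Metric.closedBall (0 : Plane) (2 ^ 0), (1 : ℝ) :=
      setIntegral_mono (integrableOn_inv_one_add_sq _ measure_closedBall_lt_top.ne)
        (integrableOn_const measure_closedBall_lt_top.ne)
        fun ξ => inv_le_one_of_one_le₀ (by nlinarith [sq_nonneg ‖ξ‖])
    refine h.trans ?_
    rw [setIntegral_const, volume_real_closedBall (by positivity)]
    simp
  | succ k ih =>
    set B := Metric.closedBall (0 : Plane) (2 ^ k)
    set B' := Metric.closedBall (0 : Plane) (2 ^ (k + 1)) with hB'
    have hsub : B ⊆ B' := Metric.closedBall_subset_closedBall (by gcongr <;> simp)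
    have hBm : MeasurableSet B := Metric.isClosed_closedBall.measurableSet
    have hBm' : MeasurableSet B' := Metric.isClosed_closedBall.measurableSet
    have hfin : volume (B' \ B) ≠ ⊤ :=
      ((measure_mono Set.sdiff_subset).trans_lt measure_closedBall_lt_top).ne
    have h1 : ∫ ξ in B' \ B, (1 + ‖ξ‖ ^ 2)⁻¹ ≤ 4 * discArea := by
      have h : ∫ ξ in B' \ B, (1 + ‖ξ‖ ^ 2)⁻¹ ≤ ∫ ξ in B' \ B, ((2 : ℝ) ^ k)⁻¹ ^ 2 := by
        refine setIntegral_mono_on (integrableOn_inv_one_add_sq _ hfin) (integrableOn_const hfin)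
          (hBm'.diff hBm) fun ξ hξ => ?_
        have h3 : (2 : ℝ) ^ k < ‖ξ‖ := by simpa [B] using hξ.2
        rw [inv_pow]
        gcongr
        nlinarith [pow_pos (show (0 : ℝ) < 2 by norm_num) k]
      refine h.trans ?_
      rw [setIntegral_const, smul_eq_mul]
      have h4 : volume.real (B' \ B) ≤ (2 ^ (k + 1)) ^ 2 * discArea := by
        rw [← volume_real_closedBall (by positivity)]
        exact measureReal_mono Set.sdiff_subset measure_closedBall_lt_top.ne
      calc volume.real (B' \ B) * ((2 : ℝ) ^ k)⁻¹ ^ 2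
          ≤ (2 ^ (k + 1)) ^ 2 * discArea * ((2 : ℝ) ^ k)⁻¹ ^ 2 := by gcongr
        _ = 4 * discArea := by field_simp; ring
    have h2 := setIntegral_union (f := fun ξ : Plane => (1 + ‖ξ‖ ^ 2)⁻¹) (μ := volume)
      (disjoint_sdiff_self_right (x := B) (y := B')) (hBm'.diff hBm)
      (integrableOn_inv_one_add_sq B measure_closedBall_lt_top.ne)
      (integrableOn_inv_one_add_sq _ hfin)
    rw [Set.union_sdiff_cancel hsub] at h2
    rw [h2]
    push_cast
    linarith

/-- The constant `sqrt (|B₁| (1 + 4 k))` bounding the `L¹` norm of frequency localised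
functions. -/
def logK (k : ℕ) : ℝ := √(discArea * (1 + 4 * k))

theorem logK_pos (k : ℕ) : 0 < logK k :=
  Real.sqrt_pos.2 (mul_pos discArea_pos (by positivity))

theorem logK_sq (k : ℕ) : logK k ^ 2 = discArea * (1 + 4 * k) :=
  Real.sq_sqrt (mul_pos discArea_pos (by positivity)).le

/-- Truncation at 2^k restores the sup bound at the price of `logK k`, of order √k. The weight is
1+|ξ|², below the weight 1+4π²|ξ|² of the H¹ norm. -/
theorem integral_norm_fourier_cutL_le {k : ℕ} (u : H1) {M : ℝ} (hM : 0 < M) (hu : ‖u‖ ≤ M) :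
    Integrable (𝓕 (cutL (by positivity : (0 : ℝ) ≤ 2 ^ k) u.fn).fn : L2) ∧
    ∫ ξ, ‖(𝓕 (cutL (by positivity : (0 : ℝ) ≤ 2 ^ k) u.fn).fn : L2) ξ‖ ≤ M * logK k := by
  set a := cutL (by positivity : (0 : ℝ) ≤ 2 ^ k) u.fn
  have ha := fourier_cutL (by positivity : (0 : ℝ) ≤ 2 ^ k) u.fn
  have hau : ‖a‖ ≤ ‖u‖ := H1.norm_le_of_fourier (by
    filter_upwards [ha] with ξ hξ
    rw [hξ, norm_mul]
    exact mul_le_of_le_one_left (norm_nonneg _) (norm_cutSymbol_le _ _))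
  have hpi3 := Real.pi_gt_three
  have hi : Integrable fun ξ => (1 + ‖ξ‖ ^ 2) * ‖(𝓕 a.fn : L2) ξ‖ ^ 2 := by
    refine ((integrable_norm_sq (𝓕 a.fn : L2)).add
      ((H1.fourier_norm_grad_sq a).1.const_mul (1 / (4 * Real.pi ^ 2)))).congr
      (Eventually.of_forall fun ξ => ?_)
    simp only [Pi.add_apply]
    field_simp
  refine integral_norm_le_of_weight (Lp.aestronglyMeasurable _)
    (S := Metric.closedBall (0 : Plane) (2 ^ k)) Metric.isClosed_closedBall.measurableSet ?_
    (W := fun ξ => 1 + ‖ξ‖ ^ 2) (fun ξ => by positivity) hM (logK_pos k) hi ?_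
    (integrableOn_inv_one_add_sq _ measure_closedBall_lt_top.ne) ?_
  · filter_upwards [ha] with ξ hξ hs
    rw [hξ, cutSymbol_of_lt (by simpa using hs), zero_mul]
  · calc ∫ ξ, (1 + ‖ξ‖ ^ 2) * ‖(𝓕 a.fn : L2) ξ‖ ^ 2
        ≤ ∫ ξ, (‖(𝓕 a.fn : L2) ξ‖ ^ 2 +
            (4 * Real.pi ^ 2 * ‖ξ‖ ^ 2) * ‖(𝓕 a.fn : L2) ξ‖ ^ 2) := by
          refine integral_mono hi ((integrable_norm_sq _).add (H1.fourier_norm_grad_sq a).1)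
            fun ξ => ?_
          have h1 : 0 ≤ ‖ξ‖ ^ 2 * ‖(𝓕 a.fn : L2) ξ‖ ^ 2 := by positivity
          have h2 : 0 ≤ (4 * Real.pi ^ 2 - 1) * (‖ξ‖ ^ 2 * ‖(𝓕 a.fn : L2) ξ‖ ^ 2) :=
            mul_nonneg (by nlinarith) h1
          simp only
          nlinarith
      _ = ‖a‖ ^ 2 := by
          rw [integral_add (integrable_norm_sq _) (H1.fourier_norm_grad_sq a).1, H1.norm_sq,
            H1.norm_fn_sq_fourier, (H1.fourier_norm_grad_sq a).2]
      _ ≤ M ^ 2 := by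
          gcongr
          exact hau.trans hu
  · rw [logK_sq]
    exact integral_inv_one_add_sq_le k

/-- Bernstein's inequality. -/
theorem norm_le_of_frequency_localised {n : ℝ} (hn : 0 < n) (y : L2)
    (hy : ∀ᵐ ξ, n < ‖ξ‖ → (𝓕 y : L2) ξ = 0) :
    ∀ᵐ x, ‖y x‖ ≤ √discArea * n * ‖y‖ := by
  rcases (norm_nonneg y).eq_or_lt with h0 | h0
  · have : y = 0 := norm_eq_zero.1 h0.symm
    filter_upwards [Lp.coeFn_zero ℂ 2 (volume : Measure Plane)] with x hx
    rw [this, hx]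
    simp
  · have hd := discArea_pos
    have h := integral_norm_le_of_weight (F := (𝓕 y : L2)) (Lp.aestronglyMeasurable _)
      (S := Metric.closedBall (0 : Plane) n) Metric.isClosed_closedBall.measurableSet
      (by filter_upwards [hy] with ξ hξ hs using hξ (by simpa using hs))
      (W := fun _ => 1) (fun _ => one_pos) h0 (show 0 < √discArea * n by positivity)
      (by simpa using integrable_norm_sq (𝓕 y : L2))
      (by simp [← norm_L2_sq])
      (integrableOn_const (μ := volume) measure_closedBall_lt_top.ne (by simp))
      (by
        rw [setIntegral_const, volume_real_closedBall hn.le, mul_pow, Real.sq_sqrt hd.le]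
        simp [mul_comm])
    filter_upwards [norm_le_of_integrable_fourier y h.1] with x hx
    refine hx.trans (h.2.trans_eq (by ring))

theorem fourierInv_conj_neg (F : Plane → ℂ) (x : Plane) :
    𝓕⁻ (fun ξ => conj (F (-ξ))) x = conj (𝓕⁻ F x) := by
  rw [Real.fourierInv_eq', Real.fourierInv_eq', ← integral_conj, ← integral_neg_eq_self]
  congr 1
  ext ξ
  rw [neg_neg, smul_eq_mul, smul_eq_mul, map_mul, ← Complex.exp_conj]
  congr 2
  simp [Complex.conj_ofNat]

/-- The transform of |a|² is the convolution of â with its conjugate reflection, and the L¹ norm is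
submultiplicative under convolution. -/
theorem integral_norm_fourier_mulConj_le (a : H1) {A : ℝ} (ha : Integrable (𝓕 a.fn : L2))
    (hA : ∫ ξ, ‖(𝓕 a.fn : L2) ξ‖ ≤ A) :
    Integrable (𝓕 (a.mulConj a) : L2) ∧ ∫ ξ, ‖(𝓕 (a.mulConj a) : L2) ξ‖ ≤ A ^ 2 := by
  set F : Plane → ℂ := ((𝓕 a.fn : L2) : Plane → ℂ) with hFdef
  set G : Plane → ℂ := fun ξ => conj (F (-ξ)) with hGdef
  have hG : Integrable G := (Complex.conjCLE : ℂ →L[ℝ] ℂ).integrable_comp ha.comp_neg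
  set h : Plane → ℂ := convolution F G (ContinuousLinearMap.mul ℂ ℂ) volume
  have hh : Integrable h := ha.integrable_convolution _ hG
  have hinv : 𝓕⁻ h =ᵐ[volume] a.mulConj a := by
    have h1 := fourierInv_ae_eq (𝓕 a.fn) ha
    rw [FourierTransform.fourierInv_fourier_eq] at h1
    filter_upwards [h1, a.mulConj_ae a] with x hx hx2
    rw [hx2, hx, ← fourierInv_conj_neg, Real.fourierInv_eq_fourier_neg,
      Real.fourierInv_eq_fourier_neg, Real.fourierInv_eq_fourier_neg]
    exact Real.fourier_mul_convolution_eq ha hG _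
  have hF := fourier_ae_eq_of_fourierInv _ hh hinv
  refine ⟨hh.congr hF.symm, ?_⟩
  have h2 : ∫ ξ, ‖(𝓕 (a.mulConj a) : L2) ξ‖ = ∫ ξ, ‖h ξ‖ := by
    refine integral_congr_ae ?_
    filter_upwards [hF] with ξ hξ
    rw [hξ]
  rw [h2]
  have h3 : ∀ ξ, ‖h ξ‖ ≤ convolution (fun ξ => ‖F ξ‖) (fun ξ => ‖G ξ‖)
      (ContinuousLinearMap.mul ℝ ℝ) volume ξ := fun ξ => by
    refine (norm_integral_le_integral_norm _).trans_eq ?_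
    rw [convolution]
    simp
  have hnn : ∫ ξ, ‖G ξ‖ = ∫ ξ, ‖F ξ‖ := by
    rw [← integral_neg_eq_self]
    simp [hGdef]
  refine (integral_mono hh.norm (ha.norm.integrable_convolution _ hG.norm) h3).trans ?_
  rw [integral_convolution _ ha.norm hG.norm, hnn, ContinuousLinearMap.mul_apply', sq]
  have h0 : 0 ≤ ∫ ξ, ‖F ξ‖ := integral_nonneg fun _ => norm_nonneg _
  exact mul_le_mul hA hA h0 (h0.trans hA)

/-- B is not bounded on L^∞, but a bounded multiplier preserves integrability of the transform. This
is why sup bounds are carried as L¹ bounds on the Fourier side. -/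
theorem norm_opLL_mulConj_le (ν γ : ℝ) (a : H1) {A : ℝ} (ha : Integrable (𝓕 a.fn : L2))
    (hA : ∫ ξ, ‖(𝓕 a.fn : L2) ξ‖ ≤ A) :
    ∀ᵐ x, ‖opLL ν γ (a.mulConj a) x‖ ≤ (|ν| + |γ|) * A ^ 2 := by
  obtain ⟨h1, h2⟩ := integral_norm_fourier_mulConj_le a ha hA
  have hle : ∀ᵐ ξ, ‖(𝓕 (opLL ν γ (a.mulConj a)) : L2) ξ‖ ≤
      (|ν| + |γ|) * ‖(𝓕 (a.mulConj a) : L2) ξ‖ := by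
    filter_upwards [fourier_add_ae ((ν : ℂ) • a.mulConj a) ((γ : ℂ) • opB (a.mulConj a)),
      fourier_smul_ae ν (a.mulConj a), fourier_smul_ae γ (opB (a.mulConj a)),
      fourier_opB_ae (a.mulConj a)] with ξ h1 h2 h3 h4
    rw [opLL_apply, opL, h1, h2, h3, h4, add_mul]
    refine (norm_add_le _ _).trans ?_
    rw [norm_mul, norm_mul, norm_mul, Complex.norm_real ν, Complex.norm_real γ, Real.norm_eq_abs,
      Real.norm_eq_abs]
    gcongr
    exact mul_le_of_le_one_left (norm_nonneg _) (norm_symbolB_le ξ)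
  have hi : Integrable (𝓕 (opLL ν γ (a.mulConj a)) : L2) :=
    (h1.norm.const_mul _).mono' (Lp.aestronglyMeasurable _) hle
  filter_upwards [norm_le_of_integrable_fourier _ hi] with x hx
  refine hx.trans ((integral_mono_ae hi.norm (h1.norm.const_mul _) hle).trans ?_)
  rw [integral_const_mul]
  gcongr

/-! ### The nonlinear term under frequency truncation -/

theorem norm_inner_mulConj_le (y r : H1) {g : L2} {K : ℝ}
    (hg : ∀ᵐ x, ‖g x‖ ≤ K) :
    ‖inner ℂ (y.mulConj r) g‖ ≤ K * (‖y.fn‖ * ‖r.fn‖) := by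
  have hm : MemLp (fun x => g x * r.fn x) 2 volume := by
    refine (Lp.memLp r.fn).of_le_mul (c := K)
      ((Lp.aestronglyMeasurable g).mul (Lp.aestronglyMeasurable _)) ?_
    filter_upwards [hg] with x hx
    rw [norm_mul]
    gcongr
  have h1 : inner ℂ (y.mulConj r) g = inner ℂ y.fn (hm.toLp _) := by
    rw [inner_L2_def, inner_L2_def]
    refine integral_congr_ae ?_
    filter_upwards [y.mulConj_ae r, hm.coeFn_toLp] with x h1 h2
    rw [h1, h2, map_mul, Complex.conj_conj]
    ring
  have h2 : ‖hm.toLp _‖ ≤ K * ‖r.fn‖ := by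
    refine norm_L2_le_of_ae ?_
    filter_upwards [hg, hm.coeFn_toLp] with x h1 h2
    rw [h2, norm_mul]
    gcongr
  rw [h1]
  refine (norm_inner_le_norm _ _).trans ?_
  calc ‖y.fn‖ * ‖hm.toLp _‖ ≤ ‖y.fn‖ * (K * ‖r.fn‖) := by gcongr
    _ = _ := by ring

/-- The frequency cutoff to the ball of radius `2 ^ k`. -/
def dyadicL (k : ℕ) : L2 →L[ℂ] H1 := cutL (by positivity : (0 : ℝ) ≤ 2 ^ k)

theorem fourier_dyadicL (k : ℕ) (f : L2) :
    (𝓕 (dyadicL k f).fn : L2) =ᵐ[volume] fun ξ => cutSymbol (2 ^ k) ξ * (𝓕 f : L2) ξ :=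
  fourier_cutL _ f

theorem norm_fourier_dyadicL_le (k : ℕ) (f : L2) :
    ∀ᵐ ξ, ‖(𝓕 (dyadicL k f).fn : L2) ξ‖ ≤ ‖(𝓕 f : L2) ξ‖ := by
  filter_upwards [fourier_dyadicL k f] with ξ hξ
  rw [hξ, norm_mul]
  exact mul_le_of_le_one_left (norm_nonneg _) (norm_cutSymbol_le _ _)

theorem fourier_sub_dyadicL (k : ℕ) (u : H1) :
    ∀ᵐ ξ, (2 ^ k < ‖ξ‖ → (𝓕 (u - dyadicL k u.fn).fn : L2) ξ = (𝓕 u.fn : L2) ξ) ∧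
      (‖ξ‖ ≤ 2 ^ k → (𝓕 (u - dyadicL k u.fn).fn : L2) ξ = 0) := by
  filter_upwards [fourier_dyadicL k u.fn, fourier_sub_ae u.fn (dyadicL k u.fn).fn] with ξ h1 h2
  rw [H1.fn_sub, h2, h1]
  exact ⟨fun h => by rw [cutSymbol_of_lt h]; ring, fun h => by rw [cutSymbol_of_le h]; ring⟩

theorem norm_fourier_sub_dyadicL_le (k : ℕ) (u : H1) :
    ∀ᵐ ξ, ‖(𝓕 (u - dyadicL k u.fn).fn : L2) ξ‖ ≤ ‖(𝓕 u.fn : L2) ξ‖ := by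
  filter_upwards [fourier_sub_dyadicL k u] with ξ hξ
  rcases le_or_gt ‖ξ‖ (2 ^ k) with h | h
  · rw [hξ.2 h, norm_zero]
    positivity
  · rw [hξ.1 h]

theorem norm_sub_dyadicL_le (k : ℕ) (u : H1) :
    2 ^ k * ‖(u - dyadicL k u.fn).fn‖ ≤ ‖u.grad‖ := by
  set r := u - dyadicL k u.fn
  have hpi3 := Real.pi_gt_three
  refine abs_le_of_sq_le_sq' ?_ (norm_nonneg _) |>.2
  rw [mul_pow, H1.norm_fn_sq_fourier, ← integral_const_mul, (H1.fourier_norm_grad_sq u).2]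
  refine integral_mono_ae ((integrable_norm_sq _).const_mul _) (H1.fourier_norm_grad_sq u).1 ?_
  filter_upwards [fourier_sub_dyadicL k u] with ξ hξ
  rcases le_or_gt ‖ξ‖ (2 ^ k) with h | h
  · simp only [r, hξ.2 h]
    simp only [norm_zero, ne_eq, OfNat.ofNat_ne_zero, not_false_eq_true, zero_pow, mul_zero]
    positivity
  · simp only [r, hξ.1 h]
    have h2 : ((2 : ℝ) ^ k) ^ 2 ≤ ‖ξ‖ ^ 2 := by gcongr
    gcongr
    nlinarith [mul_nonneg (show 0 ≤ 4 * Real.pi ^ 2 - 1 by nlinarith) (sq_nonneg ‖ξ‖)]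

/-- Every trilinear term needs at most two sup-type bounds, each costing √k, so the total loss is a
factor k. In the second estimate one factor r = u − a is always kept in L²; this smallness is what
makes the energy argument converge. -/
theorem exists_truncation_bound (ν γ : ℝ) : ∃ C : ℝ, 0 ≤ C ∧ ∀ (k : ℕ), 1 ≤ k →
    ∀ (u : H1) (M : ℝ), 0 < M → ‖u‖ ≤ M →
    (∀ y : H1, ‖inner ℂ (y.mulConj (dyadicL k u.fn))
        (opLL ν γ ((dyadicL k u.fn).mulConj (dyadicL k u.fn)))‖ ≤ C * M ^ 3 * k * ‖y.fn‖) ∧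
    (∀ y : H1, (∀ᵐ ξ, 2 ^ k < ‖ξ‖ → (𝓕 y.fn : L2) ξ = 0) →
      ‖inner ℂ (y.mulConj u) (opLL ν γ (u.mulConj u)) -
        inner ℂ (y.mulConj (dyadicL k u.fn))
          (opLL ν γ ((dyadicL k u.fn).mulConj (dyadicL k u.fn)))‖ ≤
        C * M ^ 2 * k * ‖y.fn‖ * ‖(u - dyadicL k u.fn).fn‖) := by
  have hV := discArea_pos
  have hK := ladyK_nonneg
  set c : ℝ := |ν| + |γ|
  have hc : 0 ≤ c := by positivity
  set V : ℝ := discArea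
  set K : ℝ := ladyK
  -- The factor 5 comes from 1 + 4k ≤ 5k for k ≥ 1.
  set C₀ : ℝ := c * (V + (√V + √V) * (2 * √V + K)) * 5
  refine ⟨C₀, by positivity, fun k hk u M hM hu => ?_⟩
  have hk1 : (1 : ℝ) ≤ k := by exact_mod_cast hk
  set a := dyadicL k u.fn
  set r := u - a
  set q : ℝ := √(1 + 4 * k)
  have hq : q ^ 2 = 1 + 4 * k := Real.sq_sqrt (by positivity)
  have hq0 : 0 ≤ q := Real.sqrt_nonneg _
  have hq1 : 1 ≤ q := by
    by_contra! h
    nlinarith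
  set A : ℝ := M * logK k with hA
  have hAq : A = M * (√V * q) := by
    rw [hA, logK, Real.sqrt_mul hV.le]
  have hsV := Real.sq_sqrt hV.le
  have hsV0 := Real.sqrt_nonneg V
  have hA2 : A ^ 2 = M ^ 2 * (V * q ^ 2) := by rw [hAq, mul_pow, mul_pow, hsV]
  have hA0 : 0 ≤ A := by rw [hAq]; positivity
  obtain ⟨hai, haA⟩ := integral_norm_fourier_cutL_le (k := k) u hM hu
  have hasup : ∀ᵐ x, ‖a.fn x‖ ≤ A := by
    filter_upwards [norm_le_of_integrable_fourier _ hai] with x hx using hx.trans haA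
  have hLa : ∀ᵐ x, ‖opLL ν γ (a.mulConj a) x‖ ≤ c * A ^ 2 := norm_opLL_mulConj_le ν γ a hai haA
  have hau : ‖a.fn‖ ≤ M :=
    (H1.norm_fn_le_of_fourier (norm_fourier_dyadicL_le k u.fn)).trans ((H1.norm_fn_le u).trans hu)
  have hr : ‖r‖ ≤ M := (H1.norm_le_of_fourier (norm_fourier_sub_dyadicL_le k u)).trans hu
  refine ⟨fun y => ?_, fun y hy => ?_⟩
  · refine (norm_inner_mulConj_le y a hLa).trans ?_
    calc c * A ^ 2 * (‖y.fn‖ * ‖a.fn‖) ≤ c * A ^ 2 * (‖y.fn‖ * M) := by gcongr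
      _ = c * (V * q ^ 2) * M ^ 3 * ‖y.fn‖ := by rw [hA2]; ring
      _ ≤ c * (V * (5 * k)) * M ^ 3 * ‖y.fn‖ := by
        gcongr
        rw [hq]
        linarith
      _ = c * (V + 0) * 5 * M ^ 3 * k * ‖y.fn‖ := by ring
      _ ≤ C₀ * M ^ 3 * k * ‖y.fn‖ := by
        simp only [C₀]
        gcongr
        positivity
  · set d : L2 := u.mulConj u - a.mulConj a with hd
    have hu_eq : u = a + r := by simp [r]
    have hd_eq : d = a.mulConj r + r.mulConj a + r.mulConj r := by
      rw [hd, hu_eq, H1.mulConj_add_left, H1.mulConj_add_right, H1.mulConj_add_right]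
      abel
    have hdn : ‖d‖ ≤ (2 * A + K * M) * ‖r.fn‖ := by
      rw [hd_eq]
      refine (norm_add₃_le).trans ?_
      have h1 := H1.norm_mulConj_le_of_bound_left hasup r
      have h2 := H1.norm_mulConj_le_of_bound_right r hasup
      have h3 := H1.norm_mulConj_self_le r
      have h4 : K * (‖r.fn‖ * ‖r.grad‖) ≤ K * (‖r.fn‖ * M) := by
        gcongr
        exact (H1.norm_grad_le r).trans hr
      linarith
    have hLd : ‖opLL ν γ d‖ ≤ c * ((2 * A + K * M) * ‖r.fn‖) :=
      (norm_opLL_le ν γ d).trans (by gcongr)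
    have hsplit : inner ℂ (y.mulConj u) (opLL ν γ (u.mulConj u)) -
        inner ℂ (y.mulConj a) (opLL ν γ (a.mulConj a)) =
        inner ℂ (y.mulConj r) (opLL ν γ (a.mulConj a)) +
          (inner ℂ (y.mulConj a) (opLL ν γ d) + inner ℂ (y.mulConj r) (opLL ν γ d)) := by
      have h1 : y.mulConj u = y.mulConj a + y.mulConj r := by
        conv_lhs => rw [hu_eq]
        exact H1.mulConj_add_right _ _ _
      rw [h1, hd, map_sub]
      simp only [inner_add_left, inner_sub_right]
      ring
    have hysup := norm_le_of_frequency_localised (by positivity) y.fn hy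
    have hnr : 2 ^ k * ‖r.fn‖ ≤ M :=
      (norm_sub_dyadicL_le k u).trans ((H1.norm_grad_le u).trans hu)
    have T1 := norm_inner_mulConj_le y r hLa
    have T2 : ‖inner ℂ (y.mulConj a) (opLL ν γ d)‖ ≤
        (A * ‖y.fn‖) * (c * ((2 * A + K * M) * ‖r.fn‖)) :=
      (norm_inner_le_norm _ _).trans
        (mul_le_mul (H1.norm_mulConj_le_of_bound_right y hasup) hLd (norm_nonneg _) (by positivity))
    -- Here r has no sup bound. Bernstein's inequality for y costs 2^k, absorbed by 2^k‖r‖₂ ≤ ‖∇u‖₂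
    -- ≤ M.
    have T3 : ‖inner ℂ (y.mulConj r) (opLL ν γ d)‖ ≤
        (√V * ‖y.fn‖ * M) * (c * ((2 * A + K * M) * ‖r.fn‖)) := by
      refine (norm_inner_le_norm _ _).trans
        (mul_le_mul ?_ hLd (norm_nonneg _) (by positivity))
      refine (H1.norm_mulConj_le_of_bound_left hysup r).trans ?_
      calc √V * 2 ^ k * ‖y.fn‖ * ‖r.fn‖ = √V * ‖y.fn‖ * (2 ^ k * ‖r.fn‖) := by ring
        _ ≤ √V * ‖y.fn‖ * M := by gcongr
    rw [hsplit]
    refine (norm_add_le _ _).trans ((add_le_add_right (norm_add_le _ _) _).trans ?_)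
    calc _ ≤ c * A ^ 2 * (‖y.fn‖ * ‖r.fn‖) + ((A * ‖y.fn‖) * (c * ((2 * A + K * M) * ‖r.fn‖)) +
          (√V * ‖y.fn‖ * M) * (c * ((2 * A + K * M) * ‖r.fn‖))) := by gcongr
      _ = c * (V * q ^ 2 + (√V * q + √V) * (2 * √V * q + K)) * M ^ 2 *
          (‖y.fn‖ * ‖r.fn‖) := by rw [hA2, hAq]; ring
      _ ≤ c * (V * q ^ 2 + (√V * q + √V * q) * (2 * √V * q + K * q)) * M ^ 2 *
          (‖y.fn‖ * ‖r.fn‖) := by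
        gcongr
        · exact le_mul_of_one_le_right hsV0 hq1
        · exact le_mul_of_one_le_right hK hq1
      _ = c * (V + (√V + √V) * (2 * √V + K)) * q ^ 2 * M ^ 2 * (‖y.fn‖ * ‖r.fn‖) := by ring
      _ ≤ c * (V + (√V + √V) * (2 * √V + K)) * (5 * k) * M ^ 2 * (‖y.fn‖ * ‖r.fn‖) := by
        gcongr
        rw [hq]
        linarith
      _ = _ := by simp only [C₀]; ring

/-! ### Frequency truncation and the Laplacian -/

theorem inner_L2_fourier (f g : L2) :
    inner ℂ f g = ∫ ξ, conj ((𝓕 f : L2) ξ) * (𝓕 g : L2) ξ := by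
  rw [← Lp.inner_fourier_eq, inner_L2_def]

theorem inner_dyadicL_fn (k : ℕ) (f g : L2) :
    inner ℂ (dyadicL k f).fn g = inner ℂ f (dyadicL k g).fn := by
  rw [inner_L2_fourier, inner_L2_fourier]
  refine integral_congr_ae ?_
  filter_upwards [fourier_dyadicL k f, fourier_dyadicL k g] with ξ h1 h2
  rw [h1, h2]
  rcases le_or_gt ‖ξ‖ (2 ^ k) with h | h
  · rw [cutSymbol_of_le h]; simp
  · rw [cutSymbol_of_lt h]; simp

theorem dyadicL_dyadicL (k : ℕ) (f : L2) : dyadicL k (dyadicL k f).fn = dyadicL k f := by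
  refine H1.ext_fn (fourier_injective ?_)
  filter_upwards [fourier_dyadicL k f, fourier_dyadicL k (dyadicL k f).fn] with ξ h1 h2
  rw [h2, h1]
  rcases le_or_gt ‖ξ‖ (2 ^ k) with h | h
  · rw [cutSymbol_of_le h]; simp
  · rw [cutSymbol_of_lt h]; simp

theorem measurable_lapSymbol (n : ℝ) :
    Measurable fun ξ : Plane => ((4 * Real.pi ^ 2 * ‖ξ‖ ^ 2 : ℝ) : ℂ) * cutSymbol n ξ := by
  refine Measurable.mul ?_ (measurable_cutSymbol n)
  fun_prop

theorem norm_lapSymbol_le (n : ℝ) (ξ : Plane) :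
    ‖((4 * Real.pi ^ 2 * ‖ξ‖ ^ 2 : ℝ) : ℂ) * cutSymbol n ξ‖ ≤ 4 * Real.pi ^ 2 * n ^ 2 := by
  rcases le_or_gt ‖ξ‖ n with h | h
  · rw [cutSymbol_of_le h, mul_one, Complex.norm_real, Real.norm_of_nonneg (by positivity)]
    gcongr
  · rw [cutSymbol_of_lt h, mul_zero, norm_zero]
    positivity

/-- The frequency truncation of `-Δ`. -/
def lapL (k : ℕ) : L2 →L[ℂ] L2 :=
  multL _ (measurable_lapSymbol (2 ^ k)) (norm_lapSymbol_le (2 ^ k))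

theorem fourier_lapL (k : ℕ) (f : L2) : (𝓕 (lapL k f) : L2) =ᵐ[volume]
    fun ξ => ((4 * Real.pi ^ 2 * ‖ξ‖ ^ 2 : ℝ) : ℂ) * cutSymbol (2 ^ k) ξ * (𝓕 f : L2) ξ :=
  fourier_multL_ae _ _ _ f

/-- With a truncated test function the Laplacian term of the equation becomes an L² pairing with the
bounded operator `lapL`. -/
theorem inner_grad_dyadicL (k : ℕ) (g : L2) (w : H1) :
    inner ℂ (dyadicL k g).grad w.grad = inner ℂ g (lapL k w.fn) := by
  rw [PiLp.inner_apply, Fin.sum_univ_two, inner_L2_fourier, inner_L2_fourier, inner_L2_fourier,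
    ← integral_add (integrable_conj_mul _ _) (integrable_conj_mul _ _)]
  refine integral_congr_ae ?_
  filter_upwards [fourier_dyadicL k g, fourier_lapL k w.fn, H1.fourier_grad (dyadicL k g) 0,
    H1.fourier_grad (dyadicL k g) 1, H1.fourier_grad w 0, H1.fourier_grad w 1]
    with ξ h1 h2 h3 h4 h5 h6
  have hn : ((‖ξ‖ ^ 2 : ℝ) : ℂ) = (ξ 0 : ℂ) ^ 2 + (ξ 1 : ℂ) ^ 2 := by
    rw [EuclideanSpace.norm_sq_eq, Fin.sum_univ_two]
    simp
  have hI : conj (2 * (Real.pi : ℂ) * Complex.I) = -(2 * Real.pi * Complex.I) := by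
    simp only [map_mul, map_ofNat, Complex.conj_ofReal, Complex.conj_I]
    ring
  rw [h3, h4, h5, h6, h2, h1]
  simp only [Complex.ofReal_mul, hn]
  rcases le_or_gt ‖ξ‖ (2 ^ k) with h | h
  · rw [cutSymbol_of_le h]
    simp only [map_mul, hI, Complex.conj_ofReal, one_mul, mul_one]
    push_cast
    linear_combination (-4 * (Real.pi : ℂ) ^ 2 * ((ξ 0 : ℂ) ^ 2 + (ξ 1 : ℂ) ^ 2) *
      conj ((𝓕 g : L2) ξ) * (𝓕 w.fn : L2) ξ) * Complex.I_sq
  · rw [cutSymbol_of_lt h]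
    simp

theorem lapL_sub_dyadicL (k : ℕ) (u : H1) : lapL k (u - dyadicL k u.fn).fn = 0 := by
  refine fourier_injective ?_
  have h0 : (𝓕 (0 : L2) : L2) = 0 := (Lp.fourierTransformₗᵢ Plane ℂ).map_zero
  rw [h0]
  filter_upwards [fourier_lapL k (u - dyadicL k u.fn).fn, fourier_sub_dyadicL k u,
    Lp.coeFn_zero ℂ 2 (volume : Measure Plane)] with ξ h1 h2 h3
  rw [h1, h3]
  rcases le_or_gt ‖ξ‖ (2 ^ k) with h | h
  · rw [h2.2 h]; simp
  · rw [cutSymbol_of_lt h]; simp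

theorem lapL_dyadicL (k : ℕ) (u : H1) : lapL k (dyadicL k u.fn).fn = lapL k u.fn := by
  have h := lapL_sub_dyadicL k u
  rw [H1.fn_sub, map_sub, sub_eq_zero] at h
  exact h.symm

/-- The bound 4x/3 alone is not inductive. The correction x²/4^K is exactly the tail of the
geometric series still to come, and the maximum with 0 covers the indices with 4^K < x, where the
sum is empty. -/
theorem sum_low_frequency_le {x : ℝ} (hx : 0 ≤ x) (K : ℕ) :
    ∑ k ∈ Finset.range K, (if x ≤ 4 ^ k then x ^ 2 / 4 ^ k else 0) ≤
      4 / 3 * max 0 (x - x ^ 2 / 4 ^ K) := by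
  induction K with
  | zero => simp
  | succ K ih =>
    rw [Finset.sum_range_succ]
    have h4 : (0 : ℝ) < 4 ^ K := by positivity
    have e : x ^ 2 / 4 ^ (K + 1) = x ^ 2 / 4 ^ K / 4 := by
      rw [pow_succ 4 K, div_div]
    have hy : 0 ≤ x ^ 2 / 4 ^ K := by positivity
    split_ifs with h
    · have h1 : x ^ 2 / 4 ^ K ≤ x := by
        rw [div_le_iff₀ h4]; nlinarith
      rw [max_eq_right (by linarith)] at ih
      refine le_trans ?_ (mul_le_mul_of_nonneg_left (le_max_right _ _) (by norm_num))
      rw [e]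
      linarith
    · have h1 : x ≤ x ^ 2 / 4 ^ K := by
        rw [le_div_iff₀ h4]; nlinarith
      rw [max_eq_left (by linarith)] at ih
      refine le_trans ?_ (mul_le_mul_of_nonneg_left (le_max_left _ _) (by norm_num))
      linarith

/-- Both bounds are carried through the induction: the geometric one, 4^K/3, combined with 4^K < x
yields 4x/3 at the last index that contributes. -/
theorem sum_high_frequency_le {x : ℝ} (hx : 0 ≤ x) (K : ℕ) :
    ∑ k ∈ Finset.range K, (if x ≤ 4 ^ k then (0 : ℝ) else 4 ^ k) ≤
      min (4 ^ K / 3) (4 / 3 * x) := by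
  induction K with
  | zero => simp; positivity
  | succ K ih =>
    rw [Finset.sum_range_succ]
    have h4 : (0 : ℝ) < 4 ^ K := by positivity
    rw [le_min_iff] at ih ⊢
    rw [pow_succ]
    split_ifs with h
    · constructor <;> linarith
    · constructor <;> linarith

/-- The quantity measuring the part of `u` at frequencies of size about `2 ^ k`. -/
def dyadicSize (k : ℕ) (u : H1) : ℝ :=
  ‖lapL k u.fn‖ ^ 2 / 4 ^ k + 4 ^ k * ‖(u - dyadicL k u.fn).fn‖ ^ 2

theorem norm_le_two_pow_iff (k : ℕ) (ξ : Plane) : ‖ξ‖ ≤ 2 ^ k ↔ ‖ξ‖ ^ 2 ≤ 4 ^ k := by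
  have : (4 : ℝ) ^ k = (2 ^ k) ^ 2 := by rw [← pow_mul, mul_comm, pow_mul]; norm_num
  rw [this]
  exact (sq_le_sq₀ (norm_nonneg _) (by positivity)).symm

theorem dyadicSize_eq (k : ℕ) (u : H1) :
    (Integrable fun ξ : Plane => (16 * Real.pi ^ 4 *
      (if ‖ξ‖ ^ 2 ≤ 4 ^ k then (‖ξ‖ ^ 2) ^ 2 / 4 ^ k else 0) +
      (if ‖ξ‖ ^ 2 ≤ 4 ^ k then (0 : ℝ) else 4 ^ k)) * ‖(𝓕 u.fn : L2) ξ‖ ^ 2) ∧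
    dyadicSize k u = ∫ ξ : Plane, (16 * Real.pi ^ 4 *
      (if ‖ξ‖ ^ 2 ≤ 4 ^ k then (‖ξ‖ ^ 2) ^ 2 / 4 ^ k else 0) +
      (if ‖ξ‖ ^ 2 ≤ 4 ^ k then (0 : ℝ) else 4 ^ k)) * ‖(𝓕 u.fn : L2) ξ‖ ^ 2 := by
  have hae : (fun ξ : Plane => ‖(𝓕 (lapL k u.fn) : L2) ξ‖ ^ 2 / 4 ^ k +
      4 ^ k * ‖(𝓕 (u - dyadicL k u.fn).fn : L2) ξ‖ ^ 2) =ᵐ[volume] fun ξ : Plane =>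
      (16 * Real.pi ^ 4 * (if ‖ξ‖ ^ 2 ≤ 4 ^ k then (‖ξ‖ ^ 2) ^ 2 / 4 ^ k else 0) +
      (if ‖ξ‖ ^ 2 ≤ 4 ^ k then (0 : ℝ) else 4 ^ k)) * ‖(𝓕 u.fn : L2) ξ‖ ^ 2 := by
    filter_upwards [fourier_lapL k u.fn, fourier_sub_dyadicL k u] with ξ h1 h2
    rw [h1]
    rcases le_or_gt ‖ξ‖ (2 ^ k) with h | h
    · rw [h2.2 h, cutSymbol_of_le h, if_pos ((norm_le_two_pow_iff k ξ).1 h),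
        if_pos ((norm_le_two_pow_iff k ξ).1 h), norm_mul, mul_one, Complex.norm_real,
        Real.norm_of_nonneg (by positivity), norm_zero]
      ring
    · have h' : ¬ ‖ξ‖ ^ 2 ≤ 4 ^ k := fun h'' => not_le.2 h ((norm_le_two_pow_iff k ξ).2 h'')
      rw [h2.1 h, cutSymbol_of_lt h, if_neg h', if_neg h']
      simp
  have i1 := (integrable_norm_sq (𝓕 (lapL k u.fn) : L2)).div_const (4 ^ k)
  have i2 := (integrable_norm_sq (𝓕 (u - dyadicL k u.fn).fn : L2)).const_mul (4 ^ k)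
  refine ⟨(i1.add i2).congr hae, ?_⟩
  rw [← integral_congr_ae hae, integral_add i1 i2, integral_div, integral_const_mul, dyadicSize,
    H1.norm_fn_sq_fourier, H1.norm_fn_sq_fourier (u - _).fn]

theorem dyadicSize_nonneg (k : ℕ) (u : H1) : 0 ≤ dyadicSize k u := by
  unfold dyadicSize
  positivity

/-- For a fixed frequency both parts of `dyadicSize` form geometric series in k that peak at 2^k ≈
|ξ|, so their sum is comparable to |ξ|², uniformly in K. -/
theorem sum_dyadicSize_le (K : ℕ) (u : H1) :
    ∑ k ∈ Finset.range K, dyadicSize k u ≤ 8 * Real.pi ^ 2 * ‖u.grad‖ ^ 2 := by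
  have hpi3 := Real.pi_gt_three
  simp only [fun k => (dyadicSize_eq k u).2]
  rw [← integral_finsetSum _ fun k _ => (dyadicSize_eq k u).1, (H1.fourier_norm_grad_sq u).2,
    ← integral_const_mul]
  refine integral_mono (integrable_finsetSum _ fun k _ => (dyadicSize_eq k u).1)
    ((H1.fourier_norm_grad_sq u).1.const_mul _) fun ξ => ?_
  simp only
  rw [← Finset.sum_mul, ← mul_assoc]
  gcongr
  rw [Finset.sum_add_distrib, ← Finset.mul_sum]
  set x := ‖ξ‖ ^ 2
  have hx : 0 ≤ x := by positivity
  have h1 : ∑ k ∈ Finset.range K, (if x ≤ 4 ^ k then x ^ 2 / 4 ^ k else 0) ≤ 4 / 3 * x := by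
    refine (sum_low_frequency_le hx K).trans ?_
    gcongr
    refine max_le hx ?_
    have : 0 ≤ x ^ 2 / 4 ^ K := by positivity
    linarith
  have h2 := (sum_high_frequency_le hx K).trans (min_le_right _ _)
  calc _ ≤ 16 * Real.pi ^ 4 * (4 / 3 * x) + 4 / 3 * x := by gcongr
    _ ≤ 8 * Real.pi ^ 2 * (4 * Real.pi ^ 2 * x) := by
      have h3 : 1 ≤ Real.pi ^ 4 := one_le_pow₀ (by linarith)
      nlinarith [mul_nonneg hx (sub_nonneg.2 h3)]

theorem continuous_dyadicSize (k : ℕ) : Continuous (dyadicSize k) := by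
  have h1 : Continuous fun u : H1 => lapL k u.fn := (lapL k).continuous.comp H1.fnL.continuous
  have h2 : Continuous fun u : H1 => (u - dyadicL k u.fn).fn :=
    H1.fnL.continuous.comp
      (continuous_id.sub ((dyadicL k).continuous.comp H1.fnL.continuous))
  unfold dyadicSize
  fun_prop

theorem tendsto_dyadicL (u : H1) : Tendsto (fun k => dyadicL k u.fn) atTop (𝓝 u) := by
  rw [tendsto_iff_norm_sub_tendsto_zero]
  have hsq : Tendsto (fun k => ‖u - dyadicL k u.fn‖ ^ 2) atTop (𝓝 0) := by
    have hform : ∀ k, ‖u - dyadicL k u.fn‖ ^ 2 =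
        ∫ ξ : Plane, (1 + 4 * Real.pi ^ 2 * ‖ξ‖ ^ 2) *
          ‖(𝓕 (u - dyadicL k u.fn).fn : L2) ξ‖ ^ 2 := fun k => by
      rw [H1.norm_sq, H1.norm_fn_sq_fourier, (H1.fourier_norm_grad_sq _).2,
        ← integral_add (integrable_norm_sq _) (H1.fourier_norm_grad_sq _).1]
      simp only [add_mul, one_mul]
    simp only [hform]
    rw [← integral_zero Plane ℝ]
    refine tendsto_integral_of_dominated_convergence
      (fun ξ : Plane => ‖(𝓕 u.fn : L2) ξ‖ ^ 2 +
        (4 * Real.pi ^ 2 * ‖ξ‖ ^ 2) * ‖(𝓕 u.fn : L2) ξ‖ ^ 2) (fun k => ?_)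
      ((integrable_norm_sq _).add (H1.fourier_norm_grad_sq u).1) (fun k => ?_) ?_
    · refine AEStronglyMeasurable.mul (by fun_prop) ?_
      exact (Lp.aestronglyMeasurable _).norm.pow 2
    · filter_upwards [norm_fourier_sub_dyadicL_le k u] with ξ h
      rw [Real.norm_of_nonneg (by positivity), add_mul, one_mul]
      gcongr
    · have := ae_all_iff.2 fun k => fourier_sub_dyadicL k u
      filter_upwards [this] with ξ h
      obtain ⟨k₀, hk₀⟩ := pow_unbounded_of_one_lt ‖ξ‖ (one_lt_two)
      refine tendsto_const_nhds.congr' ?_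
      filter_upwards [eventually_ge_atTop k₀] with k hk
      rw [(h k).2 (hk₀.le.trans (pow_le_pow_right₀ one_le_two hk))]
      simp
  have := hsq.sqrt
  simp only [Real.sqrt_sq (norm_nonneg _), Real.sqrt_zero] at this
  simpa only [norm_sub_rev] using this

/-! ### The equation -/

/-- The pairing `∫ L(|u|²) u (conj φ)` of the nonlinearity with `φ`. -/
def nonlin (ν γ : ℝ) (φ u : H1) : ℂ := inner ℂ (φ.mulConj u) (opLL ν γ (u.mulConj u))

/-- The energy. -/
def energy (ν γ : ℝ) (v : H1) : ℝ := ‖v.grad‖ ^ 2 / 2 - quartic ν γ v / 4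

/-- `du` is the time derivative in `H⁻¹` of the solution `u` on the open interval `(0, T)`. -/
def IsWeakDerivative (ν γ T : ℝ) (u : ℝ → H1) (du : ℝ → Hneg1) : Prop :=
  ∀ t ∈ Set.Ioo 0 T, HasDerivAt (fun s => toHneg1 (u s).fn) (du t) t ∧
    ∀ φ : H1, Complex.I * du t φ = inner ℂ φ.grad (u t).grad - nonlin ν γ φ (u t)

theorem toHneg1_apply (f : L2) (φ : H1) : toHneg1 f φ = inner ℂ φ.fn f := rfl

theorem IsSolution.exists_weakDerivative {ν γ T : ℝ} {u : ℝ → H1} (h : IsSolution ν γ T u) :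
    ∃ du, IsWeakDerivative ν γ T u du := by
  obtain ⟨-, du, -, hdu⟩ := h
  refine ⟨du, fun t ht => ?_⟩
  obtain ⟨h1, h2⟩ := hdu t ⟨ht.1.le, ht.2⟩
  refine ⟨h1.hasDerivAt (Ico_mem_nhds ht.1 ht.2), fun φ => ?_⟩
  have h3 := h2 φ
  rw [integral_nonlinearity_eq] at h3
  rw [PiLp.inner_apply, nonlin]
  linear_combination h3

theorem nonlin_self_im (ν γ : ℝ) (u : H1) : (nonlin ν γ u u).im = 0 := by
  have h := inner_mulConj_swap ν γ u u u
  exact Complex.conj_eq_iff_im.1 h.symm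

theorem tendsto_Hneg1_apply {ι : Type*} {l : Filter ι} {G : ι → Hneg1} {F : Hneg1} {φ : ι → H1}
    {ψ : H1} (hG : Tendsto G l (𝓝 F)) (hφ : Tendsto φ l (𝓝 ψ)) :
    Tendsto (fun i => G i (φ i)) l (𝓝 (F ψ)) := by
  have h1 : Tendsto (fun i => ‖G i - F‖ * ‖φ i‖) l (𝓝 0) := by
    simpa using (tendsto_iff_norm_sub_tendsto_zero.1 hG).mul hφ.norm
  have h2 : Tendsto (fun i => (G i - F) (φ i)) l (𝓝 0) :=
    squeeze_zero_norm (fun i => (G i - F).le_opNorm _) h1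
  have h3 := h2.add ((F.continuous.tendsto ψ).comp hφ)
  rw [zero_add] at h3
  exact h3.congr fun i => sub_add_cancel (G i (φ i)) (F (φ i))

namespace IsWeakDerivative

variable {ν γ T : ℝ} {u : ℝ → H1} {du : ℝ → Hneg1}

theorem hasDerivAt_inner (h : IsWeakDerivative ν γ T u du) {t : ℝ} (ht : t ∈ Set.Ioo 0 T)
    (φ : H1) : HasDerivAt (fun s => inner ℂ φ.fn (u s).fn) (du t φ) t := by
  have h1 := (h t ht).1
  rw [hasDerivAt_iff_tendsto_slope] at h1 ⊢
  exact tendsto_Hneg1_apply h1 tendsto_const_nhds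

/-- Although u is not known to be differentiable in L², ‖u(s)‖² − ‖u(t)‖² = Re⟨u(s)+u(t),
u(s)−u(t)⟩. So the difference quotient is that of u in H⁻¹ tested on u(s)+u(t), which converges in
H¹. -/
theorem hasDerivAt_norm_sq (h : IsWeakDerivative ν γ T u du)
    (hc : ContinuousOn u (Set.Ico 0 T)) {t : ℝ} (ht : t ∈ Set.Ioo 0 T) :
    HasDerivAt (fun s => ‖(u s).fn‖ ^ 2) 0 t := by
  have h1 := (h t ht).1
  have hct : ContinuousAt u t := hc.continuousAt (Ico_mem_nhds ht.1 ht.2)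
  rw [hasDerivAt_iff_tendsto_slope] at h1 ⊢
  have h2 : Tendsto (fun s => ((slope (fun s => toHneg1 (u s).fn) t s) (u s + u t)).re)
      (𝓝[≠] t) (𝓝 (du t (u t + u t)).re) := by
    refine (Complex.continuous_re.tendsto _).comp ?_
    exact tendsto_Hneg1_apply h1 <| (hct.tendsto.mono_left nhdsWithin_le_nhds).add tendsto_const_nhds
  -- Tested with u itself, the right-hand side of the equation is real, so the pairing of u_t with u
  -- is purely imaginary.
  have h3 : (du t (u t + u t)).re = 0 := by
    have h4 := (h t ht).2 (u t)
    rw [map_add]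
    have h5 : (Complex.I * du t (u t)).im = 0 := by
      rw [h4, Complex.sub_im, nonlin_self_im, sub_zero]
      exact inner_self_im (𝕜 := ℂ) (u t).grad
    rw [Complex.I_mul_im] at h5
    simp [h5]
  rw [h3] at h2
  refine h2.congr fun s => ?_
  simp only [slope, vsub_eq_sub, smul_apply, sub_apply,
    toHneg1_apply, smul_eq_mul, Complex.smul_re]
  congr 1
  rw [← inner_sub_right, H1.fn_add, inner_add_left, inner_sub_right, inner_sub_right]
  rw [← inner_conj_symm (u t).fn (u s).fn]
  simp only [Complex.add_re, Complex.sub_re, Complex.conj_re, inner_self_eq_norm_sq_to_K]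
  norm_cast
  simp only [Complex.coe_algebraMap, Complex.ofReal_re]
  ring

theorem norm_fn_eq (h : IsWeakDerivative ν γ T u du)
    (hc : ContinuousOn u (Set.Ico 0 T)) {s t : ℝ} (hs : s ∈ Set.Ioo 0 T) (ht : t ∈ Set.Ioo 0 T) :
    ‖(u s).fn‖ = ‖(u t).fn‖ := by
  have hd : ∀ τ ∈ Set.Ioo 0 T, HasDerivAt (fun s => ‖(u s).fn‖ ^ 2) 0 τ :=
    fun τ hτ => h.hasDerivAt_norm_sq hc hτ
  have := (convex_Ioo (0 : ℝ) T).norm_image_sub_le_of_norm_hasDerivWithin_le (C := 0)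
    (fun τ hτ => (hd τ hτ).hasDerivWithinAt) (by simp) ht hs
  rw [zero_mul, norm_le_zero_iff, sub_eq_zero] at this
  exact (sq_eq_sq₀ (norm_nonneg _) (norm_nonneg _)).1 this

end IsWeakDerivative

/-! ### The energy of the truncated solution -/

/-- The truncation maps L² boundedly into H¹, so by duality it extends to a bounded map from H⁻¹ to
L²; `R` is this extension. -/
theorem exists_riesz (k : ℕ) : ∃ R : Hneg1 →L[ℝ] L2, ∀ (F : Hneg1) (f : L2),
    inner ℂ f (R F) = F (dyadicL k f) := by
  set J : Hneg1 → L2 := fun F => (InnerProductSpace.toDual ℂ L2).symm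
    (((starL ℂ : ℂ ≃L⋆[ℂ] ℂ) : ℂ →L⋆[ℂ] ℂ).comp (F.comp (dyadicL k))) with hJ
  have hJ1 : ∀ F f, inner ℂ f (J F) = F (dyadicL k f) := fun F f => by
    rw [← inner_conj_symm, hJ, InnerProductSpace.toDual_symm_apply]
    simp
  have hJu : ∀ {g g' : L2}, (∀ f : L2, inner ℂ f g = inner ℂ f g') → g = g' :=
    fun hh => ext_inner_left ℂ hh
  refine ⟨LinearMap.mkContinuous
    { toFun := J
      map_add' := fun F G => hJu fun f => by
        rw [inner_add_right, hJ1, hJ1, hJ1]; rfl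
      map_smul' := fun c F => hJu fun f => by
        have : inner ℂ f ((c : ℂ) • J F) = c * F (dyadicL k f) := by
          rw [inner_smul_right, hJ1]
        rw [hJ1]
        exact this.symm } ‖dyadicL k‖ fun F => ?_, fun F f => hJ1 F f⟩
  have h1 : ‖J F‖ ^ 2 ≤ ‖F‖ * (‖dyadicL k‖ * ‖J F‖) := by
    have := hJ1 F (J F)
    rw [inner_self_eq_norm_sq_to_K] at this
    have h2 : ‖J F‖ ^ 2 = ‖F (dyadicL k (J F))‖ := by
      rw [← this]
      simp
    rw [h2]
    refine (F.le_opNorm _).trans ?_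
    gcongr
    exact (dyadicL k).le_opNorm _
  change ‖J F‖ ≤ _
  rcases (norm_nonneg (J F)).eq_or_lt with h0 | h0
  · rw [← h0]; positivity
  · nlinarith

/-- Here `g` is the truncation of the H⁻¹ derivative. Extended to H⁻¹ the truncation gives a
derivative in L², and applying it once more upgrades that to H¹. The last identity evaluates the
equation at the otherwise inadmissible test function u_t, truncated. -/
theorem hasDerivAt_dyadicL {f : ℝ → L2} {F : Hneg1} {t : ℝ} (k : ℕ)
    (h : HasDerivAt (fun s => toHneg1 (f s)) F t) :
    ∃ g : L2, HasDerivAt (fun s => dyadicL k (f s)) (dyadicL k g) t ∧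
      F (dyadicL k g) = ((‖g‖ ^ 2 : ℝ) : ℂ) := by
  obtain ⟨R, hR⟩ := exists_riesz k
  refine ⟨R F, ?_, ?_⟩
  · have h1 : HasDerivAt (fun s => R (toHneg1 (f s))) (R F) t := R.hasFDerivAt.comp_hasDerivAt t h
    have h2 : ∀ s, R (toHneg1 (f s)) = (dyadicL k (f s)).fn := fun s =>
      ext_inner_left ℂ fun v => by
        rw [hR, toHneg1_apply, inner_dyadicL_fn]
    simp only [h2] at h1
    have h3 : HasDerivAt (fun s => dyadicL k (dyadicL k (f s)).fn) (dyadicL k (R F)) t :=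
      ((dyadicL k).restrictScalars ℝ).hasFDerivAt.comp_hasDerivAt t h1
    simpa only [dyadicL_dyadicL] using h3
  · rw [← hR, inner_self_eq_norm_sq_to_K]
    simp

/-- Symmetry of L makes the derivatives of its two arguments agree, and inside each the two factors
of |a|² contribute conjugate terms; together these give the factor 4. -/
theorem hasDerivAt_quartic (ν γ : ℝ) {a : ℝ → H1} {a' : H1} {t : ℝ} (h : HasDerivAt a a' t) :
    HasDerivAt (fun s => quartic ν γ (a s)) (4 * (nonlin ν γ a' (a t)).re) t := by
  have h1 : HasDerivAt (fun s => (a s).mulConj (a s)) (a'.mulConj (a t) + (a t).mulConj a') t := by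
    have := (H1.isBoundedBilinearMap_mulConj.hasFDerivAt (a t, a t)).comp_hasDerivAt t
      (h.prodMk h)
    rw [add_comm]
    exact this
  have h2 : HasDerivAt (fun s => opLL ν γ ((a s).mulConj (a s)))
      (opLL ν γ (a'.mulConj (a t) + (a t).mulConj a')) t :=
    ((opLL ν γ).restrictScalars ℝ).hasFDerivAt.comp_hasDerivAt t h1
  have h3 := h1.inner ℂ h2
  have h4 := Complex.reCLM.hasFDerivAt.comp_hasDerivAt t h3
  simp only [quartic_eq]
  refine HasDerivAt.congr_deriv h4 ?_
  rw [Complex.reCLM_apply, ← inner_opLL_left, ← inner_conj_symm, inner_add_left,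
    inner_mulConj_swap ν γ _ (a t) a', nonlin]
  simp only [Complex.add_re, Complex.conj_re]
  ring

theorem hasDerivAt_energy (ν γ : ℝ) {a : ℝ → H1} {a' : H1} {t : ℝ} (h : HasDerivAt a a' t) :
    HasDerivAt (fun s => energy ν γ (a s))
      (inner ℂ a'.grad (a t).grad - nonlin ν γ a' (a t)).re t := by
  have h1 : HasDerivAt (fun s => (a s).grad) a'.grad t :=
    (H1.gradL.restrictScalars ℝ).hasFDerivAt.comp_hasDerivAt t h
  have h2 := Complex.reCLM.hasFDerivAt.comp_hasDerivAt t (h1.inner ℂ h1)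
  have h3 : HasDerivAt (fun s => ‖(a s).grad‖ ^ 2) (2 * (inner ℂ a'.grad (a t).grad).re) t := by
    have h4 : (fun s => ‖(a s).grad‖ ^ 2) =
        Complex.reCLM ∘ fun s => inner ℂ (a s).grad (a s).grad := by
      ext s
      simp only [Function.comp_apply, Complex.reCLM_apply, inner_self_eq_norm_sq_to_K]
      simp only [Complex.coe_algebraMap, ← Complex.ofReal_pow, Complex.ofReal_re]
    rw [h4]
    refine HasDerivAt.congr_deriv h2 ?_
    · rw [Complex.reCLM_apply, ← inner_conj_symm]
      simp only [Complex.add_re, Complex.conj_re]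
      ring
  refine ((h3.div_const 2).sub ((hasDerivAt_quartic ν γ h).div_const 4)).congr_deriv ?_
  rw [Complex.sub_re]
  ring

/-! ### Conservation of the energy -/

/-- Testing the equation with a' = P_k u_t gives i‖g‖² = ⟨g, −ΔP_k u⟩ − N. The real part vanishes,
so the energy of a = P_k u changes only by Re(N − N'), where N and N' pair a' with the
nonlinearities of u and of a. -/
theorem exists_energy_deriv_bound (ν γ : ℝ) : ∃ C : ℝ, 0 ≤ C ∧
    ∀ (T : ℝ) (u : ℝ → H1) (du : ℝ → Hneg1), IsWeakDerivative ν γ T u du →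
    ∀ (k : ℕ), 1 ≤ k → ∀ (M : ℝ), 0 < M → ∀ t ∈ Set.Ioo 0 T, ‖u t‖ ≤ M →
    ∃ e : ℝ, HasDerivAt (fun s => energy ν γ (dyadicL k (u s).fn)) e t ∧
      |e| ≤ C * M ^ 2 * k * dyadicSize k (u t) + C * M ^ 6 * k ^ 2 / 2 ^ k := by
  obtain ⟨C, hC, hCb⟩ := exists_truncation_bound ν γ
  refine ⟨C + 2 * C ^ 2, by positivity, fun T u du h k hk M hM t ht hut => ?_⟩
  obtain ⟨g, hg, hgn⟩ := hasDerivAt_dyadicL k (h t ht).1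
  obtain ⟨hB1, hB2⟩ := hCb k hk (u t) M hM hut
  set a := dyadicL k (u t).fn with ha
  set a' := dyadicL k g with ha'
  set r := u t - a with hr
  have hB1 := hB1 a'
  have hB2 := hB2 a' (by
    filter_upwards [fourier_dyadicL k g] with ξ h1 h2
    rw [h1, cutSymbol_of_lt h2, zero_mul])
  have heq := (h t ht).2 a'
  rw [hgn, inner_grad_dyadicL] at heq
  have hgrad : inner ℂ a'.grad a.grad = inner ℂ g (lapL k (u t).fn) := by
    rw [inner_grad_dyadicL, lapL_dyadicL]
  refine ⟨_, hasDerivAt_energy ν γ hg, ?_⟩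
  have ha'n : ‖a'.fn‖ ≤ ‖g‖ := by
    rw [← Lp.norm_fourier_eq, ← Lp.norm_fourier_eq g]
    exact Lp.norm_le_norm_of_ae_le (norm_fourier_dyadicL_le k g)
  have hrn : 2 ^ k * ‖r.fn‖ ≤ M :=
    (norm_sub_dyadicL_le k (u t)).trans ((H1.norm_grad_le _).trans hut)
  set N := nonlin ν γ a' (u t) with hN
  set N' := nonlin ν γ a' a with hN'
  have hB1' : ‖N'‖ ≤ C * M ^ 3 * k * ‖g‖ := hB1.trans (by gcongr)
  have hB2' : ‖N - N'‖ ≤ C * M ^ 2 * k * ‖g‖ * ‖r.fn‖ := hB2.trans (by gcongr)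
  have h2k : (1 : ℝ) ≤ 2 ^ k := one_le_pow₀ one_le_two
  have hrM : ‖r.fn‖ ≤ M := le_trans (le_mul_of_one_le_left (norm_nonneg _) h2k) hrn
  set z := lapL k (u t).fn with hz
  -- The same identity, now taken in absolute value, bounds ‖g‖² by ‖g‖ times the right-hand side;
  -- one factor ‖g‖ is divided out.
  have hgb : ‖g‖ ≤ ‖z‖ + 2 * C * M ^ 3 * k := by
    have h1 : ‖g‖ ^ 2 = ‖inner ℂ g z - N‖ := by
      rw [← heq, norm_mul, Complex.norm_I, one_mul, Complex.norm_real, Real.norm_of_nonneg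
        (by positivity)]
    have h2 : ‖g‖ ^ 2 ≤ ‖g‖ * (‖z‖ + 2 * C * M ^ 3 * k) := by
      have h3 : ‖N‖ ≤ ‖N'‖ + ‖N - N'‖ := by
        have := norm_add_le N' (N - N')
        rwa [add_sub_cancel] at this
      have h4 : C * M ^ 2 * k * ‖g‖ * ‖r.fn‖ ≤ C * M ^ 2 * k * ‖g‖ * M := by gcongr
      have h5 := norm_inner_le_norm (𝕜 := ℂ) g z
      have h6 := norm_sub_le (inner ℂ g z) N
      rw [h1]
      nlinarith
    rcases (norm_nonneg g).eq_or_lt with h0 | h0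
    · rw [← h0]; positivity
    · nlinarith
  have hre : (inner ℂ a'.grad a.grad - N').re = (N - N').re := by
    have h1 : (inner ℂ g z - N).re = 0 := by
      rw [← heq]
      simp only [Complex.mul_re, Complex.I_re, Complex.I_im, Complex.ofReal_im]
      ring
    rw [hgrad, Complex.sub_re, Complex.sub_re]
    rw [Complex.sub_re] at h1
    linarith
  rw [hre]
  refine (Complex.abs_re_le_norm _).trans (hB2'.trans ?_)
  -- The low-frequency factor is scaled by 2^(−k) and the high-frequency one by 2^k; the squares of
  -- the two are the terms of `dyadicSize`.
  have hsz : ‖z‖ * ‖r.fn‖ ≤ dyadicSize k (u t) := by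
    have h4 : (4 : ℝ) ^ k = (2 ^ k) ^ 2 := by rw [← pow_mul, mul_comm, pow_mul]; norm_num
    rw [dyadicSize, h4]
    have h1 : ‖z‖ ^ 2 / (2 ^ k) ^ 2 = (‖z‖ / 2 ^ k) ^ 2 := by rw [div_pow]
    have h2 : ‖z‖ * ‖r.fn‖ = (‖z‖ / 2 ^ k) * (2 ^ k * ‖r.fn‖) := by
      field_simp
    rw [h1, h2, ← mul_pow]
    nlinarith [sq_nonneg (‖z‖ / 2 ^ k - 2 ^ k * ‖r.fn‖), sq_nonneg (‖z‖ / 2 ^ k),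
      sq_nonneg (2 ^ k * ‖r.fn‖)]
  have hrn' : ‖r.fn‖ ≤ M / 2 ^ k := by
    rw [le_div_iff₀ (by positivity)]
    linarith
  calc C * M ^ 2 * k * ‖g‖ * ‖r.fn‖
      ≤ C * M ^ 2 * k * (‖z‖ + 2 * C * M ^ 3 * k) * ‖r.fn‖ := by gcongr
    _ = C * M ^ 2 * k * (‖z‖ * ‖r.fn‖) + 2 * C ^ 2 * M ^ 5 * k ^ 2 * ‖r.fn‖ := by ring
    _ ≤ C * M ^ 2 * k * dyadicSize k (u t) + 2 * C ^ 2 * M ^ 5 * k ^ 2 * (M / 2 ^ k) := by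
      gcongr
    _ = C * M ^ 2 * k * dyadicSize k (u t) + 2 * C ^ 2 * M ^ 6 * k ^ 2 / 2 ^ k := by ring
    _ ≤ _ := by
      have := dyadicSize_nonneg k (u t)
      gcongr
      · nlinarith [sq_nonneg C]
      · linarith

/-- Otherwise b k ≥ ε/k eventually, against divergence of the harmonic series. This recovers the
factor k lost in the nonlinear estimate. -/
theorem frequently_mul_lt_of_sum_bounded {b : ℕ → ℝ} {B : ℝ} (hb : ∀ k, 0 ≤ b k)
    (hB : ∀ K, ∑ k ∈ Finset.range K, b k ≤ B) {ε : ℝ} (hε : 0 < ε) :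
    ∃ᶠ k : ℕ in atTop, k * b k < ε := by
  intro h
  have hs : Summable b := summable_of_sum_range_le hb hB
  have h1 : Summable fun k : ℕ => ((k : ℝ))⁻¹ := by
    refine Summable.of_norm_bounded_eventually_nat (g := fun k => ε⁻¹ * b k) (hs.mul_left _) ?_
    filter_upwards [h, eventually_gt_atTop 0] with k hk hk0
    have hk0' : (0 : ℝ) < k := by exact_mod_cast hk0
    rw [Real.norm_of_nonneg (by positivity), inv_mul_eq_div, le_div_iff₀ hε, inv_mul_le_iff₀ hk0']
    exact not_lt.1 hk
  exact Real.not_summable_natCast_inv h1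

theorem continuous_quartic (ν γ : ℝ) : Continuous (quartic ν γ) := by
  have h1 : Continuous fun v : H1 => v.mulConj v :=
    H1.isBoundedBilinearMap_mulConj.continuous.comp (continuous_id.prodMk continuous_id)
  have h2 : quartic ν γ = fun v => (inner ℂ (v.mulConj v) (opLL ν γ (v.mulConj v))).re := by
    ext v
    exact quartic_eq ν γ v
  rw [h2]
  exact Complex.continuous_re.comp (h1.inner ((opLL ν γ).continuous.comp h1))

theorem continuous_energy (ν γ : ℝ) : Continuous (energy ν γ) := by
  have h1 : Continuous fun v : H1 => v.grad := H1.gradL.continuous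
  have h2 := continuous_quartic ν γ
  unfold energy
  fun_prop

/-- Integrated in time, the energy of the truncation changes by at most a multiple of k b_k plus a
multiple of k²2^(−k). The b_k have bounded partial sums, so both are small for arbitrarily large k,
while the truncations converge to u in H¹. -/
theorem IsWeakDerivative.energy_eq {ν γ T : ℝ} {u : ℝ → H1} {du : ℝ → Hneg1}
    (h : IsWeakDerivative ν γ T u du) (hc : ContinuousOn u (Set.Ico 0 T)) {s t : ℝ}
    (hs : s ∈ Set.Ioo 0 T) (ht : t ∈ Set.Ioo 0 T) : energy ν γ (u s) = energy ν γ (u t) := by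
  wlog hst : s ≤ t generalizing s t
  · exact (this ht hs (le_of_not_ge hst)).symm
  obtain ⟨C, hC, hCb⟩ := exists_energy_deriv_bound ν γ
  have hsub : Set.Icc s t ⊆ Set.Ioo 0 T := fun τ hτ => ⟨hs.1.trans_le hτ.1, hτ.2.trans_lt ht.2⟩
  have hcI : ContinuousOn u (Set.Icc s t) :=
    hc.mono fun τ hτ => ⟨(hsub hτ).1.le, (hsub hτ).2⟩
  obtain ⟨M₀, hM₀⟩ := isCompact_Icc.exists_bound_of_continuousOn hcI
  set M := max M₀ 1 with hMdef
  have hM : 0 < M := lt_max_of_lt_right one_pos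
  have huM : ∀ τ ∈ Set.Icc s t, ‖u τ‖ ≤ M := fun τ hτ => (hM₀ τ hτ).trans (le_max_left _ _)
  have hsz : ∀ k, ContinuousOn (fun τ => dyadicSize k (u τ)) (Set.Icc s t) := fun k =>
    (continuous_dyadicSize k).comp_continuousOn hcI
  have hszi : ∀ k, IntervalIntegrable (fun τ => dyadicSize k (u τ)) volume s t := fun k =>
    (by rw [← Set.uIcc_of_le hst] at hsz; exact (hsz k).intervalIntegrable)
  set b : ℕ → ℝ := fun k => ∫ τ in s..t, dyadicSize k (u τ) with hb
  have hb0 : ∀ k, 0 ≤ b k := fun k =>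
    intervalIntegral.integral_nonneg hst fun τ _ => dyadicSize_nonneg k _
  have hbB : ∀ K, ∑ k ∈ Finset.range K, b k ≤ (t - s) * (8 * Real.pi ^ 2 * M ^ 2) := fun K => by
    rw [← intervalIntegral.integral_finsetSum fun k _ => hszi k, ← smul_eq_mul,
      ← intervalIntegral.integral_const]
    refine intervalIntegral.integral_mono_on hst
      (by
        have := IntervalIntegrable.sum (Finset.range K) fun k _ => hszi k
        rwa [Finset.sum_fn] at this)
      intervalIntegrable_const fun τ hτ => ?_
    refine (sum_dyadicSize_le K (u τ)).trans ?_
    gcongr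
    exact (H1.norm_grad_le _).trans (huM τ hτ)
  have hk : ∀ k, 1 ≤ k → |energy ν γ (dyadicL k (u t).fn) - energy ν γ (dyadicL k (u s).fn)| ≤
      C * M ^ 2 * (k * b k) + (t - s) * (C * M ^ 6 * (k ^ 2 / 2 ^ k)) := fun k hk1 => by
    have hd : ∀ τ ∈ Set.Icc s t, ∃ e : ℝ,
        HasDerivAt (fun s => energy ν γ (dyadicL k (u s).fn)) e τ ∧
        |e| ≤ C * M ^ 2 * k * dyadicSize k (u τ) + C * M ^ 6 * k ^ 2 / 2 ^ k := fun τ hτ =>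
      hCb T u du h k hk1 M hM τ (hsub hτ) (huM τ hτ)
    have h1 := norm_sub_le_integral_of_norm_deriv_le_of_le hst
      (f := fun s => energy ν γ (dyadicL k (u s).fn))
      (B := fun τ => C * M ^ 2 * k * dyadicSize k (u τ) + C * M ^ 6 * k ^ 2 / 2 ^ k)
      (fun τ hτ => (hd τ hτ).choose_spec.1.continuousAt.continuousWithinAt)
      (fun τ hτ => (hd τ (Set.Ioo_subset_Icc_self hτ)).choose_spec.1.differentiableAt.differentiableWithinAt)
      (Eventually.of_forall fun τ hτ => by
        rw [(hd τ (Set.Ioo_subset_Icc_self hτ)).choose_spec.1.deriv]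
        exact (hd τ (Set.Ioo_subset_Icc_self hτ)).choose_spec.2)
      (((hszi k).const_mul _).add intervalIntegrable_const)
    rw [Real.norm_eq_abs, intervalIntegral.integral_add ((hszi k).const_mul _)
      intervalIntegrable_const, intervalIntegral.integral_const_mul,
      intervalIntegral.integral_const, smul_eq_mul] at h1
    refine h1.trans (le_of_eq ?_)
    simp only [hb]
    ring
  have hlim : Tendsto (fun k : ℕ => |energy ν γ (dyadicL k (u t).fn) -
      energy ν γ (dyadicL k (u s).fn)|) atTop (𝓝 |energy ν γ (u t) - energy ν γ (u s)|) :=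
    ((((continuous_energy ν γ).tendsto _).comp (tendsto_dyadicL (u t))).sub
      (((continuous_energy ν γ).tendsto _).comp (tendsto_dyadicL (u s)))).abs
  have hlim2 : Tendsto (fun k : ℕ => (t - s) * (C * M ^ 6 * ((k : ℝ) ^ 2 / 2 ^ k))) atTop
      (𝓝 0) := by
    have := tendsto_pow_const_div_const_pow_of_one_lt 2 (one_lt_two (α := ℝ))
    simpa using (this.const_mul (C * M ^ 6)).const_mul (t - s)
  have hfin : |energy ν γ (u t) - energy ν γ (u s)| ≤ 0 := by
    refine le_of_forall_pos_lt_add fun ε hε => ?_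
    have hf := frequently_mul_lt_of_sum_bounded hb0 hbB
      (show 0 < ε / 4 / (C * M ^ 2 + 1) by positivity)
    have he1 := hlim2.eventually_lt_const (show 0 < ε / 4 by positivity)
    have he2 := hlim.eventually_const_lt
      (show |energy ν γ (u t) - energy ν γ (u s)| - ε / 4 < _ by linarith)
    obtain ⟨k, hk1, hk2, hk3, hk4⟩ :=
      (hf.and_eventually (he1.and (he2.and (eventually_ge_atTop 1)))).exists
    have h5 := hk k hk4
    have h6 : C * M ^ 2 * (k * b k) ≤ ε / 4 := by
      rw [lt_div_iff₀ (by positivity)] at hk1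
      have : 0 ≤ k * b k := mul_nonneg (Nat.cast_nonneg _) (hb0 k)
      nlinarith
    linarith
  have := abs_nonpos_iff.1 hfin
  linarith

/-! ### The rate of blow-up -/

/-- The factors 2 in the bounds on φ are there because the test function will be the difference of
two values of the solution. -/
theorem norm_nonlin_le_of_bounds (ν γ : ℝ) {φ u : H1} {m M : ℝ} (hm : 0 ≤ m) (hM : 0 ≤ M)
    (hu : ‖u.fn‖ ≤ m) (hgu : ‖u.grad‖ ≤ M) (hφ : ‖φ.fn‖ ≤ 2 * m) (hgφ : ‖φ.grad‖ ≤ 2 * M) :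
    ‖nonlin ν γ φ u‖ ≤ 2 * (|ν| + |γ|) * ladyK ^ 2 * m ^ 2 * M ^ 2 := by
  have hK := ladyK_nonneg
  have h1 : ‖φ.mulConj u‖ ≤ 2 * ladyK * m * M := by
    refine abs_le_of_sq_le_sq' ((H1.norm_mulConj_sq_le' φ u).trans ?_) (by positivity) |>.2
    calc ladyK ^ 2 * (‖φ.fn‖ * ‖φ.grad‖) * (‖u.fn‖ * ‖u.grad‖)
        ≤ ladyK ^ 2 * ((2 * m) * (2 * M)) * (m * M) := by gcongr
      _ = _ := by ring
  have h2 : ‖u.mulConj u‖ ≤ ladyK * (m * M) :=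
    (H1.norm_mulConj_self_le u).trans (by gcongr)
  refine (norm_inner_le_norm _ _).trans ?_
  calc ‖φ.mulConj u‖ * ‖opLL ν γ (u.mulConj u)‖
      ≤ (2 * ladyK * m * M) * ((|ν| + |γ|) * (ladyK * (m * M))) := by
        gcongr
        exact (norm_opLL_le _ _ _).trans (by gcongr)
    _ = _ := by ring

/-- The difference is linear in |u|² − |v|² = w ū + v w̄ with w = u − v, and the Ladyzhenskaya bound
makes its L² norm of order ‖w‖₂^{1/2}. The inequality is squared to avoid the root. -/
theorem abs_quartic_sub_le (ν γ : ℝ) {u v : H1} {m M : ℝ} (hm : 0 ≤ m) (hM : 0 ≤ M)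
    (hu : ‖u.fn‖ ≤ m) (hgu : ‖u.grad‖ ≤ M) (hv : ‖v.fn‖ ≤ m) (hgv : ‖v.grad‖ ≤ M) :
    (quartic ν γ u - quartic ν γ v) ^ 2 ≤
      32 * (|ν| + |γ|) ^ 2 * ladyK ^ 4 * m ^ 3 * M ^ 4 * ‖u.fn - v.fn‖ := by
  have hK := ladyK_nonneg
  set c := |ν| + |γ| with hc
  have hc0 : 0 ≤ c := by positivity
  set w := u - v with hw
  have hgw : ‖w.grad‖ ≤ 2 * M := by
    have := norm_sub_le u.grad v.grad
    rw [hw, H1.grad_sub]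
    linarith
  have hD : u.mulConj u - v.mulConj v = w.mulConj u + v.mulConj w := by
    rw [hw, H1.mulConj_sub_left, H1.mulConj_sub_right]
    abel
  set D := ‖u.mulConj u - v.mulConj v‖ with hDdef
  have h1 : ‖w.mulConj u‖ ^ 2 ≤ ladyK ^ 2 * (‖w.fn‖ * (2 * M)) * (m * M) :=
    (H1.norm_mulConj_sq_le' w u).trans (by gcongr)
  have h2 : ‖v.mulConj w‖ ^ 2 ≤ ladyK ^ 2 * (m * M) * (‖w.fn‖ * (2 * M)) :=
    (H1.norm_mulConj_sq_le' v w).trans (by gcongr)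
  have h3 : D ^ 2 ≤ 8 * ladyK ^ 2 * m * M ^ 2 * ‖w.fn‖ := by
    have h4 : D ≤ ‖w.mulConj u‖ + ‖v.mulConj w‖ := by
      rw [hDdef, hD]
      exact norm_add_le _ _
    have h5 : D ^ 2 ≤ (‖w.mulConj u‖ + ‖v.mulConj w‖) ^ 2 := by gcongr
    nlinarith [sq_nonneg (‖w.mulConj u‖ - ‖v.mulConj w‖)]
  have hVu : ‖u.mulConj u‖ ≤ ladyK * (m * M) :=
    (H1.norm_mulConj_self_le u).trans (by gcongr)
  have hVv : ‖v.mulConj v‖ ≤ ladyK * (m * M) :=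
    (H1.norm_mulConj_self_le v).trans (by gcongr)
  have h6 : |quartic ν γ u - quartic ν γ v| ≤ 2 * c * ladyK * m * M * D := by
    have h7 : inner ℂ (u.mulConj u) (opLL ν γ (u.mulConj u)) -
        inner ℂ (v.mulConj v) (opLL ν γ (v.mulConj v)) =
        inner ℂ (u.mulConj u - v.mulConj v) (opLL ν γ (u.mulConj u)) +
        inner ℂ (v.mulConj v) (opLL ν γ (u.mulConj u - v.mulConj v)) := by
      rw [map_sub, inner_sub_left, inner_sub_right]
      ring
    rw [quartic_eq, quartic_eq, ← Complex.sub_re, h7]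
    refine (Complex.abs_re_le_norm _).trans ((norm_add_le _ _).trans ?_)
    have h8 : ‖inner ℂ (u.mulConj u - v.mulConj v) (opLL ν γ (u.mulConj u))‖ ≤
        D * (c * (ladyK * (m * M))) := by
      refine (norm_inner_le_norm _ _).trans ?_
      gcongr
      exact (norm_opLL_le _ _ _).trans (by gcongr)
    have h9 : ‖inner ℂ (v.mulConj v) (opLL ν γ (u.mulConj u - v.mulConj v))‖ ≤
        (ladyK * (m * M)) * (c * D) := by
      refine (norm_inner_le_norm _ _).trans ?_
      gcongr
      exact norm_opLL_le _ _ _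
    linarith
  rw [← sq_abs]
  calc |quartic ν γ u - quartic ν γ v| ^ 2 ≤ (2 * c * ladyK * m * M * D) ^ 2 := by gcongr
    _ = 4 * c ^ 2 * ladyK ^ 2 * m ^ 2 * M ^ 2 * D ^ 2 := by ring
    _ ≤ 4 * c ^ 2 * ladyK ^ 2 * m ^ 2 * M ^ 2 * (8 * ladyK ^ 2 * m * M ^ 2 * ‖w.fn‖) := by
      gcongr
    _ = _ := by
      rw [hw, H1.fn_sub]
      ring

theorem exists_first_time {G : ℝ → ℝ} {s t A : ℝ} (hst : s ≤ t)
    (hG : ContinuousOn G (Set.Icc s t)) (hs : G s ≤ A) (ht : A ≤ G t) :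
    ∃ r ∈ Set.Icc s t, G r = A ∧ ∀ τ ∈ Set.Icc s r, G τ ≤ A := by
  have hcomp : IsCompact (Set.Icc s t ∩ G ⁻¹' Set.Ici A) :=
    isCompact_Icc.of_isClosed_subset (hG.preimage_isClosed_of_isClosed isClosed_Icc isClosed_Ici)
      Set.inter_subset_left
  obtain ⟨r, hr, hmin⟩ := hcomp.exists_isLeast ⟨t, ⟨hst, le_rfl⟩, ht⟩
  obtain ⟨τ, hτ, hτA⟩ := intermediate_value_Icc hr.1.1
    (hG.mono (Set.Icc_subset_Icc_right hr.1.2)) ⟨hs, hr.2⟩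
  have hrτ : r = τ := le_antisymm
    (hmin ⟨⟨hτ.1, hτ.2.trans hr.1.2⟩, hτA.ge⟩) hτ.2
  refine ⟨r, hr.1, hrτ ▸ hτA, fun σ hσ => ?_⟩
  rcases hσ.2.eq_or_lt with h | h
  · rw [h, hrτ, hτA]
  · by_contra! hc
    exact absurd (hmin ⟨⟨hσ.1, hσ.2.trans hr.1.2⟩, hc.le⟩) (not_le.2 h)

theorem tendsto_norm_grad {T m : ℝ} {u : ℝ → H1} (hT : 0 < T)
    (hm : ∀ t ∈ Set.Ioo 0 T, ‖(u t).fn‖ = m)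
    (hu : Tendsto (fun t => ‖u t‖) (𝓝[<] T) atTop) :
    Tendsto (fun t => ‖(u t).grad‖) (𝓝[<] T) atTop := by
  refine tendsto_atTop_mono' _ ?_ (tendsto_atTop_add_const_right _ (-m) hu)
  filter_upwards [Ioo_mem_nhdsLT hT] with t ht
  have := H1.norm_le_add (u t)
  rw [hm t ht] at this
  linarith

/-- The time for ‖∇u‖ to double from its value g at time s is at least of order g⁻². Doubling does
happen before T, so T − s is at least as long. -/
theorem IsWeakDerivative.exists_rate {ν γ T : ℝ} {u : ℝ → H1} {du : ℝ → Hneg1}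
    (h : IsWeakDerivative ν γ T u du) (hT : 0 < T) (hc : ContinuousOn u (Set.Ico 0 T))
    (hu : Tendsto (fun t => ‖u t‖) (𝓝[<] T) atTop) :
    ∃ c : ℝ, 0 < c ∧ ∀ᶠ t in 𝓝[<] T, c ≤ ‖(u t).grad‖ ^ 2 * (T - t) := by
  have hK := ladyK_nonneg
  set m := ‖(u (T / 2)).fn‖ with hmdef
  have hm0 : 0 ≤ m := norm_nonneg _
  have hT2 : T / 2 ∈ Set.Ioo 0 T := ⟨by linarith, by linarith⟩
  have hm : ∀ t ∈ Set.Ioo 0 T, ‖(u t).fn‖ = m := fun t ht => h.norm_fn_eq hc ht hT2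
  have hG := tendsto_norm_grad hT hm hu
  set cc := |ν| + |γ| with hcc
  have hcc0 : 0 ≤ cc := by positivity
  set A := 32 * cc ^ 2 * ladyK ^ 4 * m ^ 3 with hA
  set B := 2 + 2 * cc * ladyK ^ 2 * m ^ 2 with hB
  have hA0 : 0 ≤ A := by positivity
  have hB0 : 0 ≤ B := by positivity
  -- Obtained from 36 ≤ 16A‖w‖ and ‖w‖² ≤ B(2g)²(T−s) with w = u(t) − u(s); the added 1 keeps the
  -- denominator positive.
  refine ⟨36 ^ 2 / (16 ^ 2 * A ^ 2 * (4 * B) + 1), by positivity, ?_⟩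
  filter_upwards [Ioo_mem_nhdsLT hT, hG.eventually_gt_atTop 0] with s hs hsG
  set g := ‖(u s).grad‖ with hg
  obtain ⟨t', ht'1, ht'2⟩ := ((hG.eventually_ge_atTop (2 * g)).and (Ioo_mem_nhdsLT hs.2)).exists
  have hsub : Set.Icc s t' ⊆ Set.Ioo 0 T := fun τ hτ => ⟨hs.1.trans_le hτ.1, hτ.2.trans_lt ht'2.2⟩
  have hGc : ContinuousOn (fun τ => ‖(u τ).grad‖) (Set.Icc s t') :=
    (H1.gradL.continuous.norm).comp_continuousOn
      (hc.mono fun τ hτ => ⟨(hsub hτ).1.le, (hsub hτ).2⟩)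
  obtain ⟨t, ht, htG, htM⟩ := exists_first_time (A := 2 * g) ht'2.1.le hGc (by linarith) ht'1
  set M := 2 * g with hM
  have hM0 : 0 ≤ M := by positivity
  have htT := hsub ht
  set w := u t - u s with hw
  have hwfn : ‖w.fn‖ ≤ 2 * m := by
    have := norm_sub_le (u t).fn (u s).fn
    rw [hm t htT, hm s hs] at this
    rw [hw, H1.fn_sub]
    linarith
  have hwg : ‖w.grad‖ ≤ 2 * M := by
    have := norm_sub_le (u t).grad (u s).grad
    rw [hw, H1.grad_sub]
    linarith
  have hsubt : Set.Icc s t ⊆ Set.Icc s t' := Set.Icc_subset_Icc_right ht.2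
  -- With w held fixed, ⟨w, u(τ)⟩ increases by exactly ‖w‖² from s to t, and the equation bounds its
  -- derivative, since the gradients stay below M up to the first doubling time.
  have hwsq : ‖w.fn‖ ^ 2 ≤ B * M ^ 2 * (t - s) := by
    have hmv := (convex_Icc s t).norm_image_sub_le_of_norm_hasDerivWithin_le
      (f := fun τ => inner ℂ w.fn (u τ).fn) (f' := fun τ => du τ w) (C := B * M ^ 2)
      (fun τ hτ => (h.hasDerivAt_inner (hsub (hsubt hτ)) w).hasDerivWithinAt)
      (fun τ hτ => by
        have hτT := hsub (hsubt hτ)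
        have h1 : ‖du τ w‖ = ‖Complex.I * du τ w‖ := by
          rw [norm_mul, Complex.norm_I, one_mul]
        rw [h1, (h τ hτT).2 w]
        refine (norm_sub_le _ _).trans ?_
        have h2 : ‖inner ℂ w.grad (u τ).grad‖ ≤ 2 * M * M :=
          (norm_inner_le_norm _ _).trans (by gcongr; exact htM τ hτ)
        have h3 := norm_nonlin_le_of_bounds ν γ hm0 hM0 (hm τ hτT).le (htM τ hτ) hwfn hwg
        rw [hB]
        linarith) (Set.left_mem_Icc.2 ht.1) (Set.right_mem_Icc.2 ht.1)
    rw [← inner_sub_right, ← H1.fn_sub, ← hw, inner_self_eq_norm_sq_to_K, Real.norm_of_nonneg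
      (sub_nonneg.2 ht.1)] at hmv
    simpa using hmv
  have hE := h.energy_eq hc htT hs
  rw [energy, energy, htG] at hE
  have hQ := abs_quartic_sub_le ν γ hm0 hM0 (hm t htT).le htG.le (hm s hs).le
    (show ‖(u s).grad‖ ≤ M by linarith)
  -- Equal energies give ((2g)² − g²)/2 = (Q(u(t)) − Q(u(s)))/4.
  have hQ' : quartic ν γ (u t) - quartic ν γ (u s) = 6 * g ^ 2 := by
    rw [hM] at hE
    linarith
  rw [hQ', ← H1.fn_sub, ← hw, hM] at hQ
  have h36 : 36 ≤ 16 * A * ‖w.fn‖ := by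
    have h4 : g ^ 4 * 36 ≤ g ^ 4 * (16 * A * ‖w.fn‖) := by
      rw [hA]
      linarith
    exact le_of_mul_le_mul_left h4 (by positivity)
  rw [div_le_iff₀ (by positivity)]
  have hTs : 0 ≤ T - s := by linarith [hs.2]
  calc (36 : ℝ) ^ 2 ≤ (16 * A * ‖w.fn‖) ^ 2 := by gcongr
    _ = 16 ^ 2 * A ^ 2 * ‖w.fn‖ ^ 2 := by ring
    _ ≤ 16 ^ 2 * A ^ 2 * (B * M ^ 2 * (t - s)) := by gcongr
    _ ≤ 16 ^ 2 * A ^ 2 * (B * M ^ 2 * (T - s)) := by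
      gcongr
      exact htT.2.le
    _ = (g ^ 2 * (T - s)) * (16 ^ 2 * A ^ 2 * (4 * B)) := by rw [hM]; ring
    _ ≤ g ^ 2 * (T - s) * (16 ^ 2 * A ^ 2 * (4 * B) + 1) := by
      gcongr
      linarith

/-! ### Localisation in space -/

theorem memLp_schwartz_mul (χ : 𝓢(Plane, ℂ)) (f : L2) :
    MemLp (fun x => χ x * f x) 2 (volume : Measure Plane) := by
  obtain ⟨C, hC⟩ := χ.decay 0 0
  refine (Lp.memLp f).of_le_mul (c := C)
    (χ.continuous.aestronglyMeasurable.mul (Lp.aestronglyMeasurable _))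
    (Eventually.of_forall fun x => ?_)
  have h := hC.2 x
  simp only [pow_zero, one_mul, norm_iteratedFDeriv_zero] at h
  rw [norm_mul]
  gcongr

theorem lineDeriv_schwartz_mul (χ φ : 𝓢(Plane, ℂ)) (e x : Plane) :
    (∂_{e} (SchwartzMap.smulLeftCLM ℂ χ φ) : 𝓢(Plane, ℂ)) x =
      χ x * (∂_{e} φ : 𝓢(Plane, ℂ)) x + (∂_{e} χ : 𝓢(Plane, ℂ)) x * φ x := by
  have hd := (χ.differentiable x).hasFDerivAt.mul (φ.differentiable x).hasFDerivAt
  have hcoe : (SchwartzMap.smulLeftCLM ℂ χ φ : Plane → ℂ) = fun x => χ x * φ x :=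
    SchwartzMap.smulLeftCLM_apply χ.hasTemperateGrowth φ
  simp only [SchwartzMap.lineDerivOp_apply_eq_fderiv]
  have hd' : fderiv ℝ (fun x => χ x * φ x) x = _ := hd.fderiv
  rw [hcoe, hd']
  simp only [add_apply, smul_apply, smul_eq_mul]
  ring

theorem integrable_schwartz_mul (χ : 𝓢(Plane, ℂ)) (f : L2) :
    Integrable fun x => χ x * f x :=
  (χ.memLp 2 volume).integrable_mul (Lp.memLp f)

/-- The product of a Schwartz function and an element of `H¹`. -/
def H1.smulSchwartz (χ : 𝓢(Plane, ℂ)) (v : H1) : H1 :=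
  ⟨WithLp.toLp 2 ((memLp_schwartz_mul χ v.fn).toLp _, WithLp.toLp 2 fun j =>
    (memLp_schwartz_mul χ (v.grad j)).toLp _ +
    (memLp_schwartz_mul (∂_{EuclideanSpace.single j (1 : ℝ)} χ) v.fn).toLp _), fun j => by
      set e : Plane := EuclideanSpace.single j (1 : ℝ)
      have hv : ∀ φ : 𝓢(Plane, ℂ), ∫ x, (∂_{e} φ : 𝓢(Plane, ℂ)) x * v.fn x =
          -∫ x, φ x * v.grad j x := fun φ => by
        have h := congrArg (fun T : 𝓢'(Plane, ℂ) => T φ) (v.2 j)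
        change ∂_{e} (v.fn : 𝓢'(Plane, ℂ)) φ = (v.grad j : 𝓢'(Plane, ℂ)) φ at h
        rw [TemperedDistribution.lineDerivOp_apply_apply, map_neg,
          Lp.toTemperedDistribution_apply, Lp.toTemperedDistribution_apply] at h
        simp only [smul_eq_mul] at h
        rw [← h, neg_neg]
      ext φ
      change ∂_{e} (((memLp_schwartz_mul χ v.fn).toLp _ : L2) : 𝓢'(Plane, ℂ)) φ =
        (((memLp_schwartz_mul χ (v.grad j)).toLp _ +
          (memLp_schwartz_mul (∂_{e} χ) v.fn).toLp _ : L2) : 𝓢'(Plane, ℂ)) φ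
      rw [TemperedDistribution.lineDerivOp_apply_apply, map_neg,
        Lp.toTemperedDistribution_apply, Lp.toTemperedDistribution_apply]
      simp only [smul_eq_mul]
      -- The product rule in the form χ ∂φ = ∂(χφ) − (∂χ)φ, so that the weak derivative of v is
      -- tested with the Schwartz function χφ.
      have h1 : ∫ x, (∂_{e} φ : 𝓢(Plane, ℂ)) x *
          ((memLp_schwartz_mul χ v.fn).toLp _ : L2) x =
          ∫ x, ((∂_{e} (SchwartzMap.smulLeftCLM ℂ χ φ) : 𝓢(Plane, ℂ)) x * v.fn x -
            SchwartzMap.smulLeftCLM ℂ (∂_{e} χ : 𝓢(Plane, ℂ)) φ x * v.fn x) := by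
        refine integral_congr_ae ?_
        filter_upwards [(memLp_schwartz_mul χ v.fn).coeFn_toLp] with x hx
        rw [hx, lineDeriv_schwartz_mul,
          SchwartzMap.smulLeftCLM_apply_apply (SchwartzMap.hasTemperateGrowth _), smul_eq_mul]
        ring
      rw [h1, integral_sub (integrable_schwartz_mul _ _) (integrable_schwartz_mul _ _), hv,
        neg_sub, sub_neg_eq_add, ← integral_add (integrable_schwartz_mul _ _)
        (integrable_schwartz_mul _ _)]
      refine integral_congr_ae ?_
      filter_upwards [(memLp_schwartz_mul χ (v.grad j)).coeFn_toLp,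
        (memLp_schwartz_mul (∂_{e} χ) v.fn).coeFn_toLp,
        Lp.coeFn_add ((memLp_schwartz_mul χ (v.grad j)).toLp _)
          ((memLp_schwartz_mul (∂_{e} χ) v.fn).toLp _)] with x h2 h3 h4
      rw [h4, Pi.add_apply, h2, h3, SchwartzMap.smulLeftCLM_apply_apply
        (SchwartzMap.hasTemperateGrowth _), SchwartzMap.smulLeftCLM_apply_apply
        (SchwartzMap.hasTemperateGrowth _), smul_eq_mul, smul_eq_mul]
      ring⟩

theorem H1.fn_smulSchwartz_ae (χ : 𝓢(Plane, ℂ)) (v : H1) :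
    (smulSchwartz χ v).fn =ᵐ[volume] fun x => χ x * v.fn x :=
  (memLp_schwartz_mul χ v.fn).coeFn_toLp

theorem H1.grad_smulSchwartz_ae (χ : 𝓢(Plane, ℂ)) (v : H1) (j : Fin 2) :
    (smulSchwartz χ v).grad j =ᵐ[volume] fun x => χ x * v.grad j x +
      (∂_{EuclideanSpace.single j (1 : ℝ)} χ : 𝓢(Plane, ℂ)) x * v.fn x := by
  filter_upwards [(memLp_schwartz_mul χ (v.grad j)).coeFn_toLp,
    (memLp_schwartz_mul (∂_{EuclideanSpace.single j (1 : ℝ)} χ) v.fn).coeFn_toLp,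
    Lp.coeFn_add ((memLp_schwartz_mul χ (v.grad j)).toLp _)
      ((memLp_schwartz_mul (∂_{EuclideanSpace.single j (1 : ℝ)} χ) v.fn).toLp _)] with x h2 h3 h4
  change ((memLp_schwartz_mul χ (v.grad j)).toLp _ +
    (memLp_schwartz_mul (∂_{EuclideanSpace.single j (1 : ℝ)} χ) v.fn).toLp _ : L2) x = _
  rw [h4, Pi.add_apply, h2, h3]

theorem sq_norm_add_le {s : ℝ} (hs : 0 < s) (a b : ℂ) :
    ‖a + b‖ ^ 2 ≤ (1 + s) * ‖a‖ ^ 2 + (1 + 1 / s) * ‖b‖ ^ 2 := by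
  have h1 : ‖a + b‖ ^ 2 ≤ (‖a‖ + ‖b‖) ^ 2 := by
    gcongr
    exact norm_add_le a b
  have h2 : 2 * (‖a‖ * ‖b‖) ≤ s * ‖a‖ ^ 2 + 1 / s * ‖b‖ ^ 2 := by
    have h3 : s * ‖a‖ ^ 2 + 1 / s * ‖b‖ ^ 2 - 2 * (‖a‖ * ‖b‖) = (s * ‖a‖ - ‖b‖) ^ 2 / s := by
      field_simp
      ring
    have h4 : 0 ≤ (s * ‖a‖ - ‖b‖) ^ 2 / s := by positivity
    linarith
  nlinarith

theorem norm_lineDeriv_le (χ : 𝓢(Plane, ℂ)) (j : Fin 2) (x : Plane) :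
    ‖(∂_{EuclideanSpace.single j (1 : ℝ)} χ : 𝓢(Plane, ℂ)) x‖ ≤ ‖fderiv ℝ χ x‖ := by
  rw [SchwartzMap.lineDerivOp_apply_eq_fderiv]
  refine (ContinuousLinearMap.le_opNorm _ _).trans_eq ?_
  simp

theorem integrable_bounded_mul {k h : Plane → ℝ} {C : ℝ} (hk : Continuous k)
    (hC : ∀ x, ‖k x‖ ≤ C) (hh : Integrable h) : Integrable fun x => k x * h x :=
  hh.bdd_mul hk.aestronglyMeasurable (Eventually.of_forall hC)

/-- The parameter s keeps the coefficient of the main term close to 1, as a sharp constant requires.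
The factor 2 in the error counts the two partial derivatives of χ, each bounded by its full
derivative. -/
theorem H1.norm_grad_smulSchwartz_le {s a b : ℝ} (hs : 0 < s) (χ : 𝓢(Plane, ℂ)) (v : H1)
    (ha : ∀ x, ‖χ x‖ ≤ a) (hb : ∀ x, ‖fderiv ℝ χ x‖ ≤ b) :
    ‖(smulSchwartz χ v).grad‖ ^ 2 ≤
      (1 + s) * (∫ x, ‖χ x‖ ^ 2 * (∑ j, ‖v.grad j x‖ ^ 2)) +
      (1 + 1 / s) * (2 * ∫ x, ‖fderiv ℝ χ x‖ ^ 2 * ‖v.fn x‖ ^ 2) := by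
  have hfc : Continuous (fderiv ℝ χ) := (χ.smooth 1).continuous_fderiv one_ne_zero
  have hg : Integrable fun x => ∑ j, ‖v.grad j x‖ ^ 2 :=
    integrable_finsetSum _ fun j _ => integrable_norm_sq _
  have i1 : Integrable fun x => ‖χ x‖ ^ 2 * (∑ j, ‖v.grad j x‖ ^ 2) :=
    integrable_bounded_mul (C := a ^ 2) (χ.continuous.norm.pow 2) (fun x => by
      rw [norm_pow, norm_norm]
      have := ha x
      gcongr) hg
  have i2 : Integrable fun x => ‖fderiv ℝ χ x‖ ^ 2 * ‖v.fn x‖ ^ 2 :=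
    integrable_bounded_mul (C := b ^ 2) (hfc.norm.pow 2) (fun x => by
      rw [norm_pow, norm_norm]
      have := hb x
      gcongr) (integrable_norm_sq _)
  rw [norm_grad_sq]
  simp only [norm_L2_sq]
  rw [← integral_finsetSum _ fun j _ => integrable_norm_sq _, ← integral_const_mul,
    ← integral_const_mul, ← integral_const_mul,
    ← integral_add (i1.const_mul _) ((i2.const_mul _).const_mul _)]
  refine integral_mono_ae (integrable_finsetSum _ fun j _ => integrable_norm_sq _)
    ((i1.const_mul _).add ((i2.const_mul _).const_mul _)) ?_
  filter_upwards [grad_smulSchwartz_ae χ v 0, grad_smulSchwartz_ae χ v 1] with x h0 h1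
  simp only [Fin.sum_univ_two]
  rw [h0, h1]
  refine (add_le_add (sq_norm_add_le hs _ _) (sq_norm_add_le hs _ _)).trans ?_
  simp only [norm_mul, mul_pow]
  have h2 := norm_lineDeriv_le χ 0 x
  have h3 := norm_lineDeriv_le χ 1 x
  have h4 : ‖(∂_{EuclideanSpace.single (0 : Fin 2) (1 : ℝ)} χ : 𝓢(Plane, ℂ)) x‖ ^ 2 *
      ‖v.fn x‖ ^ 2 ≤ ‖fderiv ℝ χ x‖ ^ 2 * ‖v.fn x‖ ^ 2 := by gcongr
  have h5 : ‖(∂_{EuclideanSpace.single (1 : Fin 2) (1 : ℝ)} χ : 𝓢(Plane, ℂ)) x‖ ^ 2 *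
      ‖v.fn x‖ ^ 2 ≤ ‖fderiv ℝ χ x‖ ^ 2 * ‖v.fn x‖ ^ 2 := by gcongr
  have h6 := mul_le_mul_of_nonneg_left (add_le_add h4 h5) (show 0 ≤ 1 + 1 / s by positivity)
  linarith

/-- Averaging over translations decouples the cutoff from the function: the inner integral is a
convolution of `h` with the reflected `k`. -/
theorem integral_translate_mul {k h : Plane → ℝ} (hk : Integrable k) (hh : Integrable h) :
    Integrable (fun y => ∫ x, k (x - y) * h x) ∧
      ∫ y, ∫ x, k (x - y) * h x = (∫ x, k x) * ∫ x, h x := by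
  have e : (fun y => ∫ x, k (x - y) * h x) =
      MeasureTheory.convolution h (fun z => k (-z)) (ContinuousLinearMap.mul ℝ ℝ) volume := by
    ext y
    simp only [MeasureTheory.convolution, ContinuousLinearMap.mul_apply', neg_sub]
    simp only [mul_comm]
  rw [e]
  refine ⟨hh.integrable_convolution _ hk.comp_neg, ?_⟩
  rw [integral_convolution _ hh hk.comp_neg, ContinuousLinearMap.mul_apply',
    integral_neg_eq_self k volume, mul_comm]

theorem quartic_eq_fourier (ν γ : ℝ) (v : H1) :
    quartic ν γ v = ν * ‖v.mulConj v‖ ^ 2 +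
      γ * ∫ ξ, symbolB ξ * ‖(𝓕 (v.mulConj v) : L2) ξ‖ ^ 2 := by
  rw [quartic_eq, opLL_apply, opL, inner_add_right, inner_smul_right, inner_smul_right, inner_opB,
    inner_self_eq_norm_sq_to_K]
  have h : ∫ ξ, (symbolB ξ : ℂ) * (conj ((𝓕 (v.mulConj v) : L2) ξ) * (𝓕 (v.mulConj v) : L2) ξ) =
      ((∫ ξ, symbolB ξ * ‖(𝓕 (v.mulConj v) : L2) ξ‖ ^ 2 : ℝ) : ℂ) := by
    rw [← integral_complex_ofReal]
    refine integral_congr_ae (Eventually.of_forall fun ξ => ?_)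
    simp only
    rw [Complex.conj_mul']
    push_cast
    ring
  rw [h]
  simp only [Complex.coe_algebraMap, ← Complex.ofReal_pow, ← Complex.ofReal_mul,
    ← Complex.ofReal_add, Complex.ofReal_re]

/-- One bump, dilated by R, so `L` does not depend on R. For small θ the cutoff is nearly an
indicator, and ∫|χ|² and ∫|η|² with η = |χ|² nearly agree, so the averaging loses almost nothing in
the constant. -/
theorem exists_cutoff {θ : ℝ} (h0 : 0 < θ) (h1 : θ < 1) : ∃ L : ℝ, 0 ≤ L ∧ ∀ R : ℝ, 0 < R →
    ∃ χ η : 𝓢(Plane, ℂ), (∀ x, ‖χ x‖ ≤ 1) ∧ (∀ x, ‖x‖ ≤ (1 - θ) * R → χ x = 1) ∧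
      (∀ x, R < ‖x‖ → χ x = 0) ∧ (∀ x, ‖fderiv ℝ χ x‖ ≤ L / R) ∧
      (∀ x, R < ‖x‖ → fderiv ℝ χ x = 0) ∧ (∀ x, η x = ((‖χ x‖ ^ 2 : ℝ) : ℂ)) ∧
      (∀ x, ‖fderiv ℝ η x‖ ≤ 2 * L / R) ∧ (∀ x, R < ‖x‖ → fderiv ℝ η x = 0) := by
  let b : ContDiffBump (0 : Plane) := ⟨1 - θ, 1, by linarith, by linarith⟩
  let f : Plane → ℂ := fun x => (b x : ℂ)
  have hf : ContDiff ℝ ((⊤ : ℕ∞) : WithTop ℕ∞) f := Complex.ofRealCLM.contDiff.comp b.contDiff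
  have hfc : HasCompactSupport f :=
    b.hasCompactSupport.comp_left (g := fun t : ℝ => (t : ℂ)) (by simp)
  have hf1 : ContDiff ℝ 1 f := hf.of_le (by exact_mod_cast le_top)
  obtain ⟨K, hK⟩ := (hf1.continuous_fderiv one_ne_zero).bounded_above_of_compact_support
    (hfc.fderiv (𝕜 := ℝ))
  have hK0 : 0 ≤ K := (norm_nonneg _).trans (hK 0)
  refine ⟨K, hK0, fun R hR => ?_⟩
  have hg : ContDiff ℝ ((⊤ : ℕ∞) : WithTop ℕ∞) fun x : Plane => f (R⁻¹ • x) :=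
    hf.comp (contDiff_const_smul _)
  have hgc : HasCompactSupport fun x : Plane => f (R⁻¹ • x) := hfc.comp_smul (by positivity)
  set g : Plane → ℂ := fun x => f (R⁻¹ • x) with hgdef
  have hg2 : ContDiff ℝ ((⊤ : ℕ∞) : WithTop ℕ∞) fun x : Plane => g x * g x := hg.mul hg
  have hg2c : HasCompactSupport fun x : Plane => g x * g x := hgc.mul_right
  have hgn : ∀ x, g x = ((‖g x‖ : ℝ) : ℂ) := fun x => by
    simp only [hgdef, f, Complex.norm_real, Real.norm_of_nonneg b.nonneg]
  have hgle : ∀ x, ‖g x‖ ≤ 1 := fun x => by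
    simp only [hgdef, f, Complex.norm_real, Real.norm_of_nonneg b.nonneg]
    exact b.le_one
  have hg0 : ∀ x, R < ‖x‖ → g x = 0 := fun x hx => by
    simp only [hgdef, f]
    rw [b.zero_of_le_dist, Complex.ofReal_zero]
    rw [dist_zero_right, norm_smul, norm_inv, Real.norm_of_nonneg hR.le, ← div_eq_inv_mul]
    exact ((one_lt_div hR).2 hx).le
  have hev : ∀ x, R < ‖x‖ → g =ᶠ[𝓝 x] fun _ => 0 := fun x hx => by
    filter_upwards [(isOpen_lt continuous_const continuous_norm).mem_nhds hx] with z hz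
    exact hg0 z hz
  have hfd : ∀ x, ‖fderiv ℝ g x‖ ≤ K / R := fun x => by
    have h1 : HasFDerivAt f (fderiv ℝ f (R⁻¹ • x)) (R⁻¹ • x) :=
      (hf1.differentiable one_ne_zero _).hasFDerivAt
    have h2 : HasFDerivAt (fun y : Plane => R⁻¹ • y) (R⁻¹ • ContinuousLinearMap.id ℝ Plane) x :=
      (R⁻¹ • ContinuousLinearMap.id ℝ Plane).hasFDerivAt
    have h3 : fderiv ℝ g x = _ := (h1.comp x h2).fderiv
    rw [h3]
    simp only [ContinuousLinearMap.comp_smul, ContinuousLinearMap.comp_id, norm_smul, norm_inv]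
    rw [Real.norm_of_nonneg hR.le, ← div_eq_inv_mul]
    gcongr
    exact hK _
  have hgd : ContDiff ℝ 1 g := hg.of_le (by exact_mod_cast le_top)
  refine ⟨hgc.toSchwartzMap hg, hg2c.toSchwartzMap hg2, hgle, fun x hx => ?_, hg0, hfd,
    fun x hx => ?_, fun x => ?_, fun x => ?_, fun x hx => ?_⟩
  · change g x = 1
    simp only [hgdef, f]
    rw [b.one_of_mem_closedBall, Complex.ofReal_one]
    rw [mem_closedBall_zero_iff, norm_smul, norm_inv, Real.norm_of_nonneg hR.le, ← div_eq_inv_mul,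
      div_le_iff₀ hR]
    exact hx
  · change fderiv ℝ g x = 0
    rw [(hev x hx).fderiv_eq, fderiv_const_apply]
  · change g x * g x = ((‖g x‖ ^ 2 : ℝ) : ℂ)
    rw [pow_two, Complex.ofReal_mul, ← hgn]
  · change ‖fderiv ℝ (fun x => g x * g x) x‖ ≤ _
    refine (norm_fderiv_mul_le hgd hgd x).trans ?_
    have h3 : ‖g x‖ * ‖fderiv ℝ g x‖ ≤ 1 * (K / R) :=
      mul_le_mul (hgle x) (hfd x) (norm_nonneg _) zero_le_one
    rw [mul_div_assoc]
    linarith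
  · change fderiv ℝ (fun x => g x * g x) x = 0
    have : (fun x => g x * g x) =ᶠ[𝓝 x] fun _ => 0 := by
      filter_upwards [hev x hx] with z hz
      rw [hz, mul_zero]
    rw [this.fderiv_eq, fderiv_const_apply]

/-! ### The nonlocal term of the localised functions, averaged over all translations -/

/-- The numerator of the difference factors as (a₀b₁ − b₀a₁)(a₀b₁ + b₀a₁). The first factor is
unchanged in size when a is replaced by b − a, hence at most |b||b − a|; the second is at most
|a||b|. -/
theorem abs_symbolB_sub_le {a b : Plane} (ha : a ≠ 0) :
    symbolB a - symbolB b ≤ ‖b - a‖ / ‖a‖ := by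
  have ha' : 0 < ‖a‖ := norm_pos_iff.2 ha
  rcases eq_or_ne b 0 with rfl | hb
  · have h : symbolB 0 = 0 := by simp [symbolB]
    rw [h, sub_zero, zero_sub, norm_neg, div_self ha'.ne']
    exact symbolB_le_one a
  have hb' : 0 < ‖b‖ := norm_pos_iff.2 hb
  have na : ‖a‖ ^ 2 = a 0 ^ 2 + a 1 ^ 2 := by
    rw [EuclideanSpace.norm_sq_eq, Fin.sum_univ_two]; simp
  have nb : ‖b‖ ^ 2 = b 0 ^ 2 + b 1 ^ 2 := by
    rw [EuclideanSpace.norm_sq_eq, Fin.sum_univ_two]; simp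
  have nc : ‖b - a‖ ^ 2 = (b 0 - a 0) ^ 2 + (b 1 - a 1) ^ 2 := by
    rw [EuclideanSpace.norm_sq_eq, Fin.sum_univ_two]; simp
  have hN : |a 0 * b 1 - b 0 * a 1| ≤ ‖b‖ * ‖b - a‖ := by
    refine abs_le_of_sq_le_sq ?_ (by positivity)
    rw [mul_pow, nb, nc]
    nlinarith [sq_nonneg (b 0 * (b 0 - a 0) + b 1 * (b 1 - a 1))]
  have hP : |a 0 * b 1 + b 0 * a 1| ≤ ‖a‖ * ‖b‖ := by
    refine abs_le_of_sq_le_sq ?_ (by positivity)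
    rw [mul_pow, na, nb]
    nlinarith [sq_nonneg (a 0 * b 0 - a 1 * b 1)]
  have key : symbolB a - symbolB b =
      (a 0 * b 1 - b 0 * a 1) * (a 0 * b 1 + b 0 * a 1) / (‖a‖ ^ 2 * ‖b‖ ^ 2) := by
    rw [symbolB, symbolB, ← na, ← nb, div_sub_div _ _ (by positivity) (by positivity), na, nb]
    congr 1
    ring
  rw [key, div_le_div_iff₀ (by positivity) ha']
  have h1 : (a 0 * b 1 - b 0 * a 1) * (a 0 * b 1 + b 0 * a 1) ≤
      (‖b‖ * ‖b - a‖) * (‖a‖ * ‖b‖) := by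
    refine (le_abs_self _).trans ?_
    rw [abs_mul]
    gcongr
  calc _ ≤ (‖b‖ * ‖b - a‖) * (‖a‖ * ‖b‖) * ‖a‖ := by gcongr
    _ = _ := by ring

theorem symbolB_le_translate {δ : ℝ} (hδ : 0 < δ) (ξ ζ : Plane) :
    ENNReal.ofReal (symbolB ξ) ≤ ENNReal.ofReal (symbolB (ξ + ζ)) +
      ((Metric.closedBall (0 : Plane) δ).indicator 1 ξ + ENNReal.ofReal (‖ζ‖ / δ)) := by
  by_cases h : ξ ∈ Metric.closedBall (0 : Plane) δ
  · rw [Set.indicator_of_mem h, Pi.one_apply]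
    calc ENNReal.ofReal (symbolB ξ) ≤ 1 := by
          rw [ENNReal.ofReal_le_one]; exact symbolB_le_one ξ
      _ ≤ 1 + ENNReal.ofReal (‖ζ‖ / δ) := le_self_add
      _ ≤ _ := le_add_self
  · rw [Set.indicator_of_notMem h, zero_add, ← ENNReal.ofReal_add (symbolB_nonneg _)
      (by positivity)]
    refine ENNReal.ofReal_le_ofReal ?_
    have h' : δ < ‖ξ‖ := by simpa using h
    have hne : ξ ≠ 0 := norm_pos_iff.1 (hδ.trans h')
    have h1 := abs_symbolB_sub_le (b := ξ + ζ) hne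
    rw [add_sub_cancel_left] at h1
    have h2 : ‖ζ‖ / ‖ξ‖ ≤ ‖ζ‖ / δ := by gcongr
    linarith

/-- The Fourier transform of the product of `ρ` with the translate by `y` of `η`. -/
def localFourier (η : 𝓢(Plane, ℂ)) (ρ : Plane → ℂ) (y ξ : Plane) : ℂ :=
  𝓕 (fun x => η (x - y) * ρ x) ξ

theorem exists_norm_schwartz_le (η : 𝓢(Plane, ℂ)) : ∃ C, ∀ x, ‖η x‖ ≤ C := by
  obtain ⟨C, hC⟩ := η.decay 0 0
  refine ⟨C, fun x => ?_⟩
  simpa using hC.2 x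

theorem continuous_localFourier (η : 𝓢(Plane, ℂ)) {ρ : Plane → ℂ} (hρ : Integrable ρ) :
    Continuous fun p : Plane × Plane => localFourier η ρ p.1 p.2 := by
  obtain ⟨C, hC⟩ := exists_norm_schwartz_le η
  simp only [localFourier, Real.fourier_eq]
  refine continuous_of_dominated (bound := fun x => C * ‖ρ x‖) (fun p => ?_) (fun p => ?_)
    (hρ.norm.const_mul C) (Eventually.of_forall fun x => ?_)
  · refine AEStronglyMeasurable.smul (Continuous.aestronglyMeasurable ?_) ?_
    · fun_prop
    · exact (Continuous.aestronglyMeasurable (by fun_prop)).mul hρ.aestronglyMeasurable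
  · refine Eventually.of_forall fun x => ?_
    rw [Circle.norm_smul, norm_mul]
    gcongr
    exact hC _
  · fun_prop

theorem integral_fourier_mul {f g : Plane → ℂ} (hf : Integrable f) (hg : Integrable g) :
    ∫ x, 𝓕 f x * g x = ∫ x, f x * 𝓕 g x := by
  simpa using! VectorFourier.integral_bilin_fourierIntegral_eq_flip (ContinuousLinearMap.mul ℂ ℂ)
    (L := innerₗ Plane) Real.continuous_fourierChar continuous_inner hf hg

/-- For fixed ξ the function of the centre y is itself a Fourier transform, which makes Plancherel
in y available. The proof moves the transform from a modulated translate of η̂ onto ρ. -/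
theorem localFourier_eq (η : 𝓢(Plane, ℂ)) {ρ : Plane → ℂ} (hρ : Integrable ρ) (y ξ : Plane) :
    localFourier η ρ y ξ = 𝓕 (fun ζ => 𝓕 η ζ * 𝓕 ρ (ξ - ζ)) y := by
  set g : Plane → ℂ := fun ζ => Real.fourierChar (-inner ℝ (ξ - ζ) y) • 𝓕 η (ξ - ζ) with hg
  have hgi : Integrable g := by
    have h1 : Integrable fun ζ => 𝓕 η (ξ - ζ) := (𝓕 η).integrable.comp_sub_left ξ
    refine h1.norm.mono' ?_ (Eventually.of_forall fun ζ => ?_)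
    · refine AEStronglyMeasurable.smul (Continuous.aestronglyMeasurable (by fun_prop))
        h1.aestronglyMeasurable
    · rw [hg, Circle.norm_smul]
  have hgF : ∀ x, 𝓕 g x = Real.fourierChar (-inner ℝ x ξ) • η (x - y) := fun x => by
    have hinv : η (x - y) = 𝓕⁻ (𝓕 η : 𝓢(Plane, ℂ)) (x - y) := by
      rw [FourierTransform.fourierInv_fourier_eq]
    rw [hinv, SchwartzMap.fourierInv_coe, Real.fourierInv_eq, Real.fourier_eq,
      ← integral_sub_left_eq_self _ volume ξ, Circle.smul_def, smul_eq_mul, ← integral_const_mul]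
    congr 1
    ext ζ
    simp only [hg, sub_sub_cancel, Circle.smul_def, smul_eq_mul]
    rw [← mul_assoc, ← mul_assoc, ← Circle.coe_mul, ← Circle.coe_mul, ← AddChar.map_add_eq_mul,
      ← AddChar.map_add_eq_mul]
    congr 3
    simp only [inner_sub_left, inner_sub_right, real_inner_comm ξ x]
    ring
  have h1 := integral_fourier_mul hgi hρ
  rw [localFourier, Real.fourier_eq, Real.fourier_eq]
  have e1 : ∀ x, Real.fourierChar (-inner ℝ x ξ) • (η (x - y) * ρ x) = 𝓕 g x * ρ x := fun x => by
    rw [hgF, smul_mul_assoc]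
  have e2 : ∀ ζ, Real.fourierChar (-inner ℝ (ξ - ζ) y) • (𝓕 η (ξ - ζ) * 𝓕 ρ (ξ - (ξ - ζ))) =
      g ζ * 𝓕 ρ ζ := fun ζ => by
    rw [sub_sub_cancel, hg, smul_mul_assoc]
  simp only [e1]
  rw [h1, ← integral_sub_left_eq_self (fun ζ => Real.fourierChar (-inner ℝ ζ y) •
    (𝓕 η ζ * 𝓕 ρ (ξ - ζ))) volume ξ]
  simp only [e2]

theorem lintegral_fourier_sq {f : Plane → ℂ} (hf : Integrable f) (hf2 : MemLp f 2 volume) :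
    ∫⁻ x, ‖𝓕 f x‖ₑ ^ 2 = ∫⁻ x, ‖f x‖ₑ ^ 2 := by
  have key : ∀ g : L2, ∫⁻ x, ‖g x‖ₑ ^ 2 = ENNReal.ofReal (‖g‖ ^ 2) := fun g => by
    rw [norm_L2_sq, ofReal_integral_eq_lintegral_ofReal (integrable_norm_sq g)
      (Eventually.of_forall fun x => by positivity)]
    congr 1
    ext x
    rw [ENNReal.ofReal_pow (norm_nonneg _), ofReal_norm]
  have h1 := hf2.coeFn_toLp
  have h2 := fourier_ae_eq (hf2.toLp f) (hf.congr h1.symm)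
  have h3 : 𝓕 (hf2.toLp f : Plane → ℂ) = 𝓕 f := by
    ext ξ
    rw [Real.fourier_eq, Real.fourier_eq]
    refine integral_congr_ae ?_
    filter_upwards [h1] with x hx
    rw [hx]
  have e1 : ∫⁻ x, ‖𝓕 f x‖ₑ ^ 2 = ∫⁻ x, ‖(𝓕 (hf2.toLp f) : L2) x‖ₑ ^ 2 := by
    refine lintegral_congr_ae ?_
    filter_upwards [h2] with x hx
    rw [hx, h3]
  have e2 : ∫⁻ x, ‖f x‖ₑ ^ 2 = ∫⁻ x, ‖(hf2.toLp f : L2) x‖ₑ ^ 2 := by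
    refine lintegral_congr_ae ?_
    filter_upwards [h1] with x hx
    rw [hx]
  rw [e1, e2, key, key, Lp.norm_fourier_eq]

theorem lintegral_localFourier_sq (η : 𝓢(Plane, ℂ)) {ρ : Plane → ℂ} (hρ : Integrable ρ)
    (ξ : Plane) : ∫⁻ y, ‖localFourier η ρ y ξ‖ₑ ^ 2 =
      ∫⁻ ζ, ‖𝓕 η ζ‖ₑ ^ 2 * ‖𝓕 ρ (ξ - ζ)‖ₑ ^ 2 := by
  simp only [localFourier_eq η hρ]
  have hc : Continuous fun ζ => 𝓕 ρ (ξ - ζ) :=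
    (continuous_fourier hρ).comp (continuous_const.sub continuous_id)
  have hb : ∀ ζ, ‖𝓕 ρ (ξ - ζ)‖ ≤ ∫ x, ‖ρ x‖ := fun ζ => norm_fourier_le _
  have hi : Integrable fun ζ => 𝓕 η ζ * 𝓕 ρ (ξ - ζ) :=
    (𝓕 η).integrable.mul_bdd (c := ∫ x, ‖ρ x‖) hc.aestronglyMeasurable (Eventually.of_forall hb)
  have hm : MemLp (fun ζ => 𝓕 η ζ * 𝓕 ρ (ξ - ζ)) 2 volume := by
    refine ((𝓕 η).memLp 2 volume).of_le_mul (c := ∫ x, ‖ρ x‖) hi.aestronglyMeasurable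
      (Eventually.of_forall fun ζ => ?_)
    rw [norm_mul, mul_comm]
    gcongr
    exact hb ζ
  rw [lintegral_fourier_sq hi hm]
  simp only [enorm_mul, mul_pow]

/-- Integrating in y first and using Plancherel there leaves |η̂(ζ)|²|ρ̂(ξ−ζ)|²; the shift ξ → ξ+ζ
then moves the translation onto the symbol. -/
theorem lintegral_symbolB_localFourier (η : 𝓢(Plane, ℂ)) {ρ : Plane → ℂ} (hρ : Integrable ρ) :
    ∫⁻ y, ∫⁻ ξ, ENNReal.ofReal (symbolB ξ) * ‖localFourier η ρ y ξ‖ₑ ^ 2 =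
      ∫⁻ ζ, ‖𝓕 η ζ‖ₑ ^ 2 * ∫⁻ ξ, ENNReal.ofReal (symbolB (ξ + ζ)) * ‖𝓕 ρ ξ‖ₑ ^ 2 := by
  have hσ : Measurable fun ξ => ENNReal.ofReal (symbolB ξ) := measurable_symbolB.ennreal_ofReal
  have hρc := continuous_fourier hρ
  have hηc : Continuous fun ζ => 𝓕 η ζ := (𝓕 η).continuous
  have hcont := continuous_localFourier η hρ
  have hsq := lintegral_localFourier_sq η hρ
  generalize localFourier η ρ = Φ at hcont hsq ⊢
  have hΦ : Measurable fun p : Plane × Plane => ‖Φ p.1 p.2‖ₑ ^ 2 :=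
    hcont.enorm.measurable.pow_const 2
  have hm : Measurable fun p : Plane × Plane => ENNReal.ofReal (symbolB p.2) * ‖Φ p.1 p.2‖ₑ ^ 2 :=
    (hσ.comp measurable_snd).mul hΦ
  rw [lintegral_lintegral_swap hm.aemeasurable]
  have h1 : ∀ ξ, ∫⁻ y, ENNReal.ofReal (symbolB ξ) * ‖Φ y ξ‖ₑ ^ 2 =
      ∫⁻ ζ, ENNReal.ofReal (symbolB ξ) * (‖𝓕 η ζ‖ₑ ^ 2 * ‖𝓕 ρ (ξ - ζ)‖ₑ ^ 2) := fun ξ => by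
    have hm1 : Measurable fun y => ‖Φ y ξ‖ₑ ^ 2 :=
      hΦ.comp measurable_prodMk_right
    have hm2 : Continuous fun ζ => 𝓕 ρ (ξ - ζ) := hρc.comp (continuous_const.sub continuous_id)
    rw [lintegral_const_mul _ hm1,
      hsq, ← lintegral_const_mul _
      (show Measurable fun ζ => ‖𝓕 η ζ‖ₑ ^ 2 * ‖𝓕 ρ (ξ - ζ)‖ₑ ^ 2 from
        (hηc.enorm.measurable.pow_const 2).mul (hm2.enorm.measurable.pow_const 2))]
  simp only [h1]
  rw [lintegral_lintegral_swap]
  swap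
  · refine Measurable.aemeasurable ?_
    have hm2 : Continuous fun p : Plane × Plane => 𝓕 ρ (p.1 - p.2) :=
      hρc.comp (continuous_fst.sub continuous_snd)
    exact (hσ.comp measurable_fst).mul (((hηc.comp continuous_snd).enorm.measurable.pow_const 2).mul
      (hm2.enorm.measurable.pow_const 2))
  refine lintegral_congr fun ζ => ?_
  rw [← lintegral_const_mul]
  swap
  · exact (hσ.comp (measurable_id.add_const ζ)).mul (hρc.enorm.measurable.pow_const 2)
  rw [← lintegral_add_right_eq_self _ ζ]
  refine lintegral_congr fun ξ => ?_
  rw [add_sub_cancel_right]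
  ring

/-- The nonlocal term survives averaging up to two errors: the low frequencies |ξ| ≤ δ of ρ, and the
first moment of |η̂|² divided by δ. -/
theorem le_lintegral_symbolB_localFourier (η : 𝓢(Plane, ℂ)) {ρ : Plane → ℂ} (hρ : Integrable ρ)
    {δ : ℝ} (hδ : 0 < δ) :
    (∫⁻ ζ, ‖𝓕 η ζ‖ₑ ^ 2) * ∫⁻ ξ, ENNReal.ofReal (symbolB ξ) * ‖𝓕 ρ ξ‖ₑ ^ 2 ≤
      (∫⁻ y, ∫⁻ ξ, ENNReal.ofReal (symbolB ξ) * ‖localFourier η ρ y ξ‖ₑ ^ 2) +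
      ((∫⁻ ζ, ‖𝓕 η ζ‖ₑ ^ 2) * (∫⁻ ξ in Metric.closedBall (0 : Plane) δ, ‖𝓕 ρ ξ‖ₑ ^ 2) +
      (∫⁻ ζ, ENNReal.ofReal (‖ζ‖ / δ) * ‖𝓕 η ζ‖ₑ ^ 2) * ∫⁻ ξ, ‖𝓕 ρ ξ‖ₑ ^ 2) := by
  have hσ : Measurable fun ξ => ENNReal.ofReal (symbolB ξ) := measurable_symbolB.ennreal_ofReal
  have hρm : Measurable fun ξ => ‖𝓕 ρ ξ‖ₑ ^ 2 :=
    (continuous_fourier hρ).enorm.measurable.pow_const 2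
  have hηm : Measurable fun ζ => ‖𝓕 η ζ‖ₑ ^ 2 := (𝓕 η).continuous.enorm.measurable.pow_const 2
  have hw : Measurable fun ζ : Plane => ENNReal.ofReal (‖ζ‖ / δ) := by fun_prop
  rw [lintegral_symbolB_localFourier η hρ, ← lintegral_mul_const _ hηm,
    ← lintegral_mul_const _ hηm, ← lintegral_mul_const _ (show Measurable fun ζ : Plane =>
      ENNReal.ofReal (‖ζ‖ / δ) * ‖𝓕 η ζ‖ₑ ^ 2 from hw.mul hηm)]
  rw [← lintegral_add_right _ (by fun_prop), ← lintegral_add_right _ (by fun_prop)]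
  refine lintegral_mono fun ζ => ?_
  have h1 : ∫⁻ ξ, ENNReal.ofReal (symbolB ξ) * ‖𝓕 ρ ξ‖ₑ ^ 2 ≤
      ∫⁻ ξ, (ENNReal.ofReal (symbolB (ξ + ζ)) * ‖𝓕 ρ ξ‖ₑ ^ 2 +
        ((Metric.closedBall (0 : Plane) δ).indicator (fun ξ => ‖𝓕 ρ ξ‖ₑ ^ 2) ξ +
        ENNReal.ofReal (‖ζ‖ / δ) * ‖𝓕 ρ ξ‖ₑ ^ 2)) := by
    refine lintegral_mono fun ξ => ?_
    refine (mul_le_mul_left (symbolB_le_translate hδ ξ ζ) _).trans_eq ?_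
    rw [add_mul, add_mul]
    congr 2
    by_cases h : ξ ∈ Metric.closedBall (0 : Plane) δ
    · simp only [Set.indicator_of_mem h, Pi.one_apply, one_mul]
    · simp only [Set.indicator_of_notMem h, zero_mul]
  refine (mul_le_mul_right h1 _).trans_eq ?_
  rw [lintegral_add_right _ (by
    exact (hρm.indicator measurableSet_closedBall).add (hρm.const_mul _)),
    lintegral_add_right _ (hρm.const_mul _), lintegral_indicator measurableSet_closedBall,
    lintegral_const_mul _ hρm]
  ring

/-! ### The averaged inequality -/

/-- The product of `v` with the translate by `y` of `χ`. -/
def H1.localize (χ : 𝓢(Plane, ℂ)) (v : H1) (y : Plane) : H1 :=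
  H1.smulSchwartz (χ.compSubConstCLM ℂ y) v

theorem H1.integrable_mulConj (v w : H1) : Integrable (v.mulConj w) := by
  refine Integrable.congr ?_ (mulConj_ae v w).symm
  have h : MemLp (fun x => conj (w.fn x)) 2 (volume : Measure Plane) :=
    (Lp.memLp w.fn).of_le (Complex.continuous_conj.comp_aestronglyMeasurable
      (Lp.aestronglyMeasurable _)) (Eventually.of_forall fun x => by simp)
  exact (Lp.memLp v.fn).integrable_mul h

theorem H1.norm_mulConj_self_ae (v : H1) :
    ∀ᵐ x, ‖v.mulConj v x‖ = ‖v.fn x‖ ^ 2 := by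
  filter_upwards [absSq_fn_ae v] with x hx
  rw [hx, Complex.norm_real, Real.norm_of_nonneg (by positivity)]

theorem H1.integral_norm_mulConj_self (v : H1) : ∫ x, ‖v.mulConj v x‖ = ‖v.fn‖ ^ 2 := by
  rw [norm_L2_sq]
  exact integral_congr_ae v.norm_mulConj_self_ae

theorem ofReal_norm_sq_eq_lintegral (f : L2) : ENNReal.ofReal (‖f‖ ^ 2) = ∫⁻ x, ‖f x‖ₑ ^ 2 := by
  rw [norm_L2_sq, ofReal_integral_eq_lintegral_ofReal (integrable_norm_sq f)
    (Eventually.of_forall fun x => by positivity)]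
  congr 1
  ext x
  rw [ENNReal.ofReal_pow (norm_nonneg _), ofReal_norm]

theorem massIn_le (f : L2) (y : Plane) (r : ℝ) : massIn f y r ≤ ENNReal.ofReal (‖f‖ ^ 2) := by
  rw [ofReal_norm_sq_eq_lintegral]
  exact setLIntegral_le_lintegral _ _

/-- `∫ σ |F ρ|²` for an integrable square integrable function, in terms of the Fourier integral. -/
theorem ofReal_integral_symbolB (ρ : L2) (hρ : Integrable ρ) :
    ENNReal.ofReal (∫ ξ, symbolB ξ * ‖(𝓕 ρ : L2) ξ‖ ^ 2) =
      ∫⁻ ξ, ENNReal.ofReal (symbolB ξ) * ‖𝓕 (ρ : Plane → ℂ) ξ‖ₑ ^ 2 := by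
  have hi : Integrable fun ξ => symbolB ξ * ‖(𝓕 ρ : L2) ξ‖ ^ 2 :=
    (integrable_norm_sq (𝓕 ρ : L2)).bdd_mul (c := 1) measurable_symbolB.aestronglyMeasurable
      (Eventually.of_forall fun ξ => by
        rw [Real.norm_of_nonneg (symbolB_nonneg ξ)]; exact symbolB_le_one ξ)
  rw [ofReal_integral_eq_lintegral_ofReal hi
    (Eventually.of_forall fun ξ => mul_nonneg (symbolB_nonneg ξ) (by positivity))]
  refine lintegral_congr_ae ?_
  filter_upwards [fourier_ae_eq ρ hρ] with ξ hξ
  rw [ENNReal.ofReal_mul (symbolB_nonneg ξ), ENNReal.ofReal_pow (norm_nonneg _), ofReal_norm, hξ]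

theorem fourier_congr_ae {f g : Plane → ℂ} (h : f =ᵐ[volume] g) : 𝓕 f = 𝓕 g := by
  ext ξ
  rw [Real.fourier_eq, Real.fourier_eq]
  refine integral_congr_ae ?_
  filter_upwards [h] with x hx
  rw [hx]

theorem integral_combination {f g h : Plane → ℝ} (hf : Integrable f) (hg : Integrable g)
    (hh : Integrable h) (a b c : ℝ) :
    ∫ y, (a * f y + b * g y - c * h y) = a * (∫ y, f y) + b * (∫ y, g y) - c * ∫ y, h y := by
  rw [integral_sub (f := fun y => a * f y + b * g y)
    ((hf.const_mul a).add (hg.const_mul b)) (hh.const_mul c),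
    integral_add (hf.const_mul a) (hg.const_mul b), integral_const_mul, integral_const_mul,
    integral_const_mul]

section Averaging

variable {χ η : 𝓢(Plane, ℂ)} {R b : ℝ}

theorem mulConj_localize_ae (hη : ∀ x, η x = ((‖χ x‖ ^ 2 : ℝ) : ℂ)) (v : H1) (y : Plane) :
    (v.localize χ y).mulConj (v.localize χ y) =ᵐ[volume] fun x => η (x - y) * v.mulConj v x := by
  filter_upwards [H1.absSq_fn_ae (v.localize χ y), H1.absSq_fn_ae v,
    H1.fn_smulSchwartz_ae (χ.compSubConstCLM ℂ y) v] with x h1 h2 h3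
  rw [h1, h2, H1.localize, h3, SchwartzMap.compSubConstCLM_apply, hη, norm_mul, mul_pow,
    Complex.ofReal_mul]

theorem norm_mulConj_localize_sq (hη : ∀ x, η x = ((‖χ x‖ ^ 2 : ℝ) : ℂ)) (v : H1) (y : Plane) :
    ‖(v.localize χ y).mulConj (v.localize χ y)‖ ^ 2 =
      ∫ x, ‖η (x - y)‖ ^ 2 * ‖v.mulConj v x‖ ^ 2 := by
  rw [norm_L2_sq]
  refine integral_congr_ae ?_
  filter_upwards [mulConj_localize_ae hη v y] with x hx
  rw [hx, norm_mul, mul_pow]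

theorem ofReal_integral_symbolB_localize (hη : ∀ x, η x = ((‖χ x‖ ^ 2 : ℝ) : ℂ)) (v : H1)
    (y : Plane) : ENNReal.ofReal (∫ ξ, symbolB ξ *
      ‖(𝓕 ((v.localize χ y).mulConj (v.localize χ y)) : L2) ξ‖ ^ 2) =
      ∫⁻ ξ, ENNReal.ofReal (symbolB ξ) * ‖localFourier η (v.mulConj v) y ξ‖ₑ ^ 2 := by
  rw [ofReal_integral_symbolB _ (H1.integrable_mulConj _ _),
    fourier_congr_ae (mulConj_localize_ae hη v y)]
  rfl

theorem norm_fn_localize_sq_le (hχ1 : ∀ x, ‖χ x‖ ≤ 1) (hχR : ∀ x, R < ‖x‖ → χ x = 0) {μ : ℝ}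
    (hμ : 0 ≤ μ) (v : H1) (y : Plane) (hv : massIn v.fn y R ≤ ENNReal.ofReal μ) :
    ‖(v.localize χ y).fn‖ ^ 2 ≤ μ := by
  rw [← ENNReal.ofReal_le_ofReal_iff hμ]
  refine le_trans ?_ hv
  rw [ofReal_norm_sq_eq_lintegral, massIn, ← lintegral_indicator measurableSet_closedBall]
  refine lintegral_mono_ae ?_
  filter_upwards [H1.fn_smulSchwartz_ae (χ.compSubConstCLM ℂ y) v] with x hx
  rw [H1.localize, hx, SchwartzMap.compSubConstCLM_apply]
  by_cases h : x ∈ Metric.closedBall y R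
  · rw [Set.indicator_of_mem h]
    gcongr
    rw [enorm_mul]
    refine mul_le_of_le_one_left zero_le ?_
    rw [← ofReal_norm, ENNReal.ofReal_le_one]
    exact hχ1 _
  · rw [hχR (x - y) (by simpa [dist_eq_norm] using h)]
    simp

theorem norm_grad_localize_sq_le (hχ1 : ∀ x, ‖χ x‖ ≤ 1) (hχb : ∀ x, ‖fderiv ℝ χ x‖ ≤ b) {s : ℝ}
    (hs : 0 < s) (v : H1) (y : Plane) :
    ‖(v.localize χ y).grad‖ ^ 2 ≤
      (1 + s) * (∫ x, ‖χ (x - y)‖ ^ 2 * (∑ j, ‖v.grad j x‖ ^ 2)) +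
      (1 + 1 / s) * (2 * ∫ x, ‖fderiv ℝ χ (x - y)‖ ^ 2 * ‖v.fn x‖ ^ 2) := by
  have hcoe : (χ.compSubConstCLM ℂ y : Plane → ℂ) = fun x => χ (x - y) := by
    ext x
    exact SchwartzMap.compSubConstCLM_apply χ y x
  have hfd : ∀ x, fderiv ℝ (χ.compSubConstCLM ℂ y) x = fderiv ℝ χ (x - y) := fun x => by
    rw [hcoe, fderiv_comp_sub]
  have h := H1.norm_grad_smulSchwartz_le (a := 1) (b := b) hs (χ.compSubConstCLM ℂ y) v
    (fun x => by rw [SchwartzMap.compSubConstCLM_apply]; exact hχ1 _)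
    (fun x => by rw [hfd]; exact hχb _)
  simp only [hfd, SchwartzMap.compSubConstCLM_apply] at h
  exact h

/-- The optimal inequality for all localised functions, integrated over the centre y. The ν-term
averages exactly whatever its sign, and γ > 0 means that only a lower bound for the averaged
nonlocal term is needed. -/
theorem averaged_inequality {ν γ C : ℝ} (hγ : 0 < γ) (hC : 0 ≤ C)
    (hopt : ∀ w : H1, quartic ν γ w ≤ C * ‖w.grad‖ ^ 2 * ‖w.fn‖ ^ 2)
    (hχ1 : ∀ x, ‖χ x‖ ≤ 1) (hχR : ∀ x, R < ‖x‖ → χ x = 0) (hχb : ∀ x, ‖fderiv ℝ χ x‖ ≤ b)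
    (hη : ∀ x, η x = ((‖χ x‖ ^ 2 : ℝ) : ℂ)) {κ : ℝ} (hκ : 0 ≤ κ)
    (hηκ : ∫⁻ ζ, ENNReal.ofReal ‖ζ‖ * ‖𝓕 η ζ‖ₑ ^ 2 ≤ ENNReal.ofReal κ)
    {s : ℝ} (hs : 0 < s) {δ : ℝ} (hδ : 0 < δ) {μ : ℝ} (hμ : 0 ≤ μ) (v : H1)
    (hv : ∀ y, massIn v.fn y R ≤ ENNReal.ofReal μ) :
    (∫ x, ‖η x‖ ^ 2) * quartic ν γ v ≤
      C * μ * ((1 + s) * ((∫ x, ‖χ x‖ ^ 2) * ‖v.grad‖ ^ 2) +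
        (1 + 1 / s) * (2 * ((∫ x, ‖fderiv ℝ χ x‖ ^ 2) * ‖v.fn‖ ^ 2))) +
      γ * ((∫ x, ‖η x‖ ^ 2) * (‖v.fn‖ ^ 4 * (discArea * δ ^ 2)) +
        κ / δ * ‖v.mulConj v‖ ^ 2) := by
  set ρ := v.mulConj v with hρ
  have hρi : Integrable ρ := H1.integrable_mulConj v v
  have iχ : Integrable fun x => ‖χ x‖ ^ 2 := (χ.memLp 2 volume).integrable_norm_pow (by norm_num)
  have iη : Integrable fun x => ‖η x‖ ^ 2 := (η.memLp 2 volume).integrable_norm_pow (by norm_num)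
  have iD : Integrable fun x => ‖fderiv ℝ χ x‖ ^ 2 :=
    ((SchwartzMap.fderivCLM ℝ Plane ℂ χ).memLp 2 volume).integrable_norm_pow (by norm_num)
  have ig : Integrable fun x => ∑ j, ‖v.grad j x‖ ^ 2 :=
    integrable_finsetSum _ fun j _ => integrable_norm_sq _
  have eg : ∫ x, ∑ j, ‖v.grad j x‖ ^ 2 = ‖v.grad‖ ^ 2 := by
    rw [integral_finsetSum _ fun j _ => integrable_norm_sq _, H1.norm_grad_sq]
    simp only [norm_L2_sq]
  obtain ⟨iP, eP⟩ := integral_translate_mul iχ ig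
  obtain ⟨iS, eS⟩ := integral_translate_mul iD (integrable_norm_sq v.fn)
  obtain ⟨iT, eT⟩ := integral_translate_mul iη (integrable_norm_sq ρ)
  rw [eg] at eP
  rw [← norm_L2_sq] at eS eT
  set A₄ := ∫ x, ‖η x‖ ^ 2 with hA₄
  have hA₄0 : 0 ≤ A₄ := integral_nonneg fun x => by positivity
  set T₂ : Plane → ℝ := fun y => ∫ ξ, symbolB ξ *
    ‖(𝓕 ((v.localize χ y).mulConj (v.localize χ y)) : L2) ξ‖ ^ 2 with hT₂
  have hT₂0 : ∀ y, 0 ≤ T₂ y := fun y => integral_nonneg fun ξ =>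
    mul_nonneg (symbolB_nonneg ξ) (by positivity)
  set B : Plane → ℝ := fun y => C * μ * ((1 + s) * (∫ x, ‖χ (x - y)‖ ^ 2 *
      (∑ j, ‖v.grad j x‖ ^ 2)) + (1 + 1 / s) * (2 * ∫ x, ‖fderiv ℝ χ (x - y)‖ ^ 2 *
      ‖v.fn x‖ ^ 2)) - ν * ∫ x, ‖η (x - y)‖ ^ 2 * ‖ρ x‖ ^ 2 with hB
  -- Mass at most μ in every disc turns the factor ‖·‖₂² of the optimal inequality into μ; the local
  -- quartic term is moved to the right-hand side.
  have hTB : ∀ y, γ * T₂ y ≤ B y := fun y => by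
    have h1 := hopt (v.localize χ y)
    rw [quartic_eq_fourier, norm_mulConj_localize_sq hη] at h1
    have h2 : C * ‖(v.localize χ y).grad‖ ^ 2 * ‖(v.localize χ y).fn‖ ^ 2 ≤
        C * μ * ‖(v.localize χ y).grad‖ ^ 2 := by
      rw [mul_assoc, mul_assoc C μ, mul_comm μ]
      gcongr
      exact norm_fn_localize_sq_le hχ1 hχR hμ v y (hv y)
    have h3 := mul_le_mul_of_nonneg_left (norm_grad_localize_sq_le hχ1 hχb hs v y)
      (mul_nonneg hC hμ)
    simp only [hB, hT₂]
    linarith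
  have iB : Integrable B :=
    (((iP.const_mul _).add ((iS.const_mul 2).const_mul _)).const_mul _).sub (iT.const_mul _)
  have eB : ∫ y, B y = C * μ * ((1 + s) * ((∫ x, ‖χ x‖ ^ 2) * ‖v.grad‖ ^ 2) +
      (1 + 1 / s) * (2 * ((∫ x, ‖fderiv ℝ χ x‖ ^ 2) * ‖v.fn‖ ^ 2))) - ν * (A₄ * ‖ρ‖ ^ 2) := by
    have h1 := integral_combination iP iS iT (C * μ * (1 + s)) (C * μ * ((1 + 1 / s) * 2)) ν
    rw [eP, eS, eT] at h1
    refine Eq.trans (integral_congr_ae (Eventually.of_forall fun y => ?_)) (h1.trans ?_)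
    · simp only [hB]
      ring
    · ring
  have hBnn : ∀ y, 0 ≤ B y := fun y => (mul_nonneg hγ.le (hT₂0 y)).trans (hTB y)
  -- Comparison of lower integrals avoids any question of integrability of `T₂`.
  have hBT : ENNReal.ofReal γ * ∫⁻ y, ENNReal.ofReal (T₂ y) ≤ ENNReal.ofReal (∫ y, B y) := by
    rw [ofReal_integral_eq_lintegral_ofReal iB (Eventually.of_forall hBnn),
      ← lintegral_const_mul' _ _ ENNReal.ofReal_ne_top]
    refine lintegral_mono fun y => ?_
    rw [← ENNReal.ofReal_mul hγ.le]
    exact ENNReal.ofReal_le_ofReal (hTB y)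
  set T := ∫ ξ, symbolB ξ * ‖(𝓕 ρ : L2) ξ‖ ^ 2 with hT
  have hT0 : 0 ≤ T := integral_nonneg fun ξ => mul_nonneg (symbolB_nonneg ξ) (by positivity)
  have hηA : ∫⁻ ζ, ‖𝓕 η ζ‖ₑ ^ 2 = ENNReal.ofReal A₄ := by
    have h1 := lintegral_fourier_sq η.integrable (η.memLp 2 volume)
    have h2 : ∀ ζ, 𝓕 (η : Plane → ℂ) ζ = 𝓕 η ζ := fun ζ => by rw [SchwartzMap.fourier_coe]
    simp only [h2] at h1
    rw [h1, ofReal_integral_eq_lintegral_ofReal iη (Eventually.of_forall fun x => by positivity)]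
    refine lintegral_congr fun x => ?_
    rw [ENNReal.ofReal_pow (norm_nonneg _), ofReal_norm]
  have hρA : ∫⁻ ξ, ‖𝓕 (ρ : Plane → ℂ) ξ‖ₑ ^ 2 = ENNReal.ofReal (‖ρ‖ ^ 2) := by
    rw [lintegral_fourier_sq hρi (Lp.memLp ρ), ofReal_norm_sq_eq_lintegral]
  -- The transform of |v|² is bounded by ‖v‖₂², so a small disc of frequencies carries little.
  have hlow : ∫⁻ ξ in Metric.closedBall (0 : Plane) δ, ‖𝓕 (ρ : Plane → ℂ) ξ‖ₑ ^ 2 ≤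
      ENNReal.ofReal (‖v.fn‖ ^ 4 * (discArea * δ ^ 2)) := by
    have h1 : ∀ ξ, ‖𝓕 (ρ : Plane → ℂ) ξ‖ₑ ^ 2 ≤ ENNReal.ofReal (‖v.fn‖ ^ 4) := fun ξ => by
      rw [← ofReal_norm, ← ENNReal.ofReal_pow (norm_nonneg _)]
      refine ENNReal.ofReal_le_ofReal ?_
      have h2 := norm_fourier_le (f := ρ) ξ
      rw [hρ, H1.integral_norm_mulConj_self] at h2
      calc _ ≤ (‖v.fn‖ ^ 2) ^ 2 := by gcongr
        _ = _ := by ring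
    refine (lintegral_mono h1).trans_eq ?_
    rw [setLIntegral_const, ENNReal.ofReal_mul (by positivity), mul_comm discArea, ← volume_real_closedBall hδ.le,
      measureReal_def, ENNReal.ofReal_toReal measure_closedBall_lt_top.ne]
  have hhigh : ∫⁻ ζ, ENNReal.ofReal (‖ζ‖ / δ) * ‖𝓕 η ζ‖ₑ ^ 2 ≤ ENNReal.ofReal (κ / δ) := by
    have h1 : ∀ ζ : Plane, ENNReal.ofReal (‖ζ‖ / δ) * ‖𝓕 η ζ‖ₑ ^ 2 =
        ENNReal.ofReal δ⁻¹ * (ENNReal.ofReal ‖ζ‖ * ‖𝓕 η ζ‖ₑ ^ 2) := fun ζ => by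
      rw [div_eq_inv_mul, ENNReal.ofReal_mul (by positivity), mul_assoc]
    simp only [h1]
    rw [lintegral_const_mul' _ _ ENNReal.ofReal_ne_top, div_eq_inv_mul,
      ENNReal.ofReal_mul (by positivity)]
    gcongr
  have hmain := le_lintegral_symbolB_localFourier η hρi hδ
  have hloc : ∀ y, ∫⁻ ξ, ENNReal.ofReal (symbolB ξ) * ‖localFourier η ρ y ξ‖ₑ ^ 2 =
      ENNReal.ofReal (T₂ y) := fun y => (ofReal_integral_symbolB_localize hη v y).symm
  simp only [hloc] at hmain
  rw [← ofReal_integral_symbolB ρ hρi, hηA, hρA] at hmain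
  have hfin : ENNReal.ofReal (γ * (A₄ * T)) ≤ ENNReal.ofReal ((∫ y, B y) +
      γ * (A₄ * (‖v.fn‖ ^ 4 * (discArea * δ ^ 2)) + κ / δ * ‖ρ‖ ^ 2)) := by
    have hd := discArea_pos
    rw [ENNReal.ofReal_add (integral_nonneg hBnn) (by positivity), ENNReal.ofReal_mul hγ.le,
      ENNReal.ofReal_mul hA₄0, ENNReal.ofReal_mul hγ.le]
    calc ENNReal.ofReal γ * (ENNReal.ofReal A₄ * ENNReal.ofReal T)
        ≤ ENNReal.ofReal γ * (_ + _) := mul_le_mul_right hmain _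
      _ ≤ _ := by
        rw [mul_add]
        gcongr
        rw [ENNReal.ofReal_add (by positivity) (by positivity), ENNReal.ofReal_mul hA₄0,
          ENNReal.ofReal_mul (p := κ / δ) (by positivity)]
        gcongr
  rw [ENNReal.ofReal_le_ofReal_iff, eB] at hfin
  · rw [quartic_eq_fourier]
    linarith
  · have hd := discArea_pos
    have : 0 ≤ ∫ y, B y := integral_nonneg hBnn
    positivity

end Averaging

/-! ### Concentration -/

/-- The first moment is interpolated between ‖η‖₂² and ‖∇η‖₂² by |ζ| ≤ (1/R + R|ζ|²)/2, balanced at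
the scale R of the cutoff. -/
theorem lintegral_weight_fourier_le (η : 𝓢(Plane, ℂ)) {R : ℝ} (hR : 0 < R) {A D : ℝ}
    (hA : ∫ x, ‖η x‖ ^ 2 ≤ A) (hD : ∫ x, ‖fderiv ℝ η x‖ ^ 2 ≤ D) :
    ∫⁻ ζ, ENNReal.ofReal ‖ζ‖ * ‖𝓕 η ζ‖ₑ ^ 2 ≤ ENNReal.ofReal (A / R + R * D) := by
  have hpi3 := Real.pi_gt_three
  set w := H1.ofSchwartz η with hw
  have hwf : w.fn =ᵐ[volume] η := η.coeFn_toLp 2 volume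
  have iη : Integrable fun x => ‖η x‖ ^ 2 := (η.memLp 2 volume).integrable_norm_pow (by norm_num)
  have iD : Integrable fun x => ‖fderiv ℝ η x‖ ^ 2 :=
    ((SchwartzMap.fderivCLM ℝ Plane ℂ η).memLp 2 volume).integrable_norm_pow (by norm_num)
  have hF : (𝓕 w.fn : L2) =ᵐ[volume] fun ζ => 𝓕 η ζ := by
    rw [hw, H1.fn_ofSchwartz, SchwartzMap.toLp_fourier_eq]
    exact (𝓕 η).coeFn_toLp 2 volume
  have h1 : ‖w.fn‖ ^ 2 ≤ A := by
    refine le_trans (le_of_eq ?_) hA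
    rw [norm_L2_sq]
    refine integral_congr_ae ?_
    filter_upwards [hwf] with x hx
    rw [hx]
  have h2 : ‖w.grad‖ ^ 2 ≤ 2 * D := by
    rw [H1.norm_grad_sq, Fin.sum_univ_two]
    have h3 : ∀ j, ‖w.grad j‖ ^ 2 ≤ D := fun j => by
      refine le_trans ?_ hD
      rw [norm_L2_sq]
      refine integral_mono_ae (integrable_norm_sq _) iD ?_
      filter_upwards [(∂_{EuclideanSpace.single j (1 : ℝ)} η : 𝓢(Plane, ℂ)).coeFn_toLp 2 volume]
        with x hx
      rw [hw, H1.grad_ofSchwartz, hx]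
      have := norm_lineDeriv_le η j x
      gcongr
    linarith [h3 0, h3 1]
  have iF := integrable_norm_sq (𝓕 w.fn : L2)
  obtain ⟨iG, eG⟩ := H1.fourier_norm_grad_sq w
  have h4 : ∫⁻ ζ, ENNReal.ofReal ‖ζ‖ * ‖𝓕 η ζ‖ₑ ^ 2 ≤
      ∫⁻ ζ, ENNReal.ofReal (1 / R * ‖(𝓕 w.fn : L2) ζ‖ ^ 2 +
        R / 2 * ((4 * Real.pi ^ 2 * ‖ζ‖ ^ 2) * ‖(𝓕 w.fn : L2) ζ‖ ^ 2)) := by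
    refine lintegral_mono_ae ?_
    filter_upwards [hF] with ζ hζ
    rw [← hζ, ← ofReal_norm, ← ENNReal.ofReal_pow (norm_nonneg _),
      ← ENNReal.ofReal_mul (norm_nonneg _)]
    refine ENNReal.ofReal_le_ofReal ?_
    rw [← mul_assoc, ← add_mul]
    gcongr
    have h5 : 2 * ‖ζ‖ ≤ 1 / R + R * ‖ζ‖ ^ 2 := by
      have h6 : 1 / R + R * ‖ζ‖ ^ 2 - 2 * ‖ζ‖ = (1 - R * ‖ζ‖) ^ 2 / R := by
        field_simp
        ring
      have h7 : 0 ≤ (1 - R * ‖ζ‖) ^ 2 / R := by positivity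
      linarith
    have h8 : R * ‖ζ‖ ^ 2 ≤ R * ‖ζ‖ ^ 2 * Real.pi ^ 2 :=
      le_mul_of_one_le_right (by positivity) (one_le_pow₀ (by linarith))
    have h9 : 0 ≤ 1 / R := by positivity
    nlinarith
  have iI : Integrable fun ζ : Plane => 1 / R * ‖(𝓕 w.fn : L2) ζ‖ ^ 2 +
      R / 2 * ((4 * Real.pi ^ 2 * ‖ζ‖ ^ 2) * ‖(𝓕 w.fn : L2) ζ‖ ^ 2) :=
    (iF.const_mul _).add (iG.const_mul _)
  refine h4.trans ?_
  rw [← ofReal_integral_eq_lintegral_ofReal iI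
    (Eventually.of_forall fun ζ => by positivity)]
  refine ENNReal.ofReal_le_ofReal ?_
  rw [integral_add (iF.const_mul _) (iG.const_mul _), integral_const_mul, integral_const_mul, ← eG,
    ← H1.norm_fn_sq_fourier]
  calc 1 / R * ‖w.fn‖ ^ 2 + R / 2 * ‖w.grad‖ ^ 2 ≤ 1 / R * A + R / 2 * (2 * D) := by gcongr
    _ = _ := by ring

theorem integral_le_of_bound_support {f : Plane → ℝ} {R c : ℝ} (hR : 0 ≤ R)
    (hc : ∀ x, f x ≤ c) (h0 : ∀ x, R < ‖x‖ → f x = 0) (hf : Integrable f) :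
    ∫ x, f x ≤ c * (R ^ 2 * discArea) := by
  have h1 : ∫ x, f x = ∫ x in Metric.closedBall (0 : Plane) R, f x := by
    refine (setIntegral_eq_integral_of_forall_compl_eq_zero fun x hx => h0 x ?_).symm
    simpa using hx
  rw [h1, ← volume_real_closedBall hR]
  refine (setIntegral_mono_on hf.integrableOn
    (integrableOn_const measure_closedBall_lt_top.ne) measurableSet_closedBall
    fun x _ => hc x).trans_eq ?_
  rw [setIntegral_const, smul_eq_mul, mul_comm]

/-- The averaged inequality divided by R²‖∇v‖² and the area of the unit disc. Every error depends on
R and ‖∇v‖ only through a negative power of their product, which is the quantity assumed to diverge.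
-/
theorem exists_concentration_bound {ν γ C θ : ℝ} (hγ : 0 < γ) (hC : 0 ≤ C)
    (hopt : ∀ w : H1, quartic ν γ w ≤ C * ‖w.grad‖ ^ 2 * ‖w.fn‖ ^ 2) (h0 : 0 < θ) (h1 : θ < 1) :
    ∃ L : ℝ, ∀ (v : H1) (R μ : ℝ), 0 < R → 0 ≤ μ → 0 < ‖v.grad‖ → 0 ≤ quartic ν γ v →
      (∀ y, massIn v.fn y R ≤ ENNReal.ofReal μ) →
      (1 - θ) ^ 2 * (quartic ν γ v / ‖v.grad‖ ^ 2) ≤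
        C * μ * ((1 + θ) + L * ‖v.fn‖ ^ 2 * ((R * ‖v.grad‖) ^ 2)⁻¹) +
        γ * (discArea * ‖v.fn‖ ^ 4 * (R * ‖v.grad‖)⁻¹ +
          L * ‖v.fn‖ ^ 2 * (√(R * ‖v.grad‖))⁻¹) := by
  obtain ⟨K, hK, hcut⟩ := exists_cutoff h0 h1
  have hk := ladyK_nonneg
  have ha := discArea_pos
  set L₁ := (1 + 1 / θ) * (2 * K ^ 2) with hL₁
  set L₂ := (1 + 4 * K ^ 2) * ladyK ^ 2 with hL₂
  have hL₁0 : 0 ≤ L₁ := by positivity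
  have hL₂0 : 0 ≤ L₂ := by positivity
  refine ⟨L₁ + L₂, fun v R μ hR hμ hG hQ hv => ?_⟩
  obtain ⟨χ, η, hχ1, hχin, hχR, hχb, hχdR, hη, hηb, hηdR⟩ := hcut R hR
  set G := ‖v.grad‖ with hGdef
  set m := ‖v.fn‖ with hm
  set Q := quartic ν γ v with hQdef
  set a := discArea with hadef
  have iχ : Integrable fun x => ‖χ x‖ ^ 2 := (χ.memLp 2 volume).integrable_norm_pow (by norm_num)
  have iη : Integrable fun x => ‖η x‖ ^ 2 := (η.memLp 2 volume).integrable_norm_pow (by norm_num)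
  have iD : Integrable fun x => ‖fderiv ℝ χ x‖ ^ 2 :=
    ((SchwartzMap.fderivCLM ℝ Plane ℂ χ).memLp 2 volume).integrable_norm_pow (by norm_num)
  have iD' : Integrable fun x => ‖fderiv ℝ η x‖ ^ 2 :=
    ((SchwartzMap.fderivCLM ℝ Plane ℂ η).memLp 2 volume).integrable_norm_pow (by norm_num)
  have hηn : ∀ x, ‖η x‖ = ‖χ x‖ ^ 2 := fun x => by
    rw [hη, Complex.norm_real, Real.norm_of_nonneg (by positivity)]
  have A₂ : ∫ x, ‖χ x‖ ^ 2 ≤ 1 * (R ^ 2 * a) :=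
    integral_le_of_bound_support hR.le (fun x => pow_le_one₀ (norm_nonneg _) (hχ1 x))
      (fun x hx => by simp [hχR x hx]) iχ
  have A₄ : ∫ x, ‖η x‖ ^ 2 ≤ 1 * (R ^ 2 * a) :=
    integral_le_of_bound_support hR.le (fun x => pow_le_one₀ (norm_nonneg _) (by
      rw [hηn]; exact pow_le_one₀ (norm_nonneg _) (hχ1 x)))
      (fun x hx => by simp [hηn, hχR x hx]) iη
  have D : ∫ x, ‖fderiv ℝ χ x‖ ^ 2 ≤ (K / R) ^ 2 * (R ^ 2 * a) :=
    integral_le_of_bound_support hR.le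
      (fun x => pow_le_pow_left₀ (norm_nonneg _) (hχb x) 2)
      (fun x hx => by simp [hχdR x hx]) iD
  have D' : ∫ x, ‖fderiv ℝ η x‖ ^ 2 ≤ (2 * K / R) ^ 2 * (R ^ 2 * a) :=
    integral_le_of_bound_support hR.le
      (fun x => pow_le_pow_left₀ (norm_nonneg _) (hηb x) 2)
      (fun x hx => by simp [hηdR x hx]) iD'
  have A₄low : ((1 - θ) * R) ^ 2 * a ≤ ∫ x, ‖η x‖ ^ 2 := by
    rw [← volume_real_closedBall (by nlinarith : 0 ≤ (1 - θ) * R)]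
    calc volume.real (Metric.closedBall (0 : Plane) ((1 - θ) * R))
        = ∫ x in Metric.closedBall (0 : Plane) ((1 - θ) * R), ‖η x‖ ^ 2 := by
          rw [setIntegral_congr_fun (g := fun _ => (1 : ℝ)) measurableSet_closedBall
            (fun x hx => by
              simp only
              rw [hηn, hχin x (by simpa using hx)]
              simp)]
          simp
      _ ≤ _ := setIntegral_le_integral iη (Eventually.of_forall fun x => by positivity)
  have hκ := lintegral_weight_fourier_le η hR A₄ D'
  have eκ : 1 * (R ^ 2 * a) / R + R * ((2 * K / R) ^ 2 * (R ^ 2 * a)) =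
      a * R * (1 + 4 * K ^ 2) := by
    field_simp
    ring
  rw [eκ] at hκ
  set X := R * G with hX
  have hX0 : 0 < X := by positivity
  have hsX : 0 < √X := Real.sqrt_pos.2 hX0
  have hsX2 : √X ^ 2 = X := Real.sq_sqrt hX0.le
  -- The choice δ = G/√X makes both nonlocal errors small: the low-frequency one is of order δ²/G² =
  -- 1/X, the first-moment one of order 1/(Rδ) = 1/√X.
  have key := averaged_inequality hγ hC hopt hχ1 hχR hχb hη (by positivity) hκ h0
    (show 0 < G / √X by positivity) hμ v hv
  have hρ : ‖v.mulConj v‖ ^ 2 ≤ ladyK ^ 2 * m ^ 2 * G ^ 2 := by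
    have := H1.norm_mulConj_self_le v
    calc ‖v.mulConj v‖ ^ 2 ≤ (ladyK * (m * G)) ^ 2 := by gcongr
      _ = _ := by ring
  have hup : ((1 - θ) * R) ^ 2 * a * Q ≤
      C * μ * ((1 + θ) * ((1 * (R ^ 2 * a)) * G ^ 2) +
        (1 + 1 / θ) * (2 * (((K / R) ^ 2 * (R ^ 2 * a)) * m ^ 2))) +
      γ * ((1 * (R ^ 2 * a)) * (m ^ 4 * (a * (G / √X) ^ 2)) +
        a * R * (1 + 4 * K ^ 2) / (G / √X) * (ladyK ^ 2 * m ^ 2 * G ^ 2)) := by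
    refine (mul_le_mul_of_nonneg_right A₄low hQ).trans (key.trans ?_)
    gcongr
  have e1 : C * μ * ((1 + θ) * ((1 * (R ^ 2 * a)) * G ^ 2) +
        (1 + 1 / θ) * (2 * (((K / R) ^ 2 * (R ^ 2 * a)) * m ^ 2))) +
      γ * ((1 * (R ^ 2 * a)) * (m ^ 4 * (a * (G / √X) ^ 2)) +
        a * R * (1 + 4 * K ^ 2) / (G / √X) * (ladyK ^ 2 * m ^ 2 * G ^ 2)) =
      (R ^ 2 * a * G ^ 2) * (C * μ * ((1 + θ) + L₁ * m ^ 2 * (X ^ 2)⁻¹) +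
        γ * (a * m ^ 4 * X⁻¹ + L₂ * m ^ 2 * (√X)⁻¹)) := by
    have e2 : (G / √X) ^ 2 = G ^ 2 * X⁻¹ := by rw [div_pow, hsX2, div_eq_mul_inv]
    have e3 : a * R * (1 + 4 * K ^ 2) / (G / √X) =
        R ^ 2 * a * (1 + 4 * K ^ 2) * (√X)⁻¹ := by
      rw [div_div_eq_mul_div, div_eq_iff hG.ne', ← div_eq_mul_inv, div_mul_eq_mul_div,
        eq_div_iff hsX.ne', mul_assoc, ← pow_two, hsX2, hX]
      ring
    have e4 : (K / R) ^ 2 * (R ^ 2 * a) = R ^ 2 * a * G ^ 2 * K ^ 2 * (X ^ 2)⁻¹ := by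
      rw [hX]
      field_simp
    rw [e2, e3, e4, hL₁, hL₂]
    ring
  rw [e1] at hup
  have e5 : ((1 - θ) * R) ^ 2 * a * Q =
      (R ^ 2 * a * G ^ 2) * ((1 - θ) ^ 2 * (Q / G ^ 2)) := by
    field_simp
  rw [e5] at hup
  refine (le_of_mul_le_mul_left hup (by positivity)).trans ?_
  gcongr
  · linarith
  · linarith

/-- The infimum is itself admissible: where ‖∇w‖‖w‖ > 0 the inequality bounds each admissible
constant below by a fixed quotient, and where the product vanishes the a priori bound makes both
sides zero or better. -/
theorem quartic_le_Copt (ν γ : ℝ) (w : H1) :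
    quartic ν γ w ≤ Copt ν γ * ‖w.grad‖ ^ 2 * ‖w.fn‖ ^ 2 := by
  have hne : {C : ℝ | ∀ v : H1, quartic ν γ v ≤ C * ‖v.grad‖ ^ 2 * ‖v.fn‖ ^ 2}.Nonempty :=
    ⟨_, fun v => (le_abs_self _).trans (abs_quartic_le ν γ v)⟩
  rcases (show 0 ≤ ‖w.grad‖ ^ 2 * ‖w.fn‖ ^ 2 by positivity).eq_or_lt with h | h
  · have h1 := (le_abs_self _).trans (abs_quartic_le ν γ w)
    rw [mul_assoc, ← h, mul_zero] at h1
    rw [mul_assoc, ← h, mul_zero]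
    exact h1
  · rw [mul_assoc, ← div_le_iff₀ h]
    refine le_csInf hne fun C hC => ?_
    rw [div_le_iff₀ h, ← mul_assoc]
    exact hC w

/-- A near-maximiser suffices as the centre; its slack will be T − t, which disappears in the limit.
-/
theorem exists_near_max_massIn (f : L2) (r : ℝ) {ε : ℝ} (hε : 0 < ε) :
    ∃ y, ∀ z, massIn f z r ≤ massIn f y r + ENNReal.ofReal ε := by
  set S := ⨆ z, massIn f z r with hS
  have hSt : S ≠ ⊤ := ne_top_of_le_ne_top ENNReal.ofReal_ne_top
    (iSup_le fun z => massIn_le f z r)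
  rcases eq_or_ne S 0 with h | h
  · refine ⟨0, fun z => ?_⟩
    have : massIn f z r ≤ S := le_iSup (fun z => massIn f z r) z
    rw [h] at this
    exact this.trans zero_le
  · have hlt : S - ENNReal.ofReal ε < S :=
      ENNReal.sub_lt_self hSt h (ENNReal.ofReal_pos.2 hε).ne'
    obtain ⟨y, hy⟩ := lt_iSup_iff.1 hlt
    refine ⟨y, fun z => (le_iSup (fun z => massIn f z r) z).trans ?_⟩
    exact tsub_le_iff_right.1 hy.le

/-- If every disc had mass at most b' < 2/C, the localised bound would give, in the limit, 2(1−θ)² ≤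
C b'(1+θ), which is false for small θ. -/
theorem concentration {ν γ T : ℝ} (hγ : 0 < γ) (hT : 0 < T) {u : ℝ → H1} {lam : ℝ → ℝ}
    {m E C : ℝ} (hC : 0 < C)
    (hopt : ∀ w : H1, quartic ν γ w ≤ C * ‖w.grad‖ ^ 2 * ‖w.fn‖ ^ 2)
    (hm : ∀ t ∈ Set.Ioo 0 T, ‖(u t).fn‖ = m) (hE : ∀ t ∈ Set.Ioo 0 T, energy ν γ (u t) = E)
    (hG : Tendsto (fun t => ‖(u t).grad‖) (𝓝[<] T) atTop)
    (hlam : ∀ t ∈ Set.Ico 0 T, 0 < lam t)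
    (hlG : Tendsto (fun t => lam t * ‖(u t).grad‖) (𝓝[<] T) atTop) :
    ∃ y : ℝ → Plane, ENNReal.ofReal (2 / C) ≤
      liminf (fun t => massIn (u t).fn (y t) (lam t)) (𝓝[<] T) := by
  have hy : ∀ t, ∃ y, t < T → ∀ z, massIn (u t).fn z (lam t) ≤
      massIn (u t).fn y (lam t) + ENNReal.ofReal (T - t) := fun t => by
    by_cases h : t < T
    · obtain ⟨y, hy⟩ := exists_near_max_massIn (u t).fn (lam t) (sub_pos.2 h)
      exact ⟨y, fun _ => hy⟩
    · exact ⟨0, fun h' => absurd h' h⟩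
  choose y hy using hy
  refine ⟨y, le_of_forall_lt fun B hB => ?_⟩
  obtain ⟨B', hBB', hB'⟩ := exists_between hB
  refine hBB'.trans_le ?_
  have hB't : B' ≠ ⊤ := hB'.ne_top
  set b := B'.toReal with hb
  have hbB' : ENNReal.ofReal b = B' := ENNReal.ofReal_toReal hB't
  have hb0 : 0 ≤ b := ENNReal.toReal_nonneg
  have hb2 : b < 2 / C := by
    rw [← hbB'] at hB'
    exact (ENNReal.ofReal_lt_ofReal_iff_of_nonneg hb0).1 hB'
  obtain ⟨b', hbb', hb'2⟩ := exists_between hb2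
  have hb'0 : 0 ≤ b' := hb0.trans hbb'.le
  have hCb' : C * b' < 2 := by
    rw [lt_div_iff₀ hC] at hb'2
    linarith
  obtain ⟨θ, hθ0, hθ1, hθ⟩ : ∃ θ : ℝ, 0 < θ ∧ θ < 1 ∧ C * b' * (1 + θ) < (1 - θ) ^ 2 * 2 := by
    have h1 : ∀ᶠ θ in 𝓝[>] (0 : ℝ), C * b' * (1 + θ) < (1 - θ) ^ 2 * 2 := by
      refine Tendsto.eventually_lt (f := fun θ : ℝ => C * b' * (1 + θ))
        (g := fun θ : ℝ => (1 - θ) ^ 2 * 2) (y := C * b' * (1 + 0)) (z := (1 - 0) ^ 2 * 2)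
        ?_ ?_ (by linarith)
      · exact ((by fun_prop : Continuous fun θ : ℝ => C * b' * (1 + θ)).tendsto 0).mono_left
          nhdsWithin_le_nhds
      · exact ((by fun_prop : Continuous fun θ : ℝ => (1 - θ) ^ 2 * 2).tendsto 0).mono_left
          nhdsWithin_le_nhds
    obtain ⟨θ, h2, h3⟩ := (h1.and (Ioo_mem_nhdsGT one_pos)).exists
    exact ⟨θ, h3.1, h3.2, h2⟩
  obtain ⟨L, hL⟩ := exists_concentration_bound hγ hC.le hopt hθ0 hθ1
  -- Energy conservation reads Q/‖∇u‖² = 2 − 4E/‖∇u‖².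
  have hQ : Tendsto (fun t => (1 - θ) ^ 2 * (quartic ν γ (u t) / ‖(u t).grad‖ ^ 2)) (𝓝[<] T)
      (𝓝 ((1 - θ) ^ 2 * 2)) := by
    have h1 : Tendsto (fun t => 2 - 4 * E * (‖(u t).grad‖ ^ 2)⁻¹) (𝓝[<] T) (𝓝 (2 - 4 * E * 0)) :=
      ((((tendsto_pow_atTop two_ne_zero).comp hG).inv_tendsto_atTop).const_mul _).const_sub _
    rw [mul_zero, sub_zero] at h1
    refine (h1.congr' ?_).const_mul _
    filter_upwards [Ioo_mem_nhdsLT hT, hG.eventually_gt_atTop 0] with t ht hGt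
    rw [← hE t ht, energy]
    field_simp
    ring
  have hX1 : Tendsto (fun t => ((lam t * ‖(u t).grad‖) ^ 2)⁻¹) (𝓝[<] T) (𝓝 0) :=
    ((tendsto_pow_atTop two_ne_zero).comp hlG).inv_tendsto_atTop
  have hX2 : Tendsto (fun t => (lam t * ‖(u t).grad‖)⁻¹) (𝓝[<] T) (𝓝 0) :=
    hlG.inv_tendsto_atTop
  have hX3 : Tendsto (fun t => (√(lam t * ‖(u t).grad‖))⁻¹) (𝓝[<] T) (𝓝 0) :=
    (Real.tendsto_sqrt_atTop.comp hlG).inv_tendsto_atTop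
  have hR : Tendsto (fun t => C * b' * ((1 + θ) + L * m ^ 2 * ((lam t * ‖(u t).grad‖) ^ 2)⁻¹) +
        γ * (discArea * m ^ 4 * (lam t * ‖(u t).grad‖)⁻¹ +
          L * m ^ 2 * (√(lam t * ‖(u t).grad‖))⁻¹)) (𝓝[<] T)
      (𝓝 (C * b' * ((1 + θ) + L * m ^ 2 * 0) +
        γ * (discArea * m ^ 4 * 0 + L * m ^ 2 * 0))) :=
    (((hX1.const_mul _).const_add _).const_mul _).add
      (((hX2.const_mul _).add (hX3.const_mul _)).const_mul _)
  have hev := hR.eventually_lt hQ (by simpa using hθ)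
  refine le_liminf_of_le (by isBoundedDefault) ?_
  -- The last condition makes T − t smaller than b' − b, so the slack of the near-maximal centre
  -- still leaves mass b.
  filter_upwards [hev, Ioo_mem_nhdsLT hT, hG.eventually_gt_atTop 0,
    hQ.eventually_const_lt (show 0 < (1 - θ) ^ 2 * 2 by nlinarith [sq_nonneg (1 - θ)]),
    Ioo_mem_nhdsLT (show T - (b' - b) < T by linarith)] with t h1 ht hGt hQt htb
  have hQ0 : 0 ≤ quartic ν γ (u t) := by
    by_contra! hneg
    have : quartic ν γ (u t) / ‖(u t).grad‖ ^ 2 < 0 := div_neg_of_neg_of_pos hneg (by positivity)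
    nlinarith [sq_nonneg (1 - θ)]
  have hex : ∃ z, ENNReal.ofReal b' < massIn (u t).fn z (lam t) := by
    by_contra! hcon
    have h2 := hL (u t) (lam t) b' (hlam t ⟨ht.1.le, ht.2⟩) hb'0 hGt hQ0 hcon
    rw [hm t ht] at h2
    linarith
  obtain ⟨z, hz⟩ := hex
  have h3 := hz.le.trans (hy t ht.2 z)
  rw [← hbB']
  have h4 : ENNReal.ofReal b + ENNReal.ofReal (T - t) ≤ ENNReal.ofReal b' := by
    rw [← ENNReal.ofReal_add hb0 (by linarith [ht.2])]
    exact ENNReal.ofReal_le_ofReal (by linarith [htb.1])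
  exact (ENNReal.add_le_add_iff_right ENNReal.ofReal_ne_top).1 (h4.trans h3)

/-- The rate gives ‖∇u‖ ≥ √c₀ (T−t)^(−1/2), so the product is at least a constant times (T−t)^(−ε).
-/
theorem tendsto_mul_norm_grad_of_rate {T c₀ c ε : ℝ} {u : ℝ → H1} {lam : ℝ → ℝ} (hc₀ : 0 < c₀)
    (hc : 0 < c) (hε : 0 < ε) (hrate : ∀ᶠ t in 𝓝[<] T, c₀ ≤ ‖(u t).grad‖ ^ 2 * (T - t))
    (hlam : ∀ᶠ t in 𝓝[<] T, c * (T - t) ^ ((1 : ℝ) / 2 - ε) ≤ lam t) :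
    Tendsto (fun t => lam t * ‖(u t).grad‖) (𝓝[<] T) atTop := by
  have h1 : Tendsto (fun t => T - t) (𝓝[<] T) (𝓝[>] 0) := by
    refine tendsto_nhdsWithin_iff.2 ⟨?_, ?_⟩
    · have : Tendsto (fun t => T - t) (𝓝 T) (𝓝 (T - T)) := by
        exact (continuous_const.sub continuous_id).tendsto T
      rw [sub_self] at this
      exact this.mono_left nhdsWithin_le_nhds
    · filter_upwards [self_mem_nhdsWithin] with t ht using sub_pos.2 (Set.mem_Iio.1 ht)
  have h2 : Tendsto (fun t => c * √c₀ * (T - t) ^ (-ε)) (𝓝[<] T) atTop := by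
    refine Tendsto.const_mul_atTop (by positivity) ?_
    exact (tendsto_rpow_neg_nhdsGT_zero (neg_neg_iff_pos.2 hε)).comp h1
  refine tendsto_atTop_mono' _ ?_ h2
  filter_upwards [hrate, hlam, self_mem_nhdsWithin] with t hr hl ht
  have hd : 0 < T - t := sub_pos.2 (Set.mem_Iio.1 ht)
  have h4 : √c₀ * (T - t) ^ (-(1 / 2) : ℝ) ≤ ‖(u t).grad‖ := by
    refine abs_le_of_sq_le_sq' ?_ (norm_nonneg _) |>.2
    rw [mul_pow, Real.sq_sqrt hc₀.le, ← Real.rpow_mul_natCast hd.le]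
    norm_num
    rw [Real.rpow_neg_one, ← div_eq_mul_inv, div_le_iff₀ hd]
    exact hr
  calc c * √c₀ * (T - t) ^ (-ε)
      = (c * (T - t) ^ ((1 : ℝ) / 2 - ε)) * (√c₀ * (T - t) ^ (-(1 / 2) : ℝ)) := by
        have h5 : (T - t) ^ (-ε) = (T - t) ^ ((1 : ℝ) / 2 - ε) * (T - t) ^ (-(1 / 2) : ℝ) := by
          rw [← Real.rpow_add hd]
          congr 1
          ring
        rw [h5]
        ring
    _ ≤ lam t * ‖(u t).grad‖ := by
        have : 0 ≤ (T - t) ^ ((1 : ℝ) / 2 - ε) := by positivity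
        gcongr
        exact le_trans (by positivity) hl

/-- With the energy fixed, a large gradient forces the quartic functional to be positive, and a
nonpositive constant could not bound it. -/
theorem Copt_pos_of_blowUp {ν γ T E : ℝ} {u : ℝ → H1} (hT : 0 < T)
    (hE : ∀ t ∈ Set.Ioo 0 T, energy ν γ (u t) = E)
    (hG : Tendsto (fun t => ‖(u t).grad‖) (𝓝[<] T) atTop) : 0 < Copt ν γ := by
  have hev : ∀ᶠ t in 𝓝[<] T, t ∈ Set.Ioo 0 T := Ioo_mem_nhdsLT hT
  obtain ⟨t, ht, hGt, hGt'⟩ := (hev.and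
    ((hG.eventually_gt_atTop (2 * |E|)).and (hG.eventually_gt_atTop 1))).exists
  have h1 := hE t ht
  rw [energy] at h1
  have h2 : 0 < quartic ν γ (u t) := by
    have := le_abs_self E
    nlinarith
  have h3 := h2.trans_le (quartic_le_Copt ν γ (u t))
  by_contra! hneg
  have : Copt ν γ * ‖(u t).grad‖ ^ 2 * ‖(u t).fn‖ ^ 2 ≤ 0 :=
    mul_nonpos_of_nonpos_of_nonneg (mul_nonpos_of_nonpos_of_nonneg hneg (by positivity))
      (by positivity)
  linarith

theorem blowUp_concentration {ν γ T : ℝ} (hγ : 0 < γ) {u : ℝ → H1}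
    (hu : IsBlowUpSolution ν γ T u) :
    0 < Copt ν γ ∧
    (∀ lam : ℝ → ℝ, (∀ t ∈ Set.Ico 0 T, 0 < lam t) →
      Tendsto (fun t => lam t * ‖(u t).grad‖) (𝓝[<] T) atTop →
      ∃ y : ℝ → Plane, ENNReal.ofReal (2 / Copt ν γ) ≤
        liminf (fun t => massIn (u t).fn (y t) (lam t)) (𝓝[<] T)) ∧
    ∃ c₀ : ℝ, 0 < c₀ ∧ ∀ᶠ t in 𝓝[<] T, c₀ ≤ ‖(u t).grad‖ ^ 2 * (T - t) := by
  obtain ⟨hT, hsol, hblow⟩ := hu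
  obtain ⟨du, hdu⟩ := hsol.exists_weakDerivative
  have hc := hsol.1
  have hT2 : T / 2 ∈ Set.Ioo 0 T := ⟨by linarith, by linarith⟩
  have hm : ∀ t ∈ Set.Ioo 0 T, ‖(u t).fn‖ = ‖(u (T / 2)).fn‖ := fun t ht =>
    hdu.norm_fn_eq hc ht hT2
  have hE : ∀ t ∈ Set.Ioo 0 T, energy ν γ (u t) = energy ν γ (u (T / 2)) := fun t ht =>
    hdu.energy_eq hc ht hT2
  have hG := tendsto_norm_grad hT hm hblow
  have hC := Copt_pos_of_blowUp hT hE hG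
  exact ⟨hC, fun lam hlam hlG => concentration hγ hT hC (quartic_le_Copt ν γ) hm hE hG hlam hlG,
    hdu.exists_rate hT hc hblow⟩

end DaveyStewartson

end

theorem theorem6 (ν γ : ℝ) (hν : ν = 1 ∨ ν = -1) (hγ : 0 < γ)
    (T : ℝ) (u : ℝ → DaveyStewartson.H1)
    (hu : DaveyStewartson.IsBlowUpSolution ν γ T u) :
    0 < DaveyStewartson.Copt ν γ ∧
    (∀ lam : ℝ → ℝ, (∀ t ∈ Set.Ico 0 T, 0 < lam t) →
      Tendsto (fun t => lam t * ‖(u t).grad‖) (𝓝[<] T) atTop →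
      ∃ y : ℝ → DaveyStewartson.Plane,
        ENNReal.ofReal (2 / DaveyStewartson.Copt ν γ) ≤
          liminf (fun t => DaveyStewartson.massIn (u t).fn (y t) (lam t)) (𝓝[<] T)) ∧
    (∀ lam : ℝ → ℝ, (∀ t ∈ Set.Ico 0 T, 0 < lam t) →
      ∀ ε : ℝ, 0 < ε → ∀ c : ℝ, 0 < c →
      (∀ᶠ t in 𝓝[<] T, c * (T - t) ^ ((1 : ℝ) / 2 - ε) ≤ lam t) →
      ∃ y : ℝ → DaveyStewartson.Plane,
        ENNReal.ofReal (2 / DaveyStewartson.Copt ν γ) ≤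
          liminf (fun t => DaveyStewartson.massIn (u t).fn (y t) (lam t)) (𝓝[<] T)) := by
  obtain ⟨hC, ha, c₀, hc₀, hrate⟩ := DaveyStewartson.blowUp_concentration hγ hu
  exact ⟨hC, ha, fun lam hlam ε hε c hc hl =>
    ha lam hlam (DaveyStewartson.tendsto_mul_norm_grad_of_rate hc₀ hc hε hrate hl)⟩
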